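/- Let $R$ be a finite chain ring whose maximal ideal is generated by $\pi$, with residue field of size $q$ and chain length $s$ (the least $s\ge 1$ with $\pi^s=0$), and fix a complete set of residues modulo $\pi$ containing $0$. An $s$-shape is a sequence $\mu=(\mu_1\le\dots\le\mu_s)$ of non-negative integers, $|\mu|=\sum_i\mu_i$; $R^\mu$ is the module $\langle 1\rangle^{\mu_1}\times\langle\pi\rangle^{\mu_2-\mu_1}\times\dots\times\langle\pi^{s-1}\rangle^{\mu_s-\mu_{s-1}}$, its elements being tuples of length $m=\mu_s$. The shape of a matrix is the shape $\kappa$ for which its row span is isomorphic to $R^\kappa$; an integer $t$ is identified with the shape $(t,\dots,t)$. $R^{n\times\mu}$ is the set of $n\times m$ matrices with rows in $R^\mu$, and $\mathcal T_\kappa(R^{n\times\mu})$ its subset of matrices of shape $\kappa$. The pivot of a nonzero row is the first entry of least degree, where $\deg a=\max\{l\le s:\pi^l\mid a\}$. A matrix is in row canonical form if nonzero rows precede zero rows; pivots of smaller degree are above pivots of larger degree and, among pivots of equal degree, earlier ones are above later ones; every pivot is some $\pi^l$ with $l<s$; the entries below a pivot $\pi^l$ are $0$; and those above it belong to the set of residues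 $\sum_{i<l}a_i\pi^i$, with digits $a_i$ in the fixed set of residues. $\mathrm{RCF}(Y)$ is the matrix in row canonical form that is left-equivalent to $Y$. A row canonical form in $\mathcal T_\kappa(R^{n\times\mu})$ is principal if its diagonal is $1,\dots,1,\pi,\dots,\pi,\dots,\pi^{s-1},\dots,\pi^{s-1},0,\dots,0$, with $\kappa_1$ entries $1$, then $\kappa_{i+1}-\kappa_i$ entries $\pi^i$ for $i=1,\dots,s-1$. The MAMC (multiplicative-additive matrix channel) is $Y=AX+Z$ with input $X\in R^{n\times\mu}$ and with $A\in\mathcal T_n(R^{N\times n})$ and $Z\in\mathcal T_t(R^{N\times\mu})$ independent, uniformly distributed and independent of $X$, where $n\le N$ and $t\le N$. Its capacity is $C=\max_{p_X}I(X;Y)$, logarithms to base $q$. Assume $2N\le\mu_i$ for all $i$ (i.e. $\mu\succeq 2N$). Scheme. For $v\ge t$ with $v\le\mu_1$ let $k=\min\{n,\max\{N-v,0\}\}$. Transmit $X=\begin{pmatrix}0&0\\0&\bar X\end{pmatrix}\in R^{n\times\mu}$, where $\bar X$ is a principal row canonical form for $\mathcal T_k(R^{k\times(\mu-v)})$. The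 decoder computes $\mathrm{RCF}(Y)$; if its leftmost $v+k$ columns form a matrix of shape $t+k$, it outputs rows $t+1,\dots,t+k$ and columns $v+1,\dots,m$ of $\mathrm{RCF}(Y)$ as its estimate of $\bar X$; otherwise it declares a failure. Theorem. (1) Every matrix has a row canonical form, and the decoder is computed, for every $N\times m$ matrix $Y$ with $m\ge1$, by the row reduction algorithm (repeatedly select the earliest entry of least degree, make it a power of $\pi$, cancel the entries below it and reduce those above it) with $O(Nm\min\{N,m\})$ basic operations over $R$, with an absolute implied constant. (2) The scheme has exactly $q^{\sum_i k(\mu_i-v-k)}$ codewords. For every codeword the probability of a wrong output is $0$, and the probability $P_f$ of a failure satisfies $P_f\le 2t/q^{1+v-t}$, with strict inequality if $t>0$. (3) Let $m\to\infty$ with $\bar n=n/m>0$, $\bar N=N/m$, $\bar t=t/m$ and $\bar\mu=\mu/m$ fixed. Then the asymptotic capacity $\bar C=\lim C/(n|\mu|)$ exists and $$\bar C=\begin{cases}\dfrac{\sum_{i=1}^s\bar n(\bar\mu_i-\bar n-\bar t)}{\bar n|\bar\mu|}&\text{if }n+t\le N,\\[2ex]\dfrac{\sum_{i=1}^s(\bar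 N-\bar t)(\bar\mu_i-\bar N)}{\bar n|\bar\mu|}&\text{if }n+t>N.\end{cases}$$ That is, the right-hand side is an upper bound for the asymptotic capacity, and it is tight. The scheme achieves it: for every choice of $v$ with $v-t\to\infty$ and $(v-t)/m\to0$, the normalized rate $\log_q(\text{number of codewords})/(n|\mu|)$ tends to the right-hand side, the error probability is eventually $0$, and the maximal failure probability over all codewords tends to $0$. -/

import Mathlib

open Filter Topology

noncomputable section

namespace MatrixChannel

/-! ### Finite chain rings, shapes and the modules they describe -/

/-- `R` is a `(q, s)` chain ring whose maximal ideal is generated by `π`. -/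
structure IsFiniteChainRing {R : Type*} [CommRing R] (π : R) (q s : ℕ) : Prop where
  finite : Finite R
  chain : ∀ I J : Ideal R, I ≤ J ∨ J ≤ I
  maximal : (Ideal.span {π}).IsMaximal
  card_residueField : Nat.card (R ⧸ Ideal.span {π}) = q
  chainLength : IsLeast {l : ℕ | 0 < l ∧ π ^ l = 0} s

/-- The last (largest) component `μ_s` of an `s`-shape. -/
def shapeLen {s : ℕ} (μ : Fin s → ℕ) : ℕ := Finset.univ.sup μ

/-- The exponent of `π` attached to the (zero-based) coordinate `j` by the shape `μ`: coordinates
`j < μ_1` get exponent `0`, coordinates `μ_1 ≤ j < μ_2` exponent `1`, ..., and coordinates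
`j ≥ μ_s` exponent `s`. -/
def shapeExp {s : ℕ} (μ : Fin s → ℕ) (j : ℕ) : ℕ :=
  (Finset.univ.filter fun i => μ i ≤ j).card

/-- The module `R^μ`, as a set of `m`-tuples; the packet length is `m = μ_s`. (For `m > μ_s` the
additional coordinates are multiples of `π ^ s = 0`.) -/
def chainModule {R : Type*} [CommRing R] {s : ℕ} (π : R) (μ : Fin s → ℕ) (m : ℕ) :
    Submodule R (Fin m → R) :=
  Submodule.pi Set.univ fun j => Ideal.span {π ^ shapeExp μ j}

/-- The module `M` has shape `κ`: `κ` is a shape and `M ≅ R^κ`. -/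
def HasShape {R : Type*} [CommRing R] {s : ℕ} (π : R) (M : Type*) [AddCommGroup M] [Module R M]
    (κ : Fin s → ℕ) : Prop :=
  Monotone κ ∧ Nonempty (M ≃ₗ[R] chainModule π κ (shapeLen κ))

/-- The row span of a matrix. -/
def rowSpan {R : Type*} [CommRing R] {α β : Type*} (A : Matrix α β R) : Submodule R (β → R) :=
  Submodule.span R (Set.range A.row)

/-- The matrix `A` has shape `κ`, i.e. its row span has shape `κ`. -/
def HasMatrixShape {R : Type*} [CommRing R] {s : ℕ} (π : R) {α β : Type*} (A : Matrix α β R)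
    (κ : Fin s → ℕ) : Prop :=
  HasShape π (rowSpan A) κ

/-- `R^{n × μ}`: the `n × m` matrices whose rows are elements of `R^μ`. -/
def rowMatrices {R : Type*} [CommRing R] {s : ℕ} (π : R) (μ : Fin s → ℕ) (n m : ℕ) :
    Set (Matrix (Fin n) (Fin m) R) :=
  {A | ∀ i, A.row i ∈ chainModule π μ m}

/-- `T_κ(R^{n × μ})`: the matrices in `R^{n × μ}` of shape `κ`. -/
def shapeMatrices {R : Type*} [CommRing R] {s : ℕ} (π : R) (κ μ : Fin s → ℕ) (n m : ℕ) :
    Set (Matrix (Fin n) (Fin m) R) :=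
  {A | A ∈ rowMatrices π μ n m ∧ HasMatrixShape π A κ}

/-! ### Row canonical forms -/

open Classical in
/-- The degree of a ring element: the number of leading zero digits of its `π`-adic decomposition,
i.e. the largest `l ≤ s` such that `π ^ l` divides it. In particular `0` has degree `s`. -/
def degree {R : Type*} [CommRing R] (π : R) (s : ℕ) (a : R) : ℕ :=
  Nat.findGreatest (fun l => π ^ l ∣ a) s

/-- `T` is a complete set of residues with respect to `π` that contains `0`. -/
def IsResidueSystem {R : Type*} [CommRing R] (π : R) (T : Set R) : Prop :=
  0 ∈ T ∧ ∀ a : R, ∃! b : R, b ∈ T ∧ π ∣ a - b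

/-- The complete set of residues for `π ^ l` built from the one for `π`. -/
def residues {R : Type*} [CommRing R] (π : R) (T : Set R) (l : ℕ) : Set R :=
  {x | ∃ a : Fin l → R, (∀ i, a i ∈ T) ∧ x = ∑ i, a i * π ^ (i : ℕ)}

/-- The pivot of row `i` of `A` stands in column `j`: the row is nonzero and `j` is the first
column among those holding an entry of least degree in that row. -/
def IsPivot {R : Type*} [CommRing R] (π : R) (s : ℕ) {n m : ℕ} (A : Matrix (Fin n) (Fin m) R)
    (i : Fin n) (j : Fin m) : Prop :=
  A i ≠ 0 ∧ (∀ j', degree π s (A i j) ≤ degree π s (A i j')) ∧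
    ∀ j' < j, degree π s (A i j) < degree π s (A i j')

/-- `A` is in row canonical form. -/
structure IsRowCanonical {R : Type*} [CommRing R] (π : R) (s : ℕ) (T : Set R) {n m : ℕ}
    (A : Matrix (Fin n) (Fin m) R) : Prop where
  zero_rows : ∀ i i', i < i' → A i = 0 → A i' = 0
  same_degree : ∀ i j i' j', IsPivot π s A i j → IsPivot π s A i' j' →
    degree π s (A i j) = degree π s (A i' j') → j < j' → i < i'
  diff_degree : ∀ i j i' j', IsPivot π s A i j → IsPivot π s A i' j' →
    degree π s (A i j) < degree π s (A i' j') → i < i'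
  pivot_eq : ∀ i j, IsPivot π s A i j → ∃ l < s, A i j = π ^ l
  below : ∀ i j, IsPivot π s A i j → ∀ i', i < i' → A i' j = 0
  above : ∀ i j l, l < s → IsPivot π s A i j → A i j = π ^ l →
    ∀ i', i' < i → A i' j ∈ residues π T l

/-- `B` is a row canonical form of `A`: it is in row canonical form and left-equivalent to `A`. -/
def IsRowCanonicalFormOf {R : Type*} [CommRing R] (π : R) (s : ℕ) (T : Set R) {n m : ℕ}
    (A B : Matrix (Fin n) (Fin m) R) : Prop :=
  IsRowCanonical π s T B ∧ ∃ U : Matrix (Fin n) (Fin n) R, IsUnit U ∧ U * A = B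

/-- `RCF(A)`: the row canonical form of `A`. -/
def rcf {R : Type*} [CommRing R] (π : R) (s : ℕ) (T : Set R) {n m : ℕ}
    (A : Matrix (Fin n) (Fin m) R) : Matrix (Fin n) (Fin m) R :=
  Classical.epsilon fun B => IsRowCanonicalFormOf π s T A B

/-- The principal row canonical forms for `T_κ(R^{n × μ})`. -/
def principalForms {R : Type*} [CommRing R] {s : ℕ} (π : R) (T : Set R) (κ μ : Fin s → ℕ)
    (n m : ℕ) : Set (Matrix (Fin n) (Fin m) R) :=
  {A | A ∈ shapeMatrices π κ μ n m ∧ IsRowCanonical π s T A ∧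
    ∀ (i : Fin n) (j : Fin m), (i : ℕ) = j → A i j = π ^ shapeExp κ i}

/-! ### Discrete memoryless channels and the MAMC -/

/-- The mutual information `I(X; Y)`, with logarithms to the base `b`, for the input distribution
`p` and the channel transition probabilities `W x y = p(y | x)`. -/
def mutualInfo (b : ℝ) {α β : Type*} [Fintype α] [Fintype β] (p : α → ℝ) (W : α → β → ℝ) : ℝ :=
  ∑ x, ∑ y, p x * W x y * Real.logb b (W x y / ∑ x', p x' * W x' y)

/-- The capacity `max I(X; Y)`, the maximum being over all input distributions. -/
def capacity (b : ℝ) {α β : Type*} [Fintype α] [Fintype β] (W : α → β → ℝ) : ℝ :=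
  sSup ((fun p => mutualInfo b p W) '' stdSimplex ℝ α)

/-- The probability, in the MAMC `Y = A X + Z` with input `X`, that the output has the property
`P`. Here `(A, Z)` is uniform over the pairs with `A ∈ T_n(R^{N × n})` and
`Z ∈ T_τ(R^{N × μ})`. -/
def mamcProb {R : Type*} [CommRing R] {s : ℕ} (π : R) (τ μ : Fin s → ℕ) {n m : ℕ} (N : ℕ)
    (X : Matrix (Fin n) (Fin m) R) (P : Matrix (Fin N) (Fin m) R → Prop) : ℝ :=
  (Nat.card {AZ : Matrix (Fin N) (Fin n) R × Matrix (Fin N) (Fin m) R //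
      AZ.1 ∈ shapeMatrices π (fun _ : Fin s => n) (fun _ : Fin s => n) N n ∧
      AZ.2 ∈ shapeMatrices π τ μ N m ∧ P (AZ.1 * X + AZ.2)} : ℝ) /
    ((Nat.card (shapeMatrices π (fun _ : Fin s => n) (fun _ : Fin s => n) N n) : ℝ) *
      Nat.card (shapeMatrices π τ μ N m))

open Classical in
/-- The capacity of the MAMC with input alphabet `R^{n × μ}` and output alphabet `R^{N × μ}`, in
`q`-ary units per channel use. -/
def mamcCapacity {R : Type*} [CommRing R] [Fintype R] {s : ℕ} (π : R) (q : ℕ) (τ μ : Fin s → ℕ)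
    (n N m : ℕ) : ℝ :=
  capacity (q : ℝ) fun (X : rowMatrices π μ n m) (Y : rowMatrices π μ N m) =>
    mamcProb π τ μ N X.1 fun Y' => Y' = Y.1

/-- The claimed asymptotic capacity. -/
def mamcBound {s : ℕ} (n N t : ℝ) (μ : Fin s → ℝ) : ℝ :=
  if n + t ≤ N then (∑ i, n * (μ i - n - t)) / (n * ∑ i, μ i)
  else (∑ i, (N - t) * (μ i - N)) / (n * ∑ i, μ i)

/-! ### The coding scheme -/

/-- The number of payload rows of the scheme with `v` error traps: `n` if `n + v ≤ N`, and `N - v`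
otherwise (none if `v > N`). -/
def payloadRows (n N v : ℕ) : ℕ := min n (N - v)

/-- The messages of the scheme: the principal row canonical forms for `T_k(R^{k × (μ - v)})`. -/
def messages {R : Type*} [CommRing R] {s : ℕ} (π : R) (T : Set R) (μ : Fin s → ℕ) (m v k : ℕ) :
    Set (Matrix (Fin k) (Fin (m - v)) R) :=
  principalForms π T (fun _ => k) (fun i => μ i - v) k (m - v)

/-- Encoding: the message is placed in the lower right corner of an `n × m` zero matrix. -/
def encode {R : Type*} [CommRing R] (n : ℕ) {m v k : ℕ} (M : Matrix (Fin k) (Fin (m - v)) R) :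
    Matrix (Fin n) (Fin m) R := fun i j =>
  if h : n ≤ i + k ∧ v ≤ j then M ⟨i + k - n, by omega⟩ ⟨j - v, by omega⟩ else 0

/-- The rows `t+1, ..., t+k` and columns `v+1, ..., m` of a matrix. -/
def payload {R : Type*} [CommRing R] {N m : ℕ} (t v k : ℕ) (B : Matrix (Fin N) (Fin m) R) :
    Matrix (Fin k) (Fin (m - v)) R := fun a b =>
  if h : t + a < N then B ⟨t + a, h⟩ ⟨v + b, by omega⟩ else 0

open Classical in
/-- Decoding: if the matrix of the leftmost `v + k` columns of `RCF(Y)` has rank `t + k`, the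
message is read off from `RCF(Y)`; otherwise a failure (`none`) is declared. -/
def decode {R : Type*} [CommRing R] (π : R) (s : ℕ) (T : Set R) {N m : ℕ} (t v k : ℕ)
    (Y : Matrix (Fin N) (Fin m) R) : Option (Matrix (Fin k) (Fin (m - v)) R) :=
  if HasMatrixShape π
      ((rcf π s T Y).submatrix id (Subtype.val : {j : Fin m // (j : ℕ) < v + k} → Fin m))
      (fun _ : Fin s => t + k)
  then some (payload t v k (rcf π s T Y)) else none

/-! ### Computations with a count of the basic operations

Every sum, difference, product or quotient of ring elements, every evaluation or comparison of
degrees and every copy of an entry counts as one operation. -/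

/-- A value together with the number of basic operations spent on it. -/
structure Counted (α : Type*) where
  val : α
  cost : ℕ

/-- A value that is available at no cost. -/
def Counted.ret {α : Type*} (a : α) : Counted α := ⟨a, 0⟩

/-- The result of one basic operation. -/
def Counted.op {α : Type*} (a : α) : Counted α := ⟨a, 1⟩

/-- Run two computations one after the other; the second may use the result of the first. -/
def Counted.bind {α β : Type*} (x : Counted α) (f : α → Counted β) : Counted β :=
  ⟨(f x.val).val, x.cost + (f x.val).cost⟩

/-- Run through a list while updating an accumulator. -/
def Counted.fold {α β : Type*} (f : α → β → Counted α) : α → List β → Counted α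
  | a, [] => Counted.ret a
  | a, b :: l => (f a b).bind fun a' => Counted.fold f a' l

/-- Carry out one computation for every index. -/
def Counted.pi {ι α : Type*} [Fintype ι] (f : ι → Counted α) : Counted (ι → α) :=
  ⟨fun i => (f i).val, ∑ i, (f i).cost⟩

/-- Division without remainder: some `c` with `c * b = a`. -/
def exactQuotient {R : Type*} [CommRing R] (a b : R) : R :=
  Classical.epsilon fun c => c * b = a

/-- Division by `π ^ l` with remainder: some `c` with `a - c * π ^ l` in the chosen set of residues
for `π ^ l`. -/
def residueQuotient {R : Type*} [CommRing R] (π : R) (T : Set R) (l : ℕ) (a : R) : R :=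
  Classical.epsilon fun c => a - c * π ^ l ∈ residues π T l

/-- Some unit `u` with `u * a = π ^ l`, where `l` is the degree of `a`. -/
def normalizer {R : Type*} [CommRing R] (π : R) (l : ℕ) (a : R) : R :=
  Classical.epsilon fun u => IsUnit u ∧ u * a = π ^ l

/-- Pivot selection among the rows with (zero-based) index at least `k`: scan the entries column by
column and keep the first one of least degree; no pivot is found if these rows are zero. -/
def selectPivot {R : Type*} [CommRing R] (π : R) (s : ℕ) {n m : ℕ} (k : ℕ)
    (A : Matrix (Fin n) (Fin m) R) : Counted (Option (Fin n × Fin m)) :=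
  (Counted.fold
    (fun (best : Option (Fin n × Fin m) × ℕ) (p : Fin m × Fin n) =>
      if k ≤ (p.2 : ℕ) then
        (Counted.op (degree π s (A p.2 p.1))).bind fun d =>
        (Counted.op (decide (d < best.2))).bind fun less =>
        Counted.ret (if less then (some (p.2, p.1), d) else best)
      else Counted.ret best)
    (none, s) (List.finRange m ×ˢ List.finRange n)).bind fun best =>
  Counted.ret best.1

/-- Process the pivot at `(i, j)`: exchange the rows `k` and `i`, make the pivot a power `π ^ l`,
cancel the entries below it and reduce the entries above it to residues for `π ^ l`. -/
def reduceAt {R : Type*} [CommRing R] (π : R) (s : ℕ) (T : Set R) {n m : ℕ}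
    (k i : Fin n) (j : Fin m) (A : Matrix (Fin n) (Fin m) R) :
    Counted (Matrix (Fin n) (Fin m) R) :=
  (Counted.pi fun c => Counted.op (A i c)).bind fun rowK =>
  (Counted.pi fun c => Counted.op (A k c)).bind fun rowI =>
  let A₁ : Matrix (Fin n) (Fin m) R := Function.update (Function.update A i rowI) k rowK
  (Counted.op (degree π s (A₁ k j))).bind fun l =>
  (Counted.op (normalizer π l (A₁ k j))).bind fun u =>
  (Counted.pi fun c => Counted.op (u * A₁ k c)).bind fun row =>
  Counted.pi fun i' =>
    if i' = k then Counted.ret row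
    else
      (Counted.op (if k < i' then exactQuotient (A₁ i' j) (π ^ l)
        else residueQuotient π T l (A₁ i' j))).bind fun c =>
      Counted.pi fun j' =>
        (Counted.op (c * row j')).bind fun x =>
        Counted.op (A₁ i' j' - x)

/-- The main loop of the row reduction, started at step `k` with at most `fuel` steps to go. -/
def rcfLoop {R : Type*} [CommRing R] (π : R) (s : ℕ) (T : Set R) {n m : ℕ} :
    ℕ → ℕ → Matrix (Fin n) (Fin m) R → Counted (Matrix (Fin n) (Fin m) R)
  | 0, _, A => Counted.ret A
  | fuel + 1, k, A =>
    (selectPivot π s k A).bind fun piv =>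
    match piv with
    | none => Counted.ret A
    | some (i, j) =>
      if h : k < n then
        (reduceAt π s T ⟨k, h⟩ i j A).bind fun A' => rcfLoop π s T fuel (k + 1) A'
      else Counted.ret A

/-- The elimination algorithm for the row canonical form. There are at most `min n m` pivots. -/
def rcfAlgorithm {R : Type*} [CommRing R] (π : R) (s : ℕ) (T : Set R) {n m : ℕ}
    (A : Matrix (Fin n) (Fin m) R) : Counted (Matrix (Fin n) (Fin m) R) :=
  rcfLoop π s T (min n m) 0 A

/-- The least degree of the entries of a row. -/
def rowDegree {R : Type*} [CommRing R] (π : R) (s : ℕ) {m : ℕ} (x : Fin m → R) : Counted ℕ :=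
  Counted.fold (fun d j =>
    (Counted.op (degree π s (x j))).bind fun e => Counted.op (min d e)) s (List.finRange m)

/-- The decoding algorithm: compute `RCF(Y)`; to see whether its leftmost `v + k` columns have rank
`t + k`, row reduce them and count the pivots of degree `0` and the pivots of any degree; finally
copy the payload. -/
def decodeAlgorithm {R : Type*} [CommRing R] (π : R) (s : ℕ) (T : Set R) {N m : ℕ} (t v k : ℕ)
    (Y : Matrix (Fin N) (Fin m) R) : Counted (Option (Matrix (Fin k) (Fin (m - v)) R)) :=
  (rcfAlgorithm π s T Y).bind fun B =>
  let left : Matrix (Fin N) (Fin m) R := fun i j => if (j : ℕ) < v + k then B i j else 0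
  (rcfAlgorithm π s T left).bind fun B' =>
  (Counted.pi fun i => rowDegree π s (B' i)).bind fun d =>
  (Counted.pi fun i => Counted.op (decide (d i = 0))).bind fun isUnitPivot =>
  (Counted.pi fun i => Counted.op (decide (d i < s))).bind fun isPivot =>
  if (Finset.univ.filter fun i => isUnitPivot i = true).card = t + k ∧
      (Finset.univ.filter fun i => isPivot i = true).card = t + k then
    (Counted.pi fun a => Counted.pi fun b => Counted.op (payload t v k B a b)).bind fun M =>
    Counted.ret (some M)
  else Counted.ret none

end MatrixChannel

end

namespace MatrixChannel

namespace IsFiniteChainRing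

variable {R : Type*} [CommRing R] {π : R} {q s : ℕ}

/-! ### Arithmetic in a finite chain ring -/

theorem pow_eq_zero (h : IsFiniteChainRing π q s) : π ^ s = 0 := h.chainLength.1.2

theorem s_pos (h : IsFiniteChainRing π q s) : 0 < s := h.chainLength.1.1

theorem pow_ne_zero (h : IsFiniteChainRing π q s) {l : ℕ} (hl : l < s) : π ^ l ≠ 0 := by
  intro h0
  rcases Nat.eq_zero_or_pos l with rfl | hpos
  · exact h.maximal.ne_top (by
      have h1 : (1 : R) = 0 := by simpa using h0
      rw [Ideal.eq_top_iff_one, h1]; exact zero_mem _)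
  · exact absurd (h.chainLength.2 ⟨hpos, h0⟩) (by omega)

theorem nontrivial (h : IsFiniteChainRing π q s) : Nontrivial R :=
  ⟨⟨π ^ 0, 0, h.pow_ne_zero h.s_pos⟩⟩

theorem not_isUnit (h : IsFiniteChainRing π q s) : ¬ IsUnit π := fun hu =>
  h.maximal.ne_top (Ideal.span_singleton_eq_top.2 hu)

theorem isUnit_or_dvd (h : IsFiniteChainRing π q s) (a : R) : IsUnit a ∨ π ∣ a := by
  rcases h.chain (Ideal.span {a}) (Ideal.span {π}) with h1 | h1
  · right; exact Ideal.span_singleton_le_span_singleton.1 h1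
  · by_cases ht : Ideal.span {a} = ⊤
    · left; exact Ideal.span_singleton_eq_top.1 ht
    · right
      have := h.maximal.eq_of_le ht h1
      exact Ideal.span_singleton_le_span_singleton.1 this.ge

theorem isUnit_iff_not_dvd (h : IsFiniteChainRing π q s) (a : R) : IsUnit a ↔ ¬ π ∣ a :=
  ⟨fun hu hd => h.not_isUnit (isUnit_of_dvd_unit hd hu), fun hn => (h.isUnit_or_dvd a).resolve_right hn⟩

theorem isUnit_of_sub_dvd (h : IsFiniteChainRing π q s) {a b : R} (ha : IsUnit a)
    (hab : π ∣ a - b) : IsUnit b := by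
  rw [h.isUnit_iff_not_dvd] at ha ⊢
  intro hb; exact ha (by simpa using dvd_add hab hb)

theorem exists_unit_mul_pow (h : IsFiniteChainRing π q s) {a : R} {l : ℕ} (hl : π ^ l ∣ a)
    (hn : ¬ π ^ (l + 1) ∣ a) : ∃ u, IsUnit u ∧ u * a = π ^ l := by
  obtain ⟨b, rfl⟩ := hl
  have hb : IsUnit b := by
    rw [h.isUnit_iff_not_dvd]; rintro ⟨c, rfl⟩; exact hn ⟨c, by ring⟩
  obtain ⟨u, rfl⟩ := hb
  exact ⟨↑u⁻¹, Units.isUnit _, by rw [mul_comm, mul_assoc]; simp⟩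

theorem dvd_of_pow_mul_eq_zero (h : IsFiniteChainRing π q s) {l : ℕ} (hl : l ≤ s) {x : R}
    (hx : π ^ l * x = 0) : π ^ (s - l) ∣ x := by
  have key : ∀ e ≤ s - l, π ^ e ∣ x := by
    intro e
    induction e with
    | zero => intro _; simp
    | succ e ih =>
      intro he
      by_contra hn
      obtain ⟨u, -, hu⟩ := h.exists_unit_mul_pow (ih (by omega)) hn
      apply h.pow_ne_zero (l := l + e) (by omega)
      rw [pow_add, ← hu, mul_left_comm, hx, mul_zero]
  exact key _ le_rfl

theorem pow_mul_eq_zero_iff (h : IsFiniteChainRing π q s) {l : ℕ} (hl : l ≤ s) {x : R} :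
    π ^ l * x = 0 ↔ π ^ (s - l) ∣ x := by
  refine ⟨h.dvd_of_pow_mul_eq_zero hl, ?_⟩
  rintro ⟨c, rfl⟩
  rw [← mul_assoc, ← pow_add, Nat.add_sub_cancel' hl, h.pow_eq_zero, zero_mul]

theorem socle_mul_eq_zero_iff (h : IsFiniteChainRing π q s) {x : R} :
    π ^ (s - 1) * x = 0 ↔ π ∣ x := by
  rw [h.pow_mul_eq_zero_iff (Nat.sub_le _ _), Nat.sub_sub_self h.s_pos, pow_one]

theorem pow_dvd_pow_iff (h : IsFiniteChainRing π q s) {l l' : ℕ} (hl' : l' < s) :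
    π ^ l ∣ π ^ l' ↔ l ≤ l' := by
  refine ⟨fun hd => ?_, pow_dvd_pow _⟩
  by_contra hlt
  push Not at hlt
  obtain ⟨c, hc⟩ := (pow_dvd_pow π (Nat.succ_le_of_lt hlt)).trans hd
  apply h.pow_ne_zero (l := s - 1) (by have := h.s_pos; omega)
  have h1 : π ^ (s - 1) = π ^ (s - 1 - l') * π ^ l' := by rw [← pow_add]; congr 1; omega
  rw [h1, hc, ← mul_assoc, ← pow_add, show s - 1 - l' + l'.succ = s by omega, h.pow_eq_zero,
    zero_mul]

theorem eq_zero_of_dvd (h : IsFiniteChainRing π q s) {a : R} {l : ℕ} (hl : s ≤ l) (hd : π ^ l ∣ a) :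
    a = 0 := by
  have := (pow_dvd_pow π hl).trans hd
  rwa [h.pow_eq_zero, zero_dvd_iff] at this

theorem two_le_q (h : IsFiniteChainRing π q s) : 2 ≤ q := by
  have := h.finite
  have := h.maximal
  rw [← h.card_residueField]
  have : Finite (R ⧸ Ideal.span {π}) := Finite.of_surjective _ Ideal.Quotient.mk_surjective
  have : Nontrivial (R ⧸ Ideal.span {π}) := Ideal.Quotient.nontrivial_iff.2 h.maximal.ne_top
  exact Finite.one_lt_card

/-! ### Degrees -/

theorem degree_le (a : R) : degree π s a ≤ s := by
  classical exact Nat.findGreatest_le _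

theorem pow_degree_dvd (a : R) : π ^ degree π s a ∣ a := by
  classical
  exact Nat.findGreatest_spec (P := fun l => π ^ l ∣ a) (Nat.zero_le s) (by simp)

theorem le_degree_iff {a : R} {l : ℕ} (hl : l ≤ s) : l ≤ degree π s a ↔ π ^ l ∣ a := by
  classical
  exact ⟨fun h => (pow_dvd_pow π h).trans (pow_degree_dvd a), fun h => Nat.le_findGreatest hl h⟩

theorem degree_lt_iff {a : R} {l : ℕ} (hl : l ≤ s) : degree π s a < l ↔ ¬ π ^ l ∣ a := by
  rw [← le_degree_iff hl, not_le]

theorem degree_zero : degree π s (0 : R) = s :=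
  le_antisymm (degree_le _) ((le_degree_iff le_rfl).2 (dvd_zero _))

theorem degree_eq_iff (h : IsFiniteChainRing π q s) {a : R} : degree π s a = s ↔ a = 0 := by
  constructor
  · intro hd; exact h.eq_zero_of_dvd le_rfl (hd ▸ pow_degree_dvd a)
  · rintro rfl; exact degree_zero

theorem degree_pow (h : IsFiniteChainRing π q s) {l : ℕ} (hl : l < s) : degree π s (π ^ l) = l := by
  apply le_antisymm
  · exact (h.pow_dvd_pow_iff hl).1 (pow_degree_dvd _)
  · exact (le_degree_iff hl.le).2 dvd_rfl

theorem normalizer_spec (h : IsFiniteChainRing π q s) {a : R} (ha : degree π s a < s) :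
    IsUnit (normalizer π (degree π s a) a) ∧ normalizer π (degree π s a) a * a = π ^ degree π s a := by
  apply Classical.epsilon_spec (p := fun u => IsUnit u ∧ u * a = π ^ degree π s a)
  exact h.exists_unit_mul_pow (pow_degree_dvd a) ((degree_lt_iff (by omega)).1 (Nat.lt_succ_self _))

/-! ### Residues -/

theorem residues_zero (π : R) (T : Set R) : residues π T 0 = {0} := by
  ext x; constructor
  · rintro ⟨a, -, rfl⟩; simp
  · intro hx; exact ⟨Fin.elim0, fun i => i.elim0, by simpa using hx⟩

theorem residues_succ (π : R) (T : Set R) (l : ℕ) :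
    residues π T (l + 1) = {x | ∃ a ∈ T, ∃ b ∈ residues π T l, x = a + π * b} := by
  ext x; constructor
  · rintro ⟨a, ha, rfl⟩
    refine ⟨a 0, ha 0, _, ⟨fun i => a i.succ, fun i => ha _, rfl⟩, ?_⟩
    rw [Fin.sum_univ_succ, Finset.mul_sum]
    congr 1
    · simp
    · refine Finset.sum_congr rfl fun i _ => ?_
      rw [Fin.val_succ, pow_succ]; ring
  · rintro ⟨a, ha, b, ⟨c, hc, rfl⟩, rfl⟩
    refine ⟨Fin.cons a c, fun i => ?_, ?_⟩
    · refine Fin.cases ?_ (fun i => ?_) i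
      · simpa using ha
      · simpa using hc i
    · rw [Fin.sum_univ_succ, Finset.mul_sum]
      congr 1
      · simp
      · refine Finset.sum_congr rfl fun i _ => ?_
        rw [Fin.val_succ, pow_succ, Fin.cons_succ]; ring

theorem exists_residue {T : Set R} (hT : IsResidueSystem π T) (l : ℕ) (a : R) :
    ∃ r ∈ residues π T l, π ^ l ∣ a - r := by
  induction l generalizing a with
  | zero => exact ⟨0, by simp [residues_zero], by simp⟩
  | succ l ih =>
    obtain ⟨t, ⟨ht, c, hc⟩, -⟩ := hT.2 a
    obtain ⟨r, hr, d, hd⟩ := ih c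
    refine ⟨t + π * r, ?_, d, ?_⟩
    · rw [residues_succ]; exact ⟨t, ht, r, hr, rfl⟩
    · calc a - (t + π * r) = (a - t) - π * r := by ring
        _ = π * (c - r) := by rw [hc]; ring
        _ = _ := by rw [hd]; ring

theorem residues_unique (h : IsFiniteChainRing π q s) {T : Set R} (hT : IsResidueSystem π T) {l : ℕ}
    (hl : l ≤ s) {a b : R} (ha : a ∈ residues π T l) (hb : b ∈ residues π T l)
    (hab : π ^ l ∣ a - b) : a = b := by
  suffices H : ∀ l e, l + e ≤ s → ∀ a ∈ residues π T l, ∀ b ∈ residues π T l,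
      π ^ l ∣ a - b → π ^ e * a = π ^ e * b by
    simpa using H l 0 (by omega) a ha b hb hab
  clear ha hb hab hl a b l
  intro l
  induction l with
  | zero => intro e _ a ha b hb _; rw [residues_zero] at ha hb; rw [ha, hb]
  | succ l ih =>
    intro e he a ha b hb hab
    rw [residues_succ] at ha hb
    obtain ⟨t, ht, x, hx, rfl⟩ := ha
    obtain ⟨t', ht', x', hx', rfl⟩ := hb
    have h1 : π ∣ t - t' := by
      have h2 : π ∣ (t + π * x) - (t' + π * x') := (dvd_pow_self π (Nat.succ_ne_zero l)).trans hab
      have h3 : t - t' = ((t + π * x) - (t' + π * x')) - π * (x - x') := by ring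
      rw [h3]; exact dvd_sub h2 (dvd_mul_right _ _)
    have h2 : t = t' := (hT.2 t).unique ⟨ht, by simp⟩ ⟨ht', h1⟩
    subst h2
    have h4 : π ^ (s - 1) ∣ π ^ (s - 1 - l) * (x - x') := by
      apply h.dvd_of_pow_mul_eq_zero (l := 1) h.s_pos
      obtain ⟨c, hc⟩ := hab
      have h5 : π * (x - x') = π ^ (l + 1) * c := by rw [← hc]; ring
      rw [pow_one, mul_left_comm, h5, ← mul_assoc, ← pow_add,
        show s - 1 - l + (l + 1) = s by omega, h.pow_eq_zero, zero_mul]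
    have h6 : π ^ l ∣ x - x' := by
      have : π ^ (l + 1) * (π ^ (s - 1 - l) * (x - x')) = 0 := by
        obtain ⟨c, hc⟩ := h4
        rw [hc, ← mul_assoc, ← pow_add]
        rw [show l + 1 + (s - 1) = s + l by omega, pow_add, h.pow_eq_zero]; simp
      obtain ⟨c, hc⟩ := hab
      have h5 : π * ((x - x') - π ^ l * c) = 0 := by
        have : π * (x - x') = π ^ (l + 1) * c := by rw [← hc]; ring
        rw [mul_sub, this]; ring
      have h7 := h.dvd_of_pow_mul_eq_zero (l := 1) h.s_pos (by simpa using h5)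
      have h8 : π ^ l ∣ (x - x') - π ^ l * c := (pow_dvd_pow π (by omega)).trans h7
      simpa using dvd_add h8 (dvd_mul_right _ c)
    have := ih (e + 1) (by omega) x hx x' hx' h6
    rw [mul_add, mul_add]
    congr 1
    calc π ^ e * (π * x) = π ^ (e + 1) * x := by ring
      _ = π ^ (e + 1) * x' := this
      _ = _ := by ring

theorem residueQuotient_spec {T : Set R} (hT : IsResidueSystem π T) (l : ℕ) (a : R) :
    a - residueQuotient π T l a * π ^ l ∈ residues π T l := by
  apply Classical.epsilon_spec (p := fun c => a - c * π ^ l ∈ residues π T l)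
  obtain ⟨r, hr, c, hc⟩ := exists_residue hT l a
  exact ⟨c, by rwa [mul_comm, ← hc, sub_sub_cancel]⟩

theorem exactQuotient_spec {a b : R} (hab : b ∣ a) : exactQuotient a b * b = a := by
  apply Classical.epsilon_spec (p := fun c => c * b = a)
  obtain ⟨c, rfl⟩ := hab
  exact ⟨c, mul_comm _ _⟩

/-! ### Cardinalities -/

theorem card_span_pow (h : IsFiniteChainRing π q s) (l : ℕ) :
    Nat.card (Ideal.span {π ^ l}) = q ^ (s - l) := by
  have := h.finite
  rcases le_or_gt s l with hl | hl
  · have : π ^ l = 0 := h.eq_zero_of_dvd hl dvd_rfl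
    rw [this, Nat.sub_eq_zero_of_le hl]; simp
  · obtain ⟨e, he⟩ : ∃ e, l + e = s := ⟨s - l, by omega⟩
    rw [show s - l = e by omega]
    clear hl
    induction e generalizing l with
    | zero =>
      have : π ^ l = 0 := h.eq_zero_of_dvd (by omega) dvd_rfl
      rw [this]; simp
    | succ e ih =>
      have ih := ih (l + 1) (by omega)
      -- multiplication by `π ^ l` induces `R ⧸ (π) ≃ (π ^ l) / (π ^ (l + 1))`
      let f : Ideal.span {π ^ l} →ₗ[R] R ⧸ Ideal.span {π ^ (l + 1)} :=
        (Submodule.mkQ _).comp (Submodule.subtype _)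
      have hf (x : Ideal.span {π ^ l}) : x ∈ LinearMap.ker f ↔ x.1 ∈ Ideal.span {π ^ (l + 1)} :=
        LinearMap.mem_ker.trans (Submodule.Quotient.mk_eq_zero _)
      have hker : Nat.card (LinearMap.ker f) = q ^ e := by
        rw [← ih]
        refine Nat.card_congr ⟨fun x => ⟨x.1.1, ?_⟩, fun x => ⟨⟨x.1, ?_⟩, ?_⟩, fun x => rfl, fun x => rfl⟩
        · exact (hf _).1 x.2
        · have := x.2
          rw [Ideal.mem_span_singleton] at this ⊢
          exact (pow_dvd_pow π (Nat.le_succ l)).trans this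
        · exact (hf _).2 x.2
      let g : R →ₗ[R] R ⧸ Ideal.span {π ^ (l + 1)} :=
        (Submodule.mkQ _).comp (LinearMap.mulLeft R (π ^ l))
      have hg : LinearMap.ker g = Ideal.span {π} := by
        ext x
        have : x ∈ LinearMap.ker g ↔ π ^ (l + 1) ∣ π ^ l * x := by
          rw [← Ideal.mem_span_singleton]
          exact LinearMap.mem_ker.trans (Submodule.Quotient.mk_eq_zero _)
        rw [this, Ideal.mem_span_singleton]
        constructor
        · rintro ⟨c, hc⟩
          have h1 : π ^ l * (x - π * c) = 0 := by rw [mul_sub, hc]; ring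
          have h2 := h.dvd_of_pow_mul_eq_zero (by omega) h1
          have h3 : π ∣ x - π * c := (dvd_pow_self π (by omega)).trans h2
          simpa using dvd_add h3 (dvd_mul_right π c)
        · rintro ⟨c, rfl⟩; exact ⟨c, by ring⟩
      have hr : LinearMap.range f = LinearMap.range g := by
        ext y; constructor
        · rintro ⟨⟨x, hx⟩, rfl⟩
          obtain ⟨c, rfl⟩ := Ideal.mem_span_singleton.1 hx
          exact ⟨c, rfl⟩
        · rintro ⟨c, rfl⟩
          exact ⟨⟨π ^ l * c, Ideal.mem_span_singleton.2 ⟨c, rfl⟩⟩, rfl⟩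
      have h1 := Submodule.card_eq_card_quotient_mul_card (LinearMap.ker f)
      have h2 : Nat.card (↥(Ideal.span {π ^ l}) ⧸ LinearMap.ker f) = q := by
        rw [Nat.card_congr f.quotKerEquivRange.toEquiv, hr,
          ← Nat.card_congr g.quotKerEquivRange.toEquiv, hg, h.card_residueField]
      rw [h1, h2, hker, pow_succ]

theorem card_eq (h : IsFiniteChainRing π q s) : Nat.card R = q ^ s := by
  have := h.card_span_pow 0
  rw [pow_zero, Ideal.span_singleton_one] at this
  rw [← Nat.sub_zero s, ← this]
  exact (Nat.card_congr (Equiv.Set.univ R)).symm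

theorem card_dvd (h : IsFiniteChainRing π q s) (l : ℕ) :
    Nat.card {x : R // π ^ l ∣ x} = q ^ (s - l) := by
  rw [← h.card_span_pow l]
  exact Nat.card_congr (Equiv.subtypeEquivRight fun x => Ideal.mem_span_singleton.symm)

theorem card_pi_dvd (h : IsFiniteChainRing π q s) {ι : Type*} [Fintype ι] (e : ι → ℕ) :
    Nat.card {x : ι → R // ∀ j, π ^ e j ∣ x j} = q ^ (∑ j, (s - e j)) := by
  rw [Nat.card_congr (Equiv.subtypePiEquivPi (p := fun j (x : R) => π ^ e j ∣ x)), Nat.card_pi,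
    ← Finset.prod_pow_eq_pow_sum]
  exact Finset.prod_congr rfl fun j _ => h.card_dvd _

theorem card_matrix_dvd (h : IsFiniteChainRing π q s) {α β : Type*} [Fintype α] [Fintype β]
    (e : α → β → ℕ) :
    Nat.card {x : Matrix α β R // ∀ i j, π ^ e i j ∣ x i j} = q ^ (∑ i, ∑ j, (s - e i j)) := by
  have : Nat.card {x : Matrix α β R // ∀ i j, π ^ e i j ∣ x i j} =
      Nat.card {x : α → β → R // ∀ i j, π ^ e i j ∣ x i j} := rfl
  rw [this, Nat.card_congr (Equiv.subtypePiEquivPi (p := fun i (x : β → R) => ∀ j, π ^ e i j ∣ x j)),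
    Nat.card_pi, ← Finset.prod_pow_eq_pow_sum]
  exact Finset.prod_congr rfl fun i _ => h.card_pi_dvd _

theorem card_fun (h : IsFiniteChainRing π q s) (ι : Type*) [Fintype ι] :
    Nat.card (ι → R) = q ^ (s * Fintype.card ι) := by
  rw [Nat.card_fun, h.card_eq, ← pow_mul, Nat.card_eq_fintype_card]

theorem card_matrix (h : IsFiniteChainRing π q s) (α β : Type*) [Fintype α] [Fintype β] :
    Nat.card (Matrix α β R) = q ^ (s * (Fintype.card α * Fintype.card β)) := by
  have : Nat.card (Matrix α β R) = Nat.card (α → β → R) := rfl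
  rw [this, Nat.card_fun, h.card_fun, ← pow_mul, Nat.card_eq_fintype_card]
  congr 1; ring

end IsFiniteChainRing

end MatrixChannel

namespace MatrixChannel

variable {R : Type*} [CommRing R] {π : R} {q s : ℕ} {T : Set R}

/-! ### Staircase matrices -/

/-- Row `i` of `A` has the pivot `π ^ l` in column `j`, which divides all entries of the rows from
`i` on, strictly those to the left of column `j`; the entries below it are zero and those above it
are residues for `π ^ l`. -/
structure PivotAt (π : R) (s : ℕ) (T : Set R) {n m : ℕ} (A : Matrix (Fin n) (Fin m) R) (i : Fin n)
    (j : Fin m) (l : ℕ) : Prop where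
  lt : l < s
  eq : A i j = π ^ l
  dvd : ∀ i', i ≤ i' → ∀ j', π ^ l ∣ A i' j'
  dvd_left : ∀ i', i ≤ i' → ∀ j', j' < j → π ^ (l + 1) ∣ A i' j'
  below : ∀ i', i < i' → A i' j = 0
  above : ∀ i', i' < i → A i' j ∈ residues π T l

/-- A row-by-row description of row canonical forms. -/
def Staircase (π : R) (s : ℕ) (T : Set R) {n m : ℕ} (A : Matrix (Fin n) (Fin m) R) : Prop :=
  ∀ i, (∀ i', i ≤ i' → A i' = 0) ∨ ∃ j l, PivotAt π s T A i j l

namespace PivotAt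

variable {n m : ℕ} {A : Matrix (Fin n) (Fin m) R} {i : Fin n} {j : Fin m} {l : ℕ}

theorem ne_zero (h : IsFiniteChainRing π q s) (hp : PivotAt π s T A i j l) : A i ≠ 0 := by
  intro h0
  apply h.pow_ne_zero hp.lt
  rw [← hp.eq, h0]; rfl

theorem degree_eq (h : IsFiniteChainRing π q s) (hp : PivotAt π s T A i j l) :
    degree π s (A i j) = l := by
  rw [hp.eq, h.degree_pow hp.lt]

theorem isPivot (h : IsFiniteChainRing π q s) (hp : PivotAt π s T A i j l) :
    IsPivot π s A i j := by
  refine ⟨hp.ne_zero h, fun j' => ?_, fun j' hj' => ?_⟩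
  · rw [hp.degree_eq h]
    exact (IsFiniteChainRing.le_degree_iff hp.lt.le).2 (hp.dvd i le_rfl j')
  · rw [hp.degree_eq h]
    exact (IsFiniteChainRing.le_degree_iff hp.lt).2 (hp.dvd_left i le_rfl j' hj')

end PivotAt

theorem IsPivot.col_unique {n m : ℕ} {A : Matrix (Fin n) (Fin m) R} {i : Fin n} {j j' : Fin m}
    (h : IsPivot π s A i j) (h' : IsPivot π s A i j') : j = j' := by
  rcases lt_trichotomy j j' with hlt | heq | hlt
  · exact absurd (h.2.1 j') (not_le.2 (h'.2.2 j hlt) |> fun h1 => by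
      have := h'.2.2 j hlt; have := h.2.1 j'; omega)
  · exact heq
  · have := h.2.2 j' hlt; have := h'.2.1 j; omega

theorem exists_isPivot {n m : ℕ} {A : Matrix (Fin n) (Fin m) R} {i : Fin n} (hi : A i ≠ 0) :
    ∃ j, IsPivot π s A i j := by
  have hne : (Finset.univ : Finset (Fin m)).Nonempty := by
    obtain ⟨j, -⟩ := Function.ne_iff.1 hi
    exact ⟨j, Finset.mem_univ _⟩
  obtain ⟨j₀, -, hj₀⟩ := Finset.exists_min_image Finset.univ (fun j => degree π s (A i j)) hne
  let S := Finset.univ.filter fun j => degree π s (A i j) = degree π s (A i j₀)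
  have hS : S.Nonempty := ⟨j₀, by simp [S]⟩
  refine ⟨S.min' hS, hi, fun j' => ?_, fun j' hj' => ?_⟩
  · have := S.min'_mem hS
    rw [Finset.mem_filter] at this
    rw [this.2]; exact hj₀ j' (Finset.mem_univ _)
  · have h1 := S.min'_mem hS
    rw [Finset.mem_filter] at h1
    rw [h1.2]
    refine lt_of_le_of_ne (hj₀ j' (Finset.mem_univ _)) fun heq => ?_
    have : j' ∈ S := by simp [S, heq]
    exact absurd (S.min'_le _ this) (not_le.2 hj')

theorem Staircase.isRowCanonical (h : IsFiniteChainRing π q s) {n m : ℕ}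
    {A : Matrix (Fin n) (Fin m) R} (hA : Staircase π s T A) : IsRowCanonical π s T A := by
  have key : ∀ i j, IsPivot π s A i j → ∃ l, PivotAt π s T A i j l := by
    intro i j hp
    rcases hA i with h0 | ⟨j', l, hl⟩
    · exact absurd (h0 i le_rfl) hp.1
    · rw [hp.col_unique (hl.isPivot h)]; exact ⟨l, hl⟩
  refine ⟨?_, ?_, ?_, ?_, ?_, ?_⟩
  · intro i i' hi h0
    rcases hA i with h1 | ⟨j', l, hl⟩
    · exact h1 i' hi.le
    · exact absurd h0 (hl.ne_zero h)
  · intro i j i' j' hp hp' hd hj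
    obtain ⟨l, hl⟩ := key i j hp
    obtain ⟨l', hl'⟩ := key i' j' hp'
    rw [hl.degree_eq h, hl'.degree_eq h] at hd
    subst hd
    by_contra hi
    have := hl'.dvd_left i (not_lt.1 hi) j hj
    rw [hl.eq, h.pow_dvd_pow_iff hl.lt] at this
    omega
  · intro i j i' j' hp hp' hd
    obtain ⟨l, hl⟩ := key i j hp
    obtain ⟨l', hl'⟩ := key i' j' hp'
    rw [hl.degree_eq h, hl'.degree_eq h] at hd
    by_contra hi
    have := hl'.dvd i (not_lt.1 hi) j
    rw [hl.eq, h.pow_dvd_pow_iff hl.lt] at this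
    omega
  · intro i j hp
    obtain ⟨l, hl⟩ := key i j hp
    exact ⟨l, hl.lt, hl.eq⟩
  · intro i j hp
    obtain ⟨l, hl⟩ := key i j hp
    exact hl.below
  · intro i j l hls hp he
    obtain ⟨l', hl⟩ := key i j hp
    have : l = l' := by
      have h1 := hl.degree_eq h
      rwa [he, h.degree_pow hls] at h1
    subst this
    exact hl.above

theorem IsRowCanonical.staircase (h : IsFiniteChainRing π q s) {n m : ℕ}
    {A : Matrix (Fin n) (Fin m) R} (hA : IsRowCanonical π s T A) : Staircase π s T A := by
  intro i
  by_cases hi : A i = 0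
  · left
    intro i' hi'
    rcases hi'.eq_or_lt with rfl | hlt
    · exact hi
    · exact hA.zero_rows i i' hlt hi
  · right
    obtain ⟨j, hj⟩ := exists_isPivot (π := π) (s := s) hi
    obtain ⟨l, hl, he⟩ := hA.pivot_eq i j hj
    have hdeg : degree π s (A i j) = l := by rw [he, h.degree_pow hl]
    refine ⟨j, l, hl, he, ?_, ?_, hA.below i j hj, hA.above i j l hl hj he⟩
    · intro i' hi' j'
      by_cases h0 : A i' = 0
      · rw [h0]; exact dvd_zero _
      obtain ⟨k, hk⟩ := exists_isPivot (π := π) (s := s) h0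
      rw [← IsFiniteChainRing.le_degree_iff hl.le]
      refine le_trans ?_ (hk.2.1 j')
      by_contra hlt
      have := hA.diff_degree i' k i j hk hj (by omega)
      omega
    · intro i' hi' j' hj'
      by_cases h0 : A i' = 0
      · rw [h0]; exact dvd_zero _
      obtain ⟨k, hk⟩ := exists_isPivot (π := π) (s := s) h0
      rw [← IsFiniteChainRing.le_degree_iff hl]
      have h1 : l ≤ degree π s (A i' k) := by
        by_contra hlt
        have := hA.diff_degree i' k i j hk hj (by omega)
        omega
      have h2 := hk.2.1 j'
      by_contra hlt
      have h3 : degree π s (A i' k) = degree π s (A i j) := by omega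
      have h4 : ¬ k < j := fun hkj => by
        have := hA.same_degree i' k i j hk hj h3 hkj
        omega
      have h5 := hk.2.2 j' (by omega)
      omega

/-! ### The elimination algorithm -/

namespace Counted

@[simp] theorem val_ret {α : Type*} (a : α) : (ret a).val = a := rfl
@[simp] theorem cost_ret {α : Type*} (a : α) : (ret a).cost = 0 := rfl
@[simp] theorem val_op {α : Type*} (a : α) : (op a).val = a := rfl
@[simp] theorem cost_op {α : Type*} (a : α) : (op a).cost = 1 := rfl
@[simp] theorem val_bind {α β : Type*} (x : Counted α) (f : α → Counted β) :
    (x.bind f).val = (f x.val).val := rfl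
@[simp] theorem cost_bind {α β : Type*} (x : Counted α) (f : α → Counted β) :
    (x.bind f).cost = x.cost + (f x.val).cost := rfl
@[simp] theorem val_pi {ι α : Type*} [Fintype ι] (f : ι → Counted α) :
    (pi f).val = fun i => (f i).val := rfl
@[simp] theorem cost_pi {ι α : Type*} [Fintype ι] (f : ι → Counted α) :
    (pi f).cost = ∑ i, (f i).cost := rfl

theorem val_fold {α β : Type*} (f : α → β → Counted α) (a : α) (l : List β) :
    (fold f a l).val = l.foldl (fun a b => (f a b).val) a := by
  induction l generalizing a with
  | nil => rfl
  | cons b l ih => exact ih _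

theorem cost_fold_le {α β : Type*} (f : α → β → Counted α) (c : ℕ) (hf : ∀ a b, (f a b).cost ≤ c)
    (a : α) (l : List β) : (fold f a l).cost ≤ c * l.length := by
  induction l generalizing a with
  | nil => simp [fold]
  | cons b l ih =>
    have h1 := ih (f a b).val
    have h2 := hf a b
    rw [fold, cost_bind, List.length_cons, mul_add, mul_one]
    omega

end Counted

/-- The value scanned for by `selectPivot`. -/
theorem foldl_select {β : Type*} (P : β → Prop) [DecidablePred P] (d : β → ℕ) (s : ℕ) (l : List β) :
    let f : Option β × ℕ → β → Option β × ℕ := fun best p =>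
      if P p then (if d p < best.2 then (some p, d p) else best) else best
    (l.foldl f (none, s) = (none, s) ∧ ∀ p ∈ l, P p → s ≤ d p) ∨
      ∃ l₁ p l₂, l = l₁ ++ p :: l₂ ∧ l.foldl f (none, s) = (some p, d p) ∧ P p ∧ d p < s ∧
        (∀ p' ∈ l, P p' → d p ≤ d p') ∧ ∀ p' ∈ l₁, P p' → d p < d p' := by
  intro f
  induction l using List.reverseRecOn with
  | nil => left; simp
  | append_singleton l b ih =>
    simp only [List.foldl_append, List.foldl_cons, List.foldl_nil]
    rcases ih with ⟨h1, h2⟩ | ⟨l₁, p, l₂, rfl, h1, hP, hs, h2, h3⟩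
    · rw [h1]
      by_cases hb : P b ∧ d b < s
      · right
        refine ⟨l, b, [], rfl, by simp [f, hb], hb.1, hb.2, ?_, ?_⟩
        · intro p' hp' hP'
          rcases List.mem_append.1 hp' with hp' | hp'
          · exact hb.2.le.trans (h2 p' hp' hP')
          · rw [List.mem_singleton.1 hp']
        · intro p' hp' hP'
          exact hb.2.trans_le (h2 p' hp' hP')
      · left
        refine ⟨?_, ?_⟩
        · simp only [f]; split_ifs <;> simp_all
        · intro p' hp' hP'
          rcases List.mem_append.1 hp' with hp' | hp'
          · exact h2 p' hp' hP'
          · rw [List.mem_singleton.1 hp'] at hP' ⊢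
            by_contra hlt; exact hb ⟨hP', by omega⟩
    · rw [h1]
      right
      by_cases hb : P b ∧ d b < d p
      · refine ⟨l₁ ++ p :: l₂, b, [], rfl, by simp [f, hb], hb.1, hb.2.trans hs, ?_, ?_⟩
        · intro p' hp' hP'
          rcases List.mem_append.1 hp' with hp' | hp'
          · exact hb.2.le.trans (h2 p' hp' hP')
          · rw [List.mem_singleton.1 hp']
        · intro p' hp' hP'
          exact hb.2.trans_le (h2 p' hp' hP')
      · refine ⟨l₁, p, l₂ ++ [b], by simp, ?_, hP, hs, ?_, h3⟩
        · simp only [f]; split_ifs <;> simp_all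
        · intro p' hp' hP'
          rcases List.mem_append.1 hp' with hp' | hp'
          · exact h2 p' hp' hP'
          · rw [List.mem_singleton.1 hp'] at hP' ⊢
            by_contra hlt; exact hb ⟨hP', by omega⟩

theorem mem_left_of_product_finRange {m n : ℕ} {l₁ l₂ : List (Fin m × Fin n)} {p : Fin m × Fin n}
    (h : List.finRange m ×ˢ List.finRange n = l₁ ++ p :: l₂) {j : Fin m} (hj : j < p.1)
    (i : Fin n) : (j, i) ∈ l₁ := by
  have hpw : (List.finRange m ×ˢ List.finRange n).Pairwise
      (fun a b : Fin m × Fin n => a.1 ≤ b.1) := by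
    change List.Pairwise _ ((List.finRange m).flatMap fun a => (List.finRange n).map (Prod.mk a))
    rw [List.pairwise_flatMap]
    refine ⟨fun a _ => ?_, ?_⟩
    · rw [List.pairwise_map]
      exact List.Pairwise.imp (fun _ => le_rfl) (List.pairwise_lt_finRange n)
    · refine List.Pairwise.imp ?_ (List.pairwise_lt_finRange m)
      intro a b hab x hx y hy
      obtain ⟨_, _, rfl⟩ := List.mem_map.1 hx
      obtain ⟨_, _, rfl⟩ := List.mem_map.1 hy
      exact hab.le
  have hmem : (j, i) ∈ l₁ ++ p :: l₂ := by
    rw [← h]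
    exact List.mem_product.2 ⟨List.mem_finRange _, List.mem_finRange _⟩
  rcases List.mem_append.1 hmem with h1 | h1
  · exact h1
  · exfalso
    rcases List.mem_cons.1 h1 with h2 | h2
    · rw [← h2] at hj; exact lt_irrefl _ hj
    · rw [h, List.pairwise_append] at hpw
      have := (List.pairwise_cons.1 hpw.2.1).1 _ h2
      exact absurd hj (not_lt.2 this)

theorem selectPivot_spec {n m : ℕ} (k : ℕ) (A : Matrix (Fin n) (Fin m) R) :
    ((selectPivot π s k A).val = none ∧ ∀ (i : Fin n) (j : Fin m), k ≤ (i : ℕ) → s ≤ degree π s (A i j)) ∨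
      ∃ (i : Fin n) (j : Fin m), (selectPivot π s k A).val = some (i, j) ∧ k ≤ (i : ℕ) ∧ degree π s (A i j) < s ∧
        (∀ (i' : Fin n) (j' : Fin m), k ≤ (i' : ℕ) → degree π s (A i j) ≤ degree π s (A i' j')) ∧
        ∀ (i' : Fin n) (j' : Fin m), k ≤ (i' : ℕ) → j' < j → degree π s (A i j) < degree π s (A i' j') := by
  have hval : (selectPivot π s k A).val =
      ((List.finRange m ×ˢ List.finRange n).foldl
        (fun (best : Option (Fin m × Fin n) × ℕ) (p : Fin m × Fin n) =>
          if k ≤ (p.2 : ℕ) then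
            (if degree π s (A p.2 p.1) < best.2 then (some p, degree π s (A p.2 p.1)) else best)
          else best) (none, s)).1.map Prod.swap := by
    rw [selectPivot, Counted.val_bind, Counted.val_ret, Counted.val_fold]
    generalize List.finRange m ×ˢ List.finRange n = l
    have : ∀ (b : Option (Fin m × Fin n)) (d : ℕ),
      (l.foldl (fun (a : Option (Fin n × Fin m) × ℕ) (b : Fin m × Fin n) =>
        (if k ≤ (b.2 : ℕ) then
          (Counted.op (degree π s (A b.2 b.1))).bind fun d =>
          (Counted.op (decide (d < a.2))).bind fun less =>
          Counted.ret (if less then (some (b.2, b.1), d) else a)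
        else Counted.ret a).val) (b.map Prod.swap, d)).1 =
      ((l.foldl (fun (best : Option (Fin m × Fin n) × ℕ) (p : Fin m × Fin n) =>
          if k ≤ (p.2 : ℕ) then
            (if degree π s (A p.2 p.1) < best.2 then (some p, degree π s (A p.2 p.1)) else best)
          else best) (b, d)).1).map Prod.swap := by
      induction l with
      | nil => intro b d; rfl
      | cons p l ih =>
        intro b d
        rw [List.foldl_cons, List.foldl_cons]
        by_cases hk : k ≤ (p.2 : ℕ)
        · by_cases hd : degree π s (A p.2 p.1) < d
          · simpa [hk, hd, Prod.swap] using ih (some p) _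
          · simpa [hk, hd] using ih b d
        · simpa [hk] using ih b d
    exact this none s
  have hfold := foldl_select (fun p : Fin m × Fin n => k ≤ (p.2 : ℕ))
    (fun p => degree π s (A p.2 p.1)) s (List.finRange m ×ˢ List.finRange n)
  have hmem (p : Fin m × Fin n) : p ∈ List.finRange m ×ˢ List.finRange n :=
    List.mem_product.2 ⟨List.mem_finRange _, List.mem_finRange _⟩
  rcases hfold with ⟨h1, h2⟩ | ⟨l₁, p, l₂, hl, h1, hP, hs, h2, h3⟩
  · left
    refine ⟨by rw [hval, h1]; rfl, fun i j hk => h2 (j, i) (hmem _) hk⟩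
  · right
    refine ⟨p.2, p.1, by rw [hval, h1]; rfl, hP, hs, fun i' j' hk => h2 (j', i') (hmem _) hk, ?_⟩
    intro i' j' hk hj
    exact h3 (j', i') (mem_left_of_product_finRange hl hj i') hk

end MatrixChannel

namespace MatrixChannel

variable {R : Type*} [CommRing R] {π : R} {q s : ℕ} {T : Set R}

/-- `B` is obtained from `A` by an invertible row transformation. -/
def LeftEquiv {α β : Type*} [Fintype α] [DecidableEq α] (A B : Matrix α β R) : Prop :=
  ∃ U : Matrix α α R, IsUnit U ∧ U * A = B

namespace LeftEquiv

variable {α β : Type*} [Fintype α] [DecidableEq α] {A B C : Matrix α β R}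

theorem refl (A : Matrix α β R) : LeftEquiv A A := ⟨1, isUnit_one, Matrix.one_mul _⟩

theorem trans (h : LeftEquiv A B) (h' : LeftEquiv B C) : LeftEquiv A C := by
  obtain ⟨U, hU, rfl⟩ := h
  obtain ⟨V, hV, rfl⟩ := h'
  exact ⟨V * U, hV.mul hU, Matrix.mul_assoc _ _ _⟩

theorem symm (h : LeftEquiv A B) : LeftEquiv B A := by
  obtain ⟨U, ⟨U, rfl⟩, rfl⟩ := h
  exact ⟨↑U⁻¹, Units.isUnit _, by rw [← Matrix.mul_assoc, Units.inv_mul, Matrix.one_mul]⟩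

theorem swap (i k : α) (A : Matrix α β R) : LeftEquiv A (A.submatrix (Equiv.swap i k) id) := by
  refine ⟨Matrix.swap R i k, ?_, ?_⟩
  · exact IsUnit.of_mul_eq_one _ (Matrix.swap_mul_self _ _)
  · rw [Matrix.swap, PEquiv.toMatrix_toPEquiv_mul]

theorem transvection (k : α) (u : R) (hu : IsUnit u) (c : α → R) (A : Matrix α β R) :
    LeftEquiv A (fun i j => if i = k then u * A k j else A i j - c i * (u * A k j)) := by
  let w : α → R := fun i => if i = k then u - 1 else - (c i * u)
  refine ⟨1 + Matrix.vecMulVec w (Pi.single k 1), ?_, ?_⟩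
  · rw [Matrix.isUnit_iff_isUnit_det, Matrix.vecMulVec_eq Unit,
      Matrix.det_one_add_replicateCol_mul_replicateRow]
    simpa [w] using hu
  · ext i j
    rw [Matrix.add_mul, Matrix.one_mul, Matrix.add_apply, Matrix.mul_apply]
    simp only [Matrix.vecMulVec_apply, Pi.single_apply, mul_ite, mul_one, mul_zero, ite_mul,
      zero_mul, Finset.sum_ite_eq', Finset.mem_univ, if_true, w]
    split_ifs with h
    · subst h; ring
    · ring

end LeftEquiv

theorem reduceAt_apply {n m : ℕ} (k i : Fin n) (j : Fin m) (A : Matrix (Fin n) (Fin m) R)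
    (i' : Fin n) (j' : Fin m) :
    let A₁ := A.submatrix (Equiv.swap k i) id
    let l := degree π s (A i j)
    let u := normalizer π l (A i j)
    (reduceAt π s T k i j A).val i' j' = if i' = k then u * A₁ k j' else
      A₁ i' j' - (if k < i' then exactQuotient (A₁ i' j) (π ^ l)
        else residueQuotient π T l (A₁ i' j)) * (u * A₁ k j') := by
  intro A₁ l u
  have hA₁ : Function.update (Function.update A i (fun c => A k c)) k (fun c => A i c) = A₁ := by
    funext i'
    by_cases h1 : i' = k
    · subst h1
      refine (Function.update_self _ _ _).trans ?_
      ext; simp [A₁]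
    · refine (Function.update_of_ne h1 _ _).trans ?_
      by_cases h2 : i' = i
      · subst h2
        refine (Function.update_self _ _ _).trans ?_
        ext; simp [A₁]
      · refine (Function.update_of_ne h2 _ _).trans ?_
        ext; simp [A₁, Equiv.swap_apply_of_ne_of_ne h1 h2]
  have hA₁k : A₁ k j = A i j := by simp [A₁]
  have hval : (reduceAt π s T k i j A).val i' j' =
      (let A₂ : Matrix (Fin n) (Fin m) R :=
        Function.update (Function.update A i (fun c => A k c)) k (fun c => A i c)
      let l := degree π s (A₂ k j)
      let u := normalizer π l (A₂ k j)
      (if i' = k then Counted.ret (fun c => u * A₂ k c) else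
        (Counted.op (if k < i' then exactQuotient (A₂ i' j) (π ^ l)
          else residueQuotient π T l (A₂ i' j))).bind fun c =>
        Counted.pi fun j' =>
          (Counted.op (c * (u * A₂ k j'))).bind fun x => Counted.op (A₂ i' j' - x)).val j') := rfl
  rw [hval, hA₁]
  dsimp only
  rw [hA₁k]
  by_cases h : i' = k
  · simp only [h, if_true, Counted.val_ret, l, u]
  · simp only [h, if_false, Counted.val_bind, Counted.val_pi, Counted.val_op, l, u]

theorem reduceAt_leftEquiv (h : IsFiniteChainRing π q s) {n m : ℕ} (k i : Fin n) (j : Fin m)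
    (A : Matrix (Fin n) (Fin m) R) (hl : degree π s (A i j) < s) :
    LeftEquiv A (reduceAt π s T k i j A).val := by
  have := (LeftEquiv.swap k i A).trans (LeftEquiv.transvection k _ (h.normalizer_spec hl).1
    (fun i' => if k < i' then
      exactQuotient (A.submatrix (Equiv.swap k i) id i' j) (π ^ degree π s (A i j))
      else residueQuotient π T (degree π s (A i j)) (A.submatrix (Equiv.swap k i) id i' j)) _)
  rwa [← show (reduceAt π s T k i j A).val = _ from
    Matrix.ext fun i' j' => reduceAt_apply k i j A i' j'] at this

/-- The first `k` rows of `A` have pivots. -/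
def PartialStaircase (π : R) (s : ℕ) (T : Set R) {n m : ℕ} (k : ℕ) (A : Matrix (Fin n) (Fin m) R) :
    Prop :=
  ∀ i : Fin n, (i : ℕ) < k → ∃ j l, PivotAt π s T A i j l

theorem PartialStaircase.step (h : IsFiniteChainRing π q s) (hT : IsResidueSystem π T) {n m : ℕ}
    {k i : Fin n} {j : Fin m} {A : Matrix (Fin n) (Fin m) R}
    (hA : PartialStaircase π s T k A) (hki : k ≤ i) (hl : degree π s (A i j) < s)
    (hmin : ∀ (i' : Fin n) (j' : Fin m), (k : ℕ) ≤ (i' : ℕ) →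
      degree π s (A i j) ≤ degree π s (A i' j'))
    (hleft : ∀ (i' : Fin n) (j' : Fin m), (k : ℕ) ≤ (i' : ℕ) → j' < j →
      degree π s (A i j) < degree π s (A i' j')) :
    PartialStaircase π s T ((k : ℕ) + 1) (reduceAt π s T k i j A).val := by
  have happ := reduceAt_apply (π := π) (s := s) (T := T) k i j A
  revert happ
  generalize (reduceAt π s T k i j A).val = V
  intro happ
  dsimp only at happ
  set A₁ := A.submatrix (Equiv.swap k i) id with hA₁
  set l := degree π s (A i j) with hldef
  set u := normalizer π l (A i j)
  obtain ⟨-, hu⟩ := h.normalizer_spec hl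
  have hk : ∀ j', A₁ k j' = A i j' := fun j' => by simp [hA₁]
  -- the exchange permutes the rows from `k` on
  have hlow : ∀ i' : Fin n, i' < k → A₁ i' = A i' := fun i' hi' => by
    ext j'
    rw [hA₁, Matrix.submatrix_apply, Equiv.swap_apply_of_ne_of_ne hi'.ne (hi'.trans_le hki).ne]; rfl
  have hhigh : ∀ i' : Fin n, k ≤ i' → ∃ i'', k ≤ i'' ∧ A₁ i' = A i'' := fun i' hi' => by
    refine ⟨Equiv.swap k i i', ?_, rfl⟩
    rw [Equiv.swap_apply_def]; split_ifs <;> first | assumption | exact le_rfl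
  intro r hr
  rcases Nat.lt_succ_iff_lt_or_eq.1 hr with hr | hr
  · obtain ⟨jr, lr, hp⟩ := hA r hr
    have hrk : r < k := hr
    have hall : ∀ i', r ≤ i' → ∃ i'', r ≤ i'' ∧ A₁ i' = A i'' := fun i' hi' => by
      rcases lt_or_ge i' k with h1 | h1
      · exact ⟨i', hi', hlow i' h1⟩
      · obtain ⟨i'', h2, h3⟩ := hhigh i' h1
        exact ⟨i'', hrk.le.trans h2, h3⟩
    have hall' : ∀ i', r < i' → ∃ i'', r < i'' ∧ A₁ i' = A i'' := fun i' hi' => by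
      rcases lt_or_ge i' k with h1 | h1
      · exact ⟨i', hi', hlow i' h1⟩
      · obtain ⟨i'', h2, h3⟩ := hhigh i' h1
        exact ⟨i'', hrk.trans_le h2, h3⟩
    have hzero : ∀ i', r < i' → A₁ i' jr = 0 := fun i' hi' => by
      obtain ⟨i'', h2, h3⟩ := hall' i' hi'
      rw [h3, hp.below _ h2]
    have hd : ∀ i', r ≤ i' → ∀ j', π ^ lr ∣ A₁ i' j' := fun i' hi' j' => by
      obtain ⟨i'', h2, h3⟩ := hall i' hi'
      rw [h3]; exact hp.dvd _ h2 _
    have hdl : ∀ i', r ≤ i' → ∀ j', j' < jr → π ^ (lr + 1) ∣ A₁ i' j' := fun i' hi' j' hj' => by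
      obtain ⟨i'', h2, h3⟩ := hall i' hi'
      rw [h3]; exact hp.dvd_left _ h2 _ hj'
    refine ⟨jr, lr, hp.lt, ?_, ?_, ?_, ?_, ?_⟩
    · rw [happ, if_neg hrk.ne, hzero k hrk, hlow r hrk, hp.eq]; simp
    · intro i' hi' j'
      rw [happ]
      split_ifs
      · exact (hd k hrk.le j').mul_left _
      · exact dvd_sub (hd i' hi' j') (((hd k hrk.le j').mul_left _).mul_left _)
      · exact dvd_sub (hd i' hi' j') (((hd k hrk.le j').mul_left _).mul_left _)
    · intro i' hi' j' hj'
      rw [happ]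
      split_ifs
      · exact (hdl k hrk.le j' hj').mul_left _
      · exact dvd_sub (hdl i' hi' j' hj') (((hdl k hrk.le j' hj').mul_left _).mul_left _)
      · exact dvd_sub (hdl i' hi' j' hj') (((hdl k hrk.le j' hj').mul_left _).mul_left _)
    · intro i' hi'
      rw [happ, hzero k hrk, hzero i' hi']; simp
    · intro i' hi'
      rw [happ, if_neg (hi'.trans hrk).ne, hzero k hrk, hlow i' (hi'.trans hrk)]
      simpa using hp.above i' hi'
  · have hrk : r = k := Fin.ext hr
    subst hrk
    have hd : ∀ i', r ≤ i' → ∀ j', π ^ l ∣ A₁ i' j' := fun i' hi' j' => by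
      obtain ⟨i'', h2, h3⟩ := hhigh i' hi'
      rw [h3, ← IsFiniteChainRing.le_degree_iff hl.le]; exact hmin _ _ h2
    have hdl : ∀ i', r ≤ i' → ∀ j', j' < j → π ^ (l + 1) ∣ A₁ i' j' := fun i' hi' j' hj' => by
      obtain ⟨i'', h2, h3⟩ := hhigh i' hi'
      rw [h3, ← IsFiniteChainRing.le_degree_iff hl]; exact hleft _ _ h2 hj'
    refine ⟨j, l, hl, ?_, ?_, ?_, ?_, ?_⟩
    · rw [happ, if_pos rfl, hk]; exact hu
    · intro i' hi' j'
      rw [happ]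
      split_ifs
      · exact (hd r le_rfl j').mul_left _
      · exact dvd_sub (hd i' hi' j') (((hd r le_rfl j').mul_left _).mul_left _)
      · exact dvd_sub (hd i' hi' j') (((hd r le_rfl j').mul_left _).mul_left _)
    · intro i' hi' j' hj'
      rw [happ]
      split_ifs
      · exact (hdl r le_rfl j' hj').mul_left _
      · exact dvd_sub (hdl i' hi' j' hj') (((hdl r le_rfl j' hj').mul_left _).mul_left _)
      · exact dvd_sub (hdl i' hi' j' hj') (((hdl r le_rfl j' hj').mul_left _).mul_left _)
    · intro i' hi'
      rw [happ, if_neg hi'.ne', if_pos hi', hk, hu,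
        IsFiniteChainRing.exactQuotient_spec (hd i' hi'.le j), sub_self]
    · intro i' hi'
      rw [happ, if_neg hi'.ne, if_neg (not_lt.2 hi'.le), hk, hu]
      exact IsFiniteChainRing.residueQuotient_spec hT _ _

theorem PartialStaircase.staircase {n m k : ℕ} {A : Matrix (Fin n) (Fin m) R}
    (hA : PartialStaircase π s T k A) (h0 : ∀ i : Fin n, k ≤ (i : ℕ) → A i = 0) :
    Staircase π s T A := by
  intro i
  rcases lt_or_ge (i : ℕ) k with hi | hi
  · exact Or.inr (hA i hi)
  · exact Or.inl fun i' hi' => h0 i' (hi.trans hi')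

theorem PartialStaircase.staircase_of_min_le (h : IsFiniteChainRing π q s) {n m k : ℕ}
    {A : Matrix (Fin n) (Fin m) R} (hA : PartialStaircase π s T k A) (hk : min n m ≤ k) :
    Staircase π s T A := by
  refine hA.staircase fun i hi => ?_
  have hmk : m ≤ k := by have := i.2; omega
  have hkn : k ≤ n := by have := i.2; omega
  choose f l hf using fun r : Fin k => hA ⟨r, r.2.trans_le hkn⟩ r.2
  have hinj : Function.Injective f := by
    intro a b hab
    by_contra hne
    rcases lt_or_gt_of_ne hne with hlt | hlt
    · have := (hf a).below ⟨b, b.2.trans_le hkn⟩ hlt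
      rw [hab, (hf b).eq] at this
      exact h.pow_ne_zero (hf b).lt this
    · have := (hf b).below ⟨a, a.2.trans_le hkn⟩ hlt
      rw [← hab, (hf a).eq] at this
      exact h.pow_ne_zero (hf a).lt this
  have hcard : Fintype.card (Fin k) = Fintype.card (Fin m) := by
    apply le_antisymm (Fintype.card_le_of_injective f hinj); simpa using hmk
  have hsurj := ((Fintype.bijective_iff_injective_and_card f).2 ⟨hinj, hcard⟩).2
  ext j
  obtain ⟨r, rfl⟩ := hsurj j
  exact (hf r).below i (Fin.lt_def.2 (r.2.trans_le hi))

theorem rcfLoop_spec (h : IsFiniteChainRing π q s) (hT : IsResidueSystem π T) {n m : ℕ} (fuel k : ℕ)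
    (A : Matrix (Fin n) (Fin m) R) (hA : PartialStaircase π s T k A) (hk : min n m ≤ k + fuel) :
    Staircase π s T (rcfLoop π s T fuel k A).val ∧ LeftEquiv A (rcfLoop π s T fuel k A).val := by
  induction fuel generalizing k A with
  | zero => exact ⟨hA.staircase_of_min_le h hk, LeftEquiv.refl A⟩
  | succ fuel ih =>
    rw [rcfLoop, Counted.val_bind]
    rcases selectPivot_spec (π := π) (s := s) k A with ⟨h1, h2⟩ | ⟨i, j, h1, hki, hl, hmin, hleft⟩
    · rw [h1]
      refine ⟨hA.staircase fun i hi => ?_, LeftEquiv.refl A⟩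
      ext j
      exact (h.degree_eq_iff).1 (le_antisymm (IsFiniteChainRing.degree_le _) (h2 i j hi))
    · rw [h1]
      have hkn : k < n := hki.trans_lt i.2
      simp only [hkn, dif_pos, Counted.val_bind]
      obtain ⟨h3, h4⟩ := ih (k + 1) _
        (PartialStaircase.step h hT (k := ⟨k, hkn⟩) hA hki hl hmin hleft) (by omega)
      exact ⟨h3, (reduceAt_leftEquiv h _ _ _ _ hl).trans h4⟩

theorem rcfAlgorithm_spec (h : IsFiniteChainRing π q s) (hT : IsResidueSystem π T) {n m : ℕ}
    (A : Matrix (Fin n) (Fin m) R) :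
    Staircase π s T (rcfAlgorithm π s T A).val ∧ LeftEquiv A (rcfAlgorithm π s T A).val :=
  rcfLoop_spec h hT _ _ _ (fun i hi => absurd hi (Nat.not_lt_zero _)) (by simp)

theorem rcf_spec (h : IsFiniteChainRing π q s) (hT : IsResidueSystem π T) {n m : ℕ}
    (A : Matrix (Fin n) (Fin m) R) : IsRowCanonicalFormOf π s T A (rcf π s T A) := by
  apply Classical.epsilon_spec (p := fun B => IsRowCanonicalFormOf π s T A B)
  exact ⟨_, (rcfAlgorithm_spec h hT A).1.isRowCanonical h, (rcfAlgorithm_spec h hT A).2⟩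

/-! ### Cost of the elimination -/

theorem cost_selectPivot_le {n m : ℕ} (k : ℕ) (A : Matrix (Fin n) (Fin m) R) :
    (selectPivot π s k A).cost ≤ 2 * (n * m) := by
  rw [selectPivot, Counted.cost_bind, Counted.cost_ret, add_zero]
  refine (Counted.cost_fold_le _ 2 (fun a b => ?_) _ _).trans ?_
  · split_ifs <;> simp
  · rw [List.length_product, List.length_finRange, List.length_finRange, mul_comm n]

theorem cost_reduceAt_le {n m : ℕ} (k i : Fin n) (j : Fin m) (A : Matrix (Fin n) (Fin m) R) :
    (reduceAt π s T k i j A).cost ≤ 8 * (n * m) := by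
  obtain ⟨f, hf, hle⟩ : ∃ f : Fin n → ℕ, (reduceAt π s T k i j A).cost =
      (∑ _ : Fin m, 1) + ((∑ _ : Fin m, 1) + (1 + (1 + ((∑ _ : Fin m, 1) + ∑ i', f i')))) ∧
      ∀ i', f i' ≤ 1 + 2 * m := by
    refine ⟨_, rfl, fun i' => ?_⟩
    dsimp only
    split_ifs <;> simp <;> omega
  have hsum : ∑ i', f i' ≤ n * (1 + 2 * m) := (Finset.sum_le_sum fun i' _ => hle i').trans (by simp)
  have hn : 1 ≤ n := (Nat.zero_le _).trans_lt k.2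
  have hm : 1 ≤ m := (Nat.zero_le _).trans_lt j.2
  have h1 : m ≤ n * m := Nat.le_mul_of_pos_left _ hn
  have h2 : n ≤ n * m := Nat.le_mul_of_pos_right _ hm
  rw [mul_add, mul_one, mul_left_comm] at hsum
  simp only [Finset.sum_const, Finset.card_univ, Fintype.card_fin, smul_eq_mul, mul_one] at hf
  omega

theorem cost_rcfLoop_le {n m : ℕ} (fuel k : ℕ) (A : Matrix (Fin n) (Fin m) R) :
    (rcfLoop π s T fuel k A).cost ≤ fuel * (10 * (n * m)) := by
  induction fuel generalizing k A with
  | zero => simp [rcfLoop]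
  | succ fuel ih =>
    rw [rcfLoop, Counted.cost_bind, Nat.succ_mul]
    have h1 := cost_selectPivot_le (π := π) (s := s) k A
    rcases (selectPivot π s k A).val with _ | ⟨i, j⟩
    · simp only [Counted.cost_ret]; omega
    · by_cases hk : k < n
      · simp only [hk, dif_pos, Counted.cost_bind]
        have h2 := cost_reduceAt_le (π := π) (s := s) (T := T) ⟨k, hk⟩ i j A
        have h3 := ih (k + 1) (reduceAt π s T ⟨k, hk⟩ i j A).val
        omega
      · simp only [hk, dif_neg, not_false_eq_true, Counted.cost_ret]; omega

theorem cost_rcfAlgorithm_le {n m : ℕ} (A : Matrix (Fin n) (Fin m) R) :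
    (rcfAlgorithm π s T A).cost ≤ 10 * (n * m * min n m) := by
  refine (cost_rcfLoop_le _ _ _).trans (le_of_eq (by ring))

end MatrixChannel

namespace MatrixChannel

variable {R : Type*} [CommRing R] {π : R} {q s : ℕ} {T : Set R}

/-! ### Row spans -/

section RowSpan

variable {α β γ : Type*}

theorem mem_rowSpan [Fintype α] {A : Matrix α β R} {x : β → R} :
    x ∈ rowSpan A ↔ ∃ c : α → R, Matrix.vecMul c A = x := by
  rw [rowSpan, ← range_vecMulLinear]; rfl

theorem row_mem_rowSpan (A : Matrix α β R) (i : α) : A i ∈ rowSpan A :=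
  Submodule.subset_span ⟨i, rfl⟩

theorem rowSpan_mul_le [Fintype α] [Fintype γ] (A : Matrix α γ R) (B : Matrix γ β R) :
    rowSpan (A * B) ≤ rowSpan B := by
  intro x hx
  obtain ⟨c, rfl⟩ := mem_rowSpan.1 hx
  exact mem_rowSpan.2 ⟨Matrix.vecMul c A, Matrix.vecMul_vecMul _ _ _⟩

theorem LeftEquiv.rowSpan_eq [Fintype α] [DecidableEq α] {A B : Matrix α β R} (h : LeftEquiv A B) :
    rowSpan A = rowSpan B := by
  apply le_antisymm
  · obtain ⟨U, -, rfl⟩ := h.symm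
    exact rowSpan_mul_le _ _
  · obtain ⟨U, -, rfl⟩ := h
    exact rowSpan_mul_le _ _

theorem rowSpan_eq_bot {A : Matrix α β R} (h : ∀ i, A i = 0) : rowSpan A = ⊥ := by
  rw [rowSpan, Submodule.span_eq_bot]
  rintro _ ⟨i, rfl⟩
  exact h i

end RowSpan

theorem card_submodule_eq {n : ℕ} (M : Submodule R (Fin n → R)) (j : Fin n) :
    Nat.card M = Nat.card (M.map (LinearMap.proj (R := R) (φ := fun _ => R) j)) *
      Nat.card (M ⊓ LinearMap.ker (LinearMap.proj (R := R) (φ := fun _ => R) j) :) := by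
  let f : M →ₗ[R] R := (LinearMap.proj (R := R) (φ := fun _ => R) j).comp M.subtype
  rw [Submodule.card_eq_card_quotient_mul_card (LinearMap.ker f),
    Nat.card_congr f.quotKerEquivRange.toEquiv, mul_comm]
  congr 1
  · rw [LinearMap.range_comp, Submodule.range_subtype]
  · exact Nat.card_congr ⟨fun x => ⟨x.1.1, x.1.2, x.2⟩, fun x => ⟨⟨x.1, x.2.1⟩, x.2.2⟩,
      fun x => rfl, fun x => rfl⟩

/-! ### Uniqueness of row canonical forms -/

/-- All rows but the first. -/
abbrev tail {n m : ℕ} (A : Matrix (Fin (n + 1)) (Fin m) R) : Matrix (Fin n) (Fin m) R :=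
  A.submatrix Fin.succ id

theorem PivotAt.tail {n m : ℕ} {A : Matrix (Fin (n + 1)) (Fin m) R} {i : Fin n} {j : Fin m} {l : ℕ}
    (hp : PivotAt π s T A i.succ j l) : PivotAt π s T (tail A) i j l where
  lt := hp.lt
  eq := hp.eq
  dvd i' hi' := hp.dvd i'.succ (Fin.succ_le_succ_iff.2 hi')
  dvd_left i' hi' := hp.dvd_left i'.succ (Fin.succ_le_succ_iff.2 hi')
  below i' hi' := hp.below i'.succ (Fin.succ_lt_succ_iff.2 hi')
  above i' hi' := hp.above i'.succ (Fin.succ_lt_succ_iff.2 hi')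

theorem Staircase.tail {n m : ℕ} {A : Matrix (Fin (n + 1)) (Fin m) R} (hA : Staircase π s T A) :
    Staircase π s T (tail A) := by
  intro i
  rcases hA i.succ with h0 | ⟨j, l, hp⟩
  · exact Or.inl fun i' hi' => h0 i'.succ (Fin.succ_le_succ_iff.2 hi')
  · exact Or.inr ⟨j, l, hp.tail⟩

theorem mem_rowSpan_succ {n m : ℕ} {A : Matrix (Fin (n + 1)) (Fin m) R} {x : Fin m → R} :
    x ∈ rowSpan A ↔ ∃ c : R, ∃ y ∈ rowSpan (tail A), x = c • A 0 + y := by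
  have hv (c : Fin (n + 1) → R) : Matrix.vecMul c A =
      c 0 • A 0 + Matrix.vecMul (fun i => c i.succ) (MatrixChannel.tail A) := by
    ext j
    simp [Matrix.vecMul, dotProduct, Fin.sum_univ_succ]
  constructor
  · intro hx
    obtain ⟨c, rfl⟩ := mem_rowSpan.1 hx
    exact ⟨c 0, _, mem_rowSpan.2 ⟨fun i => c i.succ, rfl⟩, hv c⟩
  · rintro ⟨c, y, hy, rfl⟩
    obtain ⟨d, rfl⟩ := mem_rowSpan.1 hy
    exact mem_rowSpan.2 ⟨Fin.cons c d, by rw [hv]; simp⟩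

theorem rowSpan_coord_dvd {n m : ℕ} {A : Matrix (Fin n) (Fin m) R} {l : ℕ} {j : Fin m}
    (h : ∀ i, π ^ l ∣ A i j) {x : Fin m → R} (hx : x ∈ rowSpan A) : π ^ l ∣ x j := by
  obtain ⟨c, rfl⟩ := mem_rowSpan.1 hx
  rw [Matrix.vecMul, dotProduct]
  exact Finset.dvd_sum fun i _ => (h i).mul_left _

theorem rowSpan_coord_eq_zero {n m : ℕ} {A : Matrix (Fin n) (Fin m) R} {j : Fin m}
    (h : ∀ i, A i j = 0) {x : Fin m → R} (hx : x ∈ rowSpan A) : x j = 0 := by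
  obtain ⟨c, rfl⟩ := mem_rowSpan.1 hx
  rw [Matrix.vecMul, dotProduct]
  exact Finset.sum_eq_zero fun i _ => by rw [h i, mul_zero]

theorem PivotAt.mem_rowSpan_tail (h : IsFiniteChainRing π q s) {n m : ℕ}
    {A : Matrix (Fin (n + 1)) (Fin m) R} {j : Fin m} {l : ℕ} (hp : PivotAt π s T A 0 j l)
    {x : Fin m → R} : x ∈ rowSpan (MatrixChannel.tail A) ↔ x ∈ rowSpan A ∧ x j = 0 := by
  have hzero : ∀ y ∈ rowSpan (MatrixChannel.tail A), y j = 0 := fun y hy =>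
    rowSpan_coord_eq_zero (fun i => hp.below _ (Fin.succ_pos i)) hy
  rw [mem_rowSpan_succ]
  constructor
  · intro hx
    exact ⟨⟨0, x, hx, by simp⟩, hzero x hx⟩
  · rintro ⟨⟨c, y, hy, rfl⟩, hx⟩
    rw [Pi.add_apply, hzero y hy, add_zero, Pi.smul_apply, smul_eq_mul, hp.eq, mul_comm,
      h.pow_mul_eq_zero_iff hp.lt.le] at hx
    have : c • A 0 = 0 := by
      ext j'
      obtain ⟨d, hd⟩ := hp.dvd 0 le_rfl j'
      obtain ⟨e, rfl⟩ := hx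
      rw [Pi.smul_apply, smul_eq_mul, hd, Pi.zero_apply,
        show π ^ (s - l) * e * (π ^ l * d) = π ^ (s - l + l) * (e * d) by ring,
        Nat.sub_add_cancel hp.lt.le, h.pow_eq_zero, zero_mul]
    rwa [this, zero_add]

/-- An element of the row span whose entries in the pivot columns are differences of residues
vanishes. -/
theorem Staircase.eq_zero_of_residues (h : IsFiniteChainRing π q s) (hT : IsResidueSystem π T)
    {n m : ℕ} {A : Matrix (Fin n) (Fin m) R} (hA : Staircase π s T A) {x : Fin m → R}
    (hx : x ∈ rowSpan A)
    (hres : ∀ i j l, PivotAt π s T A i j l →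
      ∃ a ∈ residues π T l, ∃ b ∈ residues π T l, x j = a - b) : x = 0 := by
  induction n with
  | zero =>
    rw [rowSpan_eq_bot fun i => i.elim0] at hx
    exact hx
  | succ n ih =>
    rcases hA 0 with h0 | ⟨j, l, hp⟩
    · rw [rowSpan_eq_bot fun i => h0 i (Fin.zero_le i)] at hx
      exact hx
    · refine ih hA.tail ((hp.mem_rowSpan_tail h).2 ⟨hx, ?_⟩) ?_
      · obtain ⟨a, ha, b, hb, hab⟩ := hres 0 j l hp
        have hd : π ^ l ∣ x j := rowSpan_coord_dvd (fun i => hp.dvd i (Fin.zero_le i) j) hx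
        rw [hab] at hd ⊢
        rw [h.residues_unique hT hp.lt.le ha hb hd, sub_self]
      · intro i j' l' hp'
        -- pivots of the tail are pivots, up to the condition on the first row
        rcases hA i.succ with h0 | ⟨j'', l'', hp''⟩
        · exact absurd (h0 i.succ le_rfl) (hp'.ne_zero (A := MatrixChannel.tail A) h)
        · have hj := (hp''.tail.isPivot h).col_unique (hp'.isPivot h)
          subst hj
          have hl : l'' = l' := by rw [← hp''.tail.degree_eq h, hp'.degree_eq h]
          subst hl
          exact hres _ _ _ hp''

theorem Staircase.unique (h : IsFiniteChainRing π q s) (hT : IsResidueSystem π T) {n m : ℕ}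
    {A B : Matrix (Fin n) (Fin m) R} (hA : Staircase π s T A) (hB : Staircase π s T B)
    (hAB : rowSpan A = rowSpan B) : A = B := by
  induction n with
  | zero => ext i; exact i.elim0
  | succ n ih =>
    have hzero : ∀ C : Matrix (Fin (n + 1)) (Fin m) R, (∀ i, 0 ≤ i → C i = 0) → rowSpan C = ⊥ :=
      fun C hC => rowSpan_eq_bot fun i => hC i (Fin.zero_le i)
    have hne : ∀ C : Matrix (Fin (n + 1)) (Fin m) R, ∀ j l, PivotAt π s T C 0 j l → rowSpan C ≠ ⊥ :=
      fun C j l hp h0 => hp.ne_zero h ((Submodule.mem_bot R).1 (h0 ▸ row_mem_rowSpan C 0))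
    rcases hA 0 with hA0 | ⟨j, l, hp⟩
    · rcases hB 0 with hB0 | ⟨j', l', hp'⟩
      · funext i; rw [hA0 i (Fin.zero_le i), hB0 i (Fin.zero_le i)]
      · exact absurd (hAB ▸ hzero A hA0) (hne B _ _ hp')
    · rcases hB 0 with hB0 | ⟨j', l', hp'⟩
      · exact absurd (hAB ▸ hzero B hB0) (hne A _ _ hp)
      · have hle : ∀ (C D : Matrix (Fin (n + 1)) (Fin m) R) (j j' l l'), rowSpan C = rowSpan D →
            PivotAt π s T C 0 j l → PivotAt π s T D 0 j' l' → l ≤ l' ∧ (l = l' → j ≤ j') := by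
          intro C D j j' l l' hCD hp hp'
          have hmem : D 0 ∈ rowSpan C := hCD ▸ row_mem_rowSpan D 0
          have h1 : π ^ l ∣ D 0 j' := rowSpan_coord_dvd (fun i => hp.dvd i (Fin.zero_le i) j') hmem
          rw [hp'.eq, h.pow_dvd_pow_iff hp'.lt] at h1
          refine ⟨h1, fun hl => ?_⟩
          by_contra hj
          have h2 : π ^ (l + 1) ∣ D 0 j' :=
            rowSpan_coord_dvd (fun i => hp.dvd_left i (Fin.zero_le i) j' (not_le.1 hj)) hmem
          rw [hp'.eq, h.pow_dvd_pow_iff hp'.lt] at h2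
          omega
        obtain ⟨h1, h2⟩ := hle A B j j' l l' hAB hp hp'
        obtain ⟨h3, h4⟩ := hle B A j' j l' l hAB.symm hp' hp
        have hl : l = l' := le_antisymm h1 h3
        have hj : j = j' := le_antisymm (h2 hl) (h4 hl.symm)
        subst hl hj
        have htail : MatrixChannel.tail A = MatrixChannel.tail B := by
          refine ih hA.tail hB.tail ?_
          ext x
          rw [hp.mem_rowSpan_tail h, hp'.mem_rowSpan_tail h, hAB]
        have hfirst : A 0 - B 0 = 0 := by
          refine hA.tail.eq_zero_of_residues h hT ((hp.mem_rowSpan_tail h).2 ⟨?_, ?_⟩) ?_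
          · exact Submodule.sub_mem _ (row_mem_rowSpan A 0) (hAB ▸ row_mem_rowSpan B 0)
          · rw [Pi.sub_apply, hp.eq, hp'.eq, sub_self]
          · intro i j' l' hpt
            have key : ∀ C : Matrix (Fin (n + 1)) (Fin m) R, Staircase π s T C →
                PivotAt π s T (MatrixChannel.tail C) i j' l' → C 0 j' ∈ residues π T l' := by
              intro C hC hpt
              rcases hC i.succ with h0 | ⟨j'', l'', hp''⟩
              · exact absurd (h0 i.succ le_rfl) (hpt.ne_zero (A := MatrixChannel.tail C) h)
              · have hj := (hp''.tail.isPivot h).col_unique (hpt.isPivot h)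
                subst hj
                have hl : l'' = l' := by rw [← hp''.tail.degree_eq h, hpt.degree_eq h]
                subst hl
                exact hp''.above 0 (Fin.succ_pos i)
            exact ⟨_, key A hA hpt, _, key B hB (htail ▸ hpt), rfl⟩
        funext i
        refine Fin.cases ?_ (fun i => ?_) i
        · exact sub_eq_zero.1 hfirst
        · exact congrFun htail i

theorem rcf_eq_of_staircase (h : IsFiniteChainRing π q s) (hT : IsResidueSystem π T) {n m : ℕ}
    {A B : Matrix (Fin n) (Fin m) R} (hB : Staircase π s T B) (hAB : rowSpan A = rowSpan B) :
    rcf π s T A = B := by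
  obtain ⟨h1, h2⟩ := rcf_spec h hT A
  exact (h1.staircase h).unique h hT hB ((LeftEquiv.rowSpan_eq h2).symm.trans hAB)

theorem rcfAlgorithm_val (h : IsFiniteChainRing π q s) (hT : IsResidueSystem π T) {n m : ℕ}
    (A : Matrix (Fin n) (Fin m) R) : (rcfAlgorithm π s T A).val = rcf π s T A := by
  obtain ⟨h1, h2⟩ := rcfAlgorithm_spec h hT A
  exact (rcf_eq_of_staircase h hT h1 h2.rowSpan_eq).symm

/-! ### Sizes of row spans and their socles -/

/-- The least degree of the entries of a vector. -/
noncomputable abbrev minDegree (π : R) (s : ℕ) {m : ℕ} (x : Fin m → R) : ℕ := (rowDegree π s x).val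

theorem minDegree_eq_foldl {m : ℕ} (x : Fin m → R) : minDegree π s x =
    (List.finRange m).foldl (fun d j => min d (degree π s (x j))) s := Counted.val_fold _ _ _

theorem le_minDegree_iff {m : ℕ} {x : Fin m → R} {l : ℕ} (hl : l ≤ s) :
    l ≤ minDegree π s x ↔ ∀ j, π ^ l ∣ x j := by
  have : ∀ (L : List (Fin m)) (d : ℕ), l ≤ L.foldl (fun d j => min d (degree π s (x j))) d ↔
      l ≤ d ∧ ∀ j ∈ L, π ^ l ∣ x j := by
    intro L
    induction L with
    | nil => simp
    | cons j L ih =>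
      intro d
      rw [List.foldl_cons, ih, le_min_iff, IsFiniteChainRing.le_degree_iff hl, List.forall_mem_cons,
        and_assoc]
  rw [minDegree_eq_foldl, this]
  simp [hl]

theorem minDegree_le {m : ℕ} (x : Fin m → R) : minDegree π s x ≤ s := by
  have : ∀ (L : List (Fin m)) (d : ℕ), L.foldl (fun d j => min d (degree π s (x j))) d ≤ d := by
    intro L
    induction L with
    | nil => simp
    | cons j L ih => intro d; exact (ih _).trans (min_le_left _ _)
  rw [minDegree_eq_foldl]; exact this _ _

theorem minDegree_zero {m : ℕ} : minDegree π s (0 : Fin m → R) = s :=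
  le_antisymm (minDegree_le _) ((le_minDegree_iff le_rfl).2 fun _ => dvd_zero _)

theorem pow_minDegree_dvd {m : ℕ} (x : Fin m → R) (j : Fin m) : π ^ minDegree π s x ∣ x j :=
  (le_minDegree_iff (minDegree_le x)).1 le_rfl j

theorem minDegree_eq_iff (h : IsFiniteChainRing π q s) {m : ℕ} {x : Fin m → R} :
    minDegree π s x = s ↔ x = 0 := by
  constructor
  · intro hd; ext j; exact h.eq_zero_of_dvd le_rfl (hd ▸ pow_minDegree_dvd x j)
  · rintro rfl; exact minDegree_zero

theorem PivotAt.minDegree_eq (h : IsFiniteChainRing π q s) {n m : ℕ} {A : Matrix (Fin n) (Fin m) R}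
    {i : Fin n} {j : Fin m} {l : ℕ} (hp : PivotAt π s T A i j l) : minDegree π s (A i) = l := by
  apply le_antisymm
  · have := pow_minDegree_dvd (π := π) (s := s) (A i) j
    rwa [hp.eq, h.pow_dvd_pow_iff hp.lt] at this
  · exact (le_minDegree_iff hp.lt.le).2 (hp.dvd i le_rfl)

theorem Staircase.minDegree_monotone (h : IsFiniteChainRing π q s) {n m : ℕ}
    {A : Matrix (Fin n) (Fin m) R} (hA : Staircase π s T A) :
    Monotone fun i => minDegree π s (A i) := by
  intro i i' hi
  dsimp only
  rcases hA i with h0 | ⟨j, l, hp⟩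
  · rw [h0 i le_rfl, h0 i' hi]
  · rw [hp.minDegree_eq h]
    exact (le_minDegree_iff hp.lt.le).2 (hp.dvd i' hi)

/-- The elements of the row span that are killed by `π`. -/
abbrev socle (π : R) {m : ℕ} (M : Submodule R (Fin m → R)) : Submodule R (Fin m → R) :=
  M ⊓ Submodule.torsionBy R (Fin m → R) π

theorem PivotAt.rowSpan_inf_ker (h : IsFiniteChainRing π q s) {n m : ℕ}
    {A : Matrix (Fin (n + 1)) (Fin m) R} {j : Fin m} {l : ℕ} (hp : PivotAt π s T A 0 j l) :
    rowSpan A ⊓ LinearMap.ker (LinearMap.proj (R := R) (φ := fun _ => R) j) =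
      rowSpan (MatrixChannel.tail A) := by
  ext x
  rw [hp.mem_rowSpan_tail h]; rfl

theorem Staircase.card_rowSpan (h : IsFiniteChainRing π q s) {n m : ℕ}
    {A : Matrix (Fin n) (Fin m) R} (hA : Staircase π s T A) :
    Nat.card (rowSpan A) = q ^ ∑ i, (s - minDegree π s (A i)) := by
  induction n with
  | zero => rw [rowSpan_eq_bot fun i => i.elim0]; simp
  | succ n ih =>
    rcases hA 0 with h0 | ⟨j, l, hp⟩
    · rw [rowSpan_eq_bot fun i => h0 i (Fin.zero_le i), Finset.sum_eq_zero]
      · simp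
      · intro i _
        rw [h0 i (Fin.zero_le i), minDegree_zero, Nat.sub_self]
    · rw [card_submodule_eq _ j, hp.rowSpan_inf_ker h, ih hA.tail, Fin.sum_univ_succ, pow_add,
        hp.minDegree_eq h]
      congr 1
      rw [← h.card_span_pow l]
      congr 2
      apply le_antisymm
      · rintro _ ⟨x, hx, rfl⟩
        exact Ideal.mem_span_singleton.2
          (rowSpan_coord_dvd (fun i => hp.dvd i (Fin.zero_le i) j) hx)
      · refine (Ideal.span_singleton_le_iff_mem _).2 ?_
        exact ⟨A 0, row_mem_rowSpan A 0, hp.eq⟩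

open Classical in
theorem Staircase.card_socle (h : IsFiniteChainRing π q s) {n m : ℕ}
    {A : Matrix (Fin n) (Fin m) R} (hA : Staircase π s T A) :
    Nat.card (socle π (rowSpan A)) = q ^ (Finset.univ.filter fun i => A i ≠ 0).card := by
  induction n with
  | zero => rw [rowSpan_eq_bot fun i => i.elim0]; simp
  | succ n ih =>
    rcases hA 0 with h0 | ⟨j, l, hp⟩
    · rw [rowSpan_eq_bot fun i => h0 i (Fin.zero_le i), Finset.filter_false_of_mem]
      · simp
      · intro i _
        rw [h0 i (Fin.zero_le i)]; simp
    · have hinf : socle π (rowSpan A) ⊓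
          LinearMap.ker (LinearMap.proj (R := R) (φ := fun _ => R) j) =
          socle π (rowSpan (MatrixChannel.tail A)) := by
        rw [socle, inf_right_comm, hp.rowSpan_inf_ker h]
      rw [card_submodule_eq _ j, hinf, ih hA.tail,
        Finset.card_filter (fun i => A i ≠ 0), Fin.sum_univ_succ,
        if_pos (hp.ne_zero h), pow_add, Finset.card_filter]
      refine congrArg₂ (· * ·) ?_ rfl
      have hq : Nat.card (Ideal.span {π ^ (s - 1)}) = q ^ 1 := by
        rw [h.card_span_pow, Nat.sub_sub_self h.s_pos]
      rw [← hq]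
      congr 2
      apply le_antisymm
      · rintro _ ⟨x, hx, rfl⟩
        have h1 : π * x j = 0 := congrFun ((Submodule.mem_torsionBy_iff _ _).1 hx.2) j
        exact Ideal.mem_span_singleton.2 (h.dvd_of_pow_mul_eq_zero (l := 1) h.s_pos (by simpa using h1))
      · refine (Ideal.span_singleton_le_iff_mem _).2 ?_
        refine ⟨π ^ (s - 1 - l) • A 0, ⟨Submodule.smul_mem _ _ (row_mem_rowSpan A 0), ?_⟩, ?_⟩
        · rw [SetLike.mem_coe, Submodule.mem_torsionBy_iff, smul_smul]
          ext j'
          obtain ⟨d, hd⟩ := hp.dvd 0 le_rfl j'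
          have hl := hp.lt
          rw [Pi.smul_apply, smul_eq_mul, hd, Pi.zero_apply,
            show π * π ^ (s - 1 - l) * (π ^ l * d) = π ^ (1 + (s - 1 - l) + l) * d by ring,
            show 1 + (s - 1 - l) + l = s by omega, h.pow_eq_zero, zero_mul]
        · have hl := hp.lt
          change π ^ (s - 1 - l) * A 0 j = _
          rw [hp.eq, ← pow_add]; congr 1; omega

end MatrixChannel

namespace MatrixChannel

variable {R : Type*} [CommRing R] {π : R} {q s : ℕ} {T : Set R}

/-! ### Matrices whose row span is free -/

/-- The row span of `A` is free of rank `c`. -/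
def HasRank {α β : Type*} (c : ℕ) (A : Matrix α β R) : Prop :=
  Nonempty (rowSpan A ≃ₗ[R] (Fin c → R))

theorem shapeLen_const (hs : 0 < s) (c : ℕ) : shapeLen (fun _ : Fin s => c) = c := by
  have : Nonempty (Fin s) := ⟨⟨0, hs⟩⟩
  exact Finset.sup_const Finset.univ_nonempty c

theorem shapeExp_const_of_lt {c j : ℕ} (hj : j < c) : shapeExp (fun _ : Fin s => c) j = 0 := by
  rw [shapeExp, Finset.filter_false_of_mem]
  · rfl
  · intro i _; omega

theorem chainModule_const {c m : ℕ} (hm : m ≤ c) : chainModule π (fun _ : Fin s => c) m = ⊤ := by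
  rw [eq_top_iff]
  intro x _ j _
  change x j ∈ Ideal.span {π ^ shapeExp (fun _ : Fin s => c) j}
  rw [shapeExp_const_of_lt (j.2.trans_le hm), pow_zero, Ideal.span_singleton_one]
  trivial

theorem hasMatrixShape_const_iff (hs : 0 < s) {α β : Type*} {A : Matrix α β R} {c : ℕ} :
    HasMatrixShape π A (fun _ : Fin s => c) ↔ HasRank c A := by
  have hmod : chainModule π (fun _ : Fin s => c) (shapeLen fun _ : Fin s => c) = ⊤ :=
    chainModule_const (shapeLen_const hs c).le
  rw [HasMatrixShape, HasShape, and_iff_right monotone_const, hmod, shapeLen_const hs]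
  exact ⟨fun ⟨e⟩ => ⟨e.trans Submodule.topEquiv⟩, fun ⟨e⟩ => ⟨e.trans Submodule.topEquiv.symm⟩⟩

theorem exists_left_inverse (h : IsFiniteChainRing π q s) {α β : Type*} [Fintype α] [Fintype β]
    [DecidableEq β] {P : Matrix α β R}
    (hP : ∀ y : β → R, π ^ (s - 1) • P.mulVec y = 0 → ∀ b, π ∣ y b) :
    ∃ P' : Matrix β α R, P' * P = 1 := by
  have := h.maximal
  classical
  let f := Ideal.Quotient.mk (Ideal.span {π})
  let _ : Field (R ⧸ Ideal.span {π}) := Ideal.Quotient.field _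
  have hf : ∀ a, f a = 0 ↔ π ∣ a := fun a => by
    rw [Ideal.Quotient.eq_zero_iff_mem, Ideal.mem_span_singleton]
  have hinj : Function.Injective (P.map f).mulVecLin := by
    rw [injective_iff_map_eq_zero]
    intro y hy
    choose z hz using fun b => Ideal.Quotient.mk_surjective (y b)
    have hy' : y = f ∘ z := by ext b; exact (hz b).symm
    subst hy'
    ext b
    refine (hf _).2 (hP z ?_ b)
    ext a
    rw [Pi.smul_apply, smul_eq_mul, Pi.zero_apply, h.socle_mul_eq_zero_iff, ← hf,
      RingHom.map_mulVec]
    exact congrFun hy a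
  obtain ⟨g, hg⟩ := (P.map f).mulVecLin.exists_leftInverse_of_injective
    (LinearMap.ker_eq_bot.2 hinj)
  have hQ : LinearMap.toMatrix' g * P.map f = 1 := by
    conv_lhs => rw [← LinearMap.toMatrix'_toLin' (P.map f)]
    rw [← LinearMap.toMatrix'_comp, Matrix.toLin'_apply', hg, LinearMap.toMatrix'_id]
  choose Q hQ' using fun b a => Ideal.Quotient.mk_surjective (LinearMap.toMatrix' g b a)
  have hQf : (Matrix.of Q).map f = LinearMap.toMatrix' g := by
    ext b a; exact hQ' b a
  have hone : (Matrix.of Q * P).map f = 1 := by rw [Matrix.map_mul, hQf, hQ]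
  have hdet : IsUnit (Matrix.of Q * P).det := by
    have h1 : f (Matrix.of Q * P).det = 1 := by
      rw [RingHom.map_det, RingHom.mapMatrix_apply, hone, Matrix.det_one]
    refine h.isUnit_of_sub_dvd isUnit_one ?_
    rw [← hf, map_sub, h1, map_one, sub_self]
  refine ⟨(Matrix.of Q * P)⁻¹ * Matrix.of Q, ?_⟩
  rw [Matrix.mul_assoc, Matrix.nonsing_inv_mul _ hdet]

theorem exists_right_inverse (h : IsFiniteChainRing π q s) {α β : Type*} [Fintype α] [Fintype β]
    [DecidableEq α] {W : Matrix α β R}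
    (hW : ∀ x : α → R, π ^ (s - 1) • Matrix.vecMul x W = 0 → ∀ a, π ∣ x a) :
    ∃ W' : Matrix β α R, W * W' = 1 := by
  obtain ⟨P, hP⟩ := exists_left_inverse h (P := W.transpose) fun y hy =>
    hW y (by rwa [Matrix.mulVec_transpose] at hy)
  exact ⟨P.transpose, by
    rw [← Matrix.transpose_transpose W, ← Matrix.transpose_mul, hP, Matrix.transpose_one]⟩

theorem hasRank_of_factor {α β γ : Type*} [Fintype α] [Fintype β] [Fintype γ] [DecidableEq γ]
    {L : Matrix α γ R} {L' : Matrix γ α R} {W : Matrix γ β R} {W' : Matrix β γ R}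
    (hL : L' * L = 1) (hW : W * W' = 1) : HasRank (Fintype.card γ) (L * W) := by
  let f : (γ → R) →ₗ[R] rowSpan (L * W) := W.vecMulLinear.codRestrict _ fun x =>
    mem_rowSpan.2 ⟨Matrix.vecMul x L', by
      rw [Matrix.vecMul_vecMul, ← Matrix.mul_assoc, hL, Matrix.one_mul]; rfl⟩
  have hf : Function.Bijective f := by
    constructor
    · intro x y hxy
      have h1 : Matrix.vecMul x W = Matrix.vecMul y W := congrArg Subtype.val hxy
      have h2 := congrArg (fun v => Matrix.vecMul v W') h1
      simpa [Matrix.vecMul_vecMul, hW] using h2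
    · rintro ⟨y, hy⟩
      obtain ⟨c, rfl⟩ := mem_rowSpan.1 hy
      exact ⟨Matrix.vecMul c L, Subtype.ext (Matrix.vecMul_vecMul _ _ _)⟩
  exact ⟨(LinearEquiv.ofBijective f hf).symm.trans (LinearEquiv.funCongrLeft R R
    (Fintype.equivFin γ).symm)⟩

theorem HasRank.exists_factor (h : IsFiniteChainRing π q s) {α β : Type*} [Fintype α]
    [Fintype β] {c : ℕ} {A : Matrix α β R} (hA : HasRank c A) :
    ∃ (L : Matrix α (Fin c) R) (L' : Matrix (Fin c) α R) (W : Matrix (Fin c) β R)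
      (W' : Matrix β (Fin c) R), L' * L = 1 ∧ W * W' = 1 ∧ A = L * W := by
  obtain ⟨e⟩ := hA
  let W : Matrix (Fin c) β R := fun i => (e.symm (Pi.single i 1)).1
  have hW : ∀ x, Matrix.vecMul x W = (e.symm x).1 := by
    intro x
    have hx : x = ∑ i, x i • (Pi.single i 1 : Fin c → R) := by
      ext j; simp [Pi.single_apply]
    conv_rhs => rw [hx, map_sum]
    rw [AddSubmonoidClass.coe_finsetSum, Matrix.vecMul_eq_sum]
    refine Finset.sum_congr rfl fun i _ => ?_
    rw [map_smul]; rfl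
  obtain ⟨W', hW'⟩ := exists_right_inverse h (W := W) fun x hx a => by
    rw [hW, ← Submodule.coe_smul, ← map_smul, ZeroMemClass.coe_eq_zero,
      LinearEquiv.map_eq_zero_iff] at hx
    exact h.socle_mul_eq_zero_iff.1 (congrFun hx a)
  let L : Matrix α (Fin c) R := fun i => e ⟨A i, row_mem_rowSpan A i⟩
  have hLW : A = L * W := by
    ext i j
    have := congrFun (hW (L i)) j
    rw [show e.symm (L i) = ⟨A i, row_mem_rowSpan A i⟩ from e.symm_apply_apply _] at this
    exact this.symm
  choose C hC using fun i => mem_rowSpan.1 (e.symm (Pi.single i 1)).2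
  have hCA : Matrix.of C * A = W := by
    ext i j
    exact congrFun (hC i) j
  refine ⟨L, Matrix.of C, W, W', ?_, hW', hLW⟩
  calc Matrix.of C * L = Matrix.of C * L * (W * W') := by rw [hW', Matrix.mul_one]
    _ = (Matrix.of C * (L * W)) * W' := by simp only [Matrix.mul_assoc]
    _ = 1 := by rw [← hLW, hCA, hW']

theorem HasRank.card_rowSpan (h : IsFiniteChainRing π q s) {α β : Type*} {c : ℕ}
    {A : Matrix α β R} (hA : HasRank c A) : Nat.card (rowSpan A) = q ^ (s * c) := by
  obtain ⟨e⟩ := hA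
  rw [Nat.card_congr e.toEquiv, h.card_fun, Fintype.card_fin]

theorem HasRank.card_socle (h : IsFiniteChainRing π q s) {α : Type*} {m c : ℕ}
    {A : Matrix α (Fin m) R} (hA : HasRank c A) : Nat.card (socle π (rowSpan A)) = q ^ c := by
  obtain ⟨e⟩ := hA
  have h1 : Nat.card {x : Fin c → R // ∀ j, π ^ (s - 1) ∣ x j} = q ^ c := by
    rw [h.card_pi_dvd fun _ => s - 1]
    simp [Nat.sub_sub_self (show 1 ≤ s from h.s_pos)]
  rw [← h1]
  have key : ∀ x : rowSpan A, x.1 ∈ Submodule.torsionBy R (Fin m → R) π ↔ ∀ j, π ^ (s - 1) ∣ e x j := by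
    intro x
    rw [Submodule.mem_torsionBy_iff, ← Submodule.coe_smul, ZeroMemClass.coe_eq_zero,
      ← LinearEquiv.map_eq_zero_iff e, map_smul, funext_iff]
    refine forall_congr' fun j => ?_
    rw [← h.pow_mul_eq_zero_iff (l := 1) h.s_pos, pow_one]; rfl
  exact Nat.card_congr ⟨fun x => ⟨e ⟨x.1, x.2.1⟩, (key _).1 x.2.2⟩,
    fun y => ⟨(e.symm y.1).1, (e.symm y.1).2, (key _).2 (by simpa using y.2)⟩,
    fun x => by simp, fun y => by simp⟩

theorem hasRank_of_card (h : IsFiniteChainRing π q s) {α β : Type*} [Fintype α] [Finite β]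
    {W : Matrix α β R} (hW : Nat.card (rowSpan W) = q ^ (s * Fintype.card α)) :
    HasRank (Fintype.card α) W := by
  have := h.finite
  let f : (α → R) →ₗ[R] rowSpan W := W.vecMulLinear.codRestrict _ fun x => mem_rowSpan.2 ⟨x, rfl⟩
  have hs : Function.Surjective f := by
    rintro ⟨y, hy⟩
    obtain ⟨c, rfl⟩ := mem_rowSpan.1 hy
    exact ⟨c, rfl⟩
  have hf : Function.Bijective f :=
    hs.bijective_of_nat_card_le (by rw [hW, h.card_fun])
  exact ⟨(LinearEquiv.ofBijective f hf).symm.trans (LinearEquiv.funCongrLeft R R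
    (Fintype.equivFin α).symm)⟩

theorem LeftEquiv.hasRank_iff {α β : Type*} [Fintype α] [DecidableEq α] {A B : Matrix α β R}
    (hAB : LeftEquiv A B) {c : ℕ} : HasRank c A ↔ HasRank c B := by
  rw [HasRank, HasRank, hAB.rowSpan_eq]

theorem Staircase.hasRank_iff (h : IsFiniteChainRing π q s) {n m c : ℕ}
    {B : Matrix (Fin n) (Fin m) R} (hB : Staircase π s T B) :
    HasRank c B ↔ (Finset.univ.filter fun i => minDegree π s (B i) = 0).card = c ∧
      (Finset.univ.filter fun i => minDegree π s (B i) < s).card = c := by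
  classical
  have hq := h.two_le_q
  have hs := h.s_pos
  have hnz : ∀ i, minDegree π s (B i) < s ↔ B i ≠ 0 := fun i => by
    rw [Ne, ← minDegree_eq_iff h, lt_iff_le_and_ne, and_iff_right (minDegree_le _)]
  have hsub : (Finset.univ.filter fun i => minDegree π s (B i) = 0) ⊆
      Finset.univ.filter fun i => minDegree π s (B i) < s := fun i => by
    simp only [Finset.mem_filter]; rintro ⟨h1, h2⟩; exact ⟨h1, by omega⟩
  constructor
  · intro hr
    have h1 := (hr.card_socle h).symm.trans (hB.card_socle h)
    have h2 := (hr.card_rowSpan h).symm.trans (hB.card_rowSpan h)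
    have h1 := Nat.pow_right_injective hq h1
    have h2 := Nat.pow_right_injective hq h2
    have hc : (Finset.univ.filter fun i => minDegree π s (B i) < s).card = c := by
      rw [h1]; congr 1; ext i; simp only [Finset.mem_filter, hnz]
    refine ⟨?_, hc⟩
    have h3 : ∑ i ∈ Finset.univ.filter (fun i => minDegree π s (B i) < s),
        (s - minDegree π s (B i)) = ∑ i ∈ Finset.univ.filter (fun i => minDegree π s (B i) < s), s := by
      rw [Finset.sum_const, hc, smul_eq_mul, mul_comm, h2, Finset.sum_filter]
      refine Finset.sum_congr rfl fun i _ => ?_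
      split_ifs <;> omega
    rw [Finset.sum_eq_sum_iff_of_le fun i _ => Nat.sub_le _ _] at h3
    rw [← hc]
    refine congrArg _ (Finset.Subset.antisymm hsub fun i hi => ?_)
    have := h3 i hi
    simp only [Finset.mem_filter, Finset.mem_univ, true_and] at hi ⊢
    omega
  · rintro ⟨h1, h2⟩
    have heq := Finset.eq_of_subset_of_card_le hsub (by rw [h1, h2])
    have hz : ∀ i, minDegree π s (B i) = 0 ∨ minDegree π s (B i) = s := fun i => by
      have h3 : i ∈ Finset.univ.filter (fun i => minDegree π s (B i) = 0) ↔
        i ∈ Finset.univ.filter (fun i => minDegree π s (B i) < s) := by rw [heq]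
      simp only [Finset.mem_filter, Finset.mem_univ, true_and] at h3
      have := minDegree_le (π := π) (s := s) (B i)
      omega
    let S := {i // minDegree π s (B i) = 0}
    let W : Matrix S (Fin m) R := B.submatrix Subtype.val id
    have hspan : rowSpan W = rowSpan B := by
      apply le_antisymm
      · rw [rowSpan, Submodule.span_le]
        rintro _ ⟨i, rfl⟩
        exact row_mem_rowSpan B i.1
      · rw [rowSpan, Submodule.span_le]
        rintro _ ⟨i, rfl⟩
        rcases hz i with hi | hi
        · exact row_mem_rowSpan W ⟨i, hi⟩
        · have : B.row i = 0 := (minDegree_eq_iff h).1 hi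
          rw [this]; exact zero_mem _
    have hcard : Fintype.card S = c := by rw [← h1, Fintype.card_subtype]
    have := hasRank_of_card h (W := W) (by
      rw [hspan, hB.card_rowSpan h, hcard]
      congr 1
      rw [← h1, mul_comm, ← smul_eq_mul, ← Finset.sum_const, Finset.sum_filter]
      refine Finset.sum_congr rfl fun i _ => ?_
      rcases hz i with hi | hi
      · simp [hi]
      · rw [hi, if_neg (by omega), Nat.sub_self])
    rw [hcard] at this
    rwa [HasRank, ← hspan]

theorem Staircase.rows_of_hasRank (h : IsFiniteChainRing π q s) {n m c : ℕ}
    {B : Matrix (Fin n) (Fin m) R} (hB : Staircase π s T B) (hr : HasRank c B) (i : Fin n) :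
    ((i : ℕ) < c → ∃ j, PivotAt π s T B i j 0) ∧ (c ≤ (i : ℕ) → B i = 0) := by
  obtain ⟨h1, h2⟩ := (hB.hasRank_iff h).1 hr
  have hmono := hB.minDegree_monotone h
  have hs := h.s_pos
  constructor
  · intro hi
    have h0 : minDegree π s (B i) = 0 := by
      by_contra hne
      have : (Finset.univ.filter fun i => minDegree π s (B i) = 0) ⊆ Finset.Iio i := fun i' hi' => by
        simp only [Finset.mem_filter, Finset.mem_univ, true_and, Finset.mem_Iio] at hi' ⊢
        by_contra hle
        have := hmono (not_lt.1 hle)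
        dsimp only at this
        omega
      have := Finset.card_le_card this
      rw [h1, Fin.card_Iio] at this
      omega
    rcases hB i with hz | ⟨j, l, hp⟩
    · rw [hz i le_rfl, minDegree_zero] at h0; omega
    · rw [hp.minDegree_eq h] at h0
      subst h0; exact ⟨j, hp⟩
  · intro hi
    rw [← minDegree_eq_iff h]
    by_contra hne
    have hlt : minDegree π s (B i) < s := lt_of_le_of_ne (minDegree_le _) hne
    have : Finset.Iic i ⊆ Finset.univ.filter fun i => minDegree π s (B i) < s := fun i' hi' => by
      simp only [Finset.mem_filter, Finset.mem_univ, true_and, Finset.mem_Iic] at hi' ⊢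
      exact (hmono hi').trans_lt hlt
    have := Finset.card_le_card this
    rw [h2, Fin.card_Iic] at this
    omega

/-! ### The decoding algorithm -/

theorem hasRank_submatrix_iff {α : Type*} {m c : ℕ} (p : Fin m → Prop) [DecidablePred p]
    {A B : Matrix α (Fin m) R} (hA : ∀ i j, A i j = if p j then B i j else 0) :
    HasRank c A ↔ HasRank c (B.submatrix id (Subtype.val : {j // p j} → Fin m)) := by
  let f : ({j // p j} → R) →ₗ[R] (Fin m → R) :=
    { toFun := fun x j => if hj : p j then x ⟨j, hj⟩ else 0
      map_add' := fun x y => by ext j; by_cases hj : p j <;> simp [hj]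
      map_smul' := fun a x => by ext j; by_cases hj : p j <;> simp [hj] }
  have hf : Function.Injective f := fun x y hxy => by
    ext ⟨j, hj⟩
    have := congrFun hxy j
    simpa [f, hj] using this
  have hmap : rowSpan A =
      (rowSpan (B.submatrix id (Subtype.val : {j // p j} → Fin m))).map f := by
    rw [rowSpan, rowSpan, Submodule.map_span, ← Set.range_comp]
    congr 2
    ext i j
    change A i j = if hj : p j then B i j else 0
    rw [hA]; split_ifs <;> rfl
  rw [HasRank, HasRank, hmap]
  let e := Submodule.equivMapOfInjective f hf
    (rowSpan (B.submatrix id (Subtype.val : {j // p j} → Fin m)))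
  exact ⟨fun ⟨g⟩ => ⟨e.trans g⟩, fun ⟨g⟩ => ⟨e.symm.trans g⟩⟩

theorem decode_eq (h : IsFiniteChainRing π q s) {N m : ℕ} (t v k : ℕ)
    (Y : Matrix (Fin N) (Fin m) R) [Decidable (HasRank (t + k) ((rcf π s T Y).submatrix id
      (Subtype.val : {j : Fin m // (j : ℕ) < v + k} → Fin m)))] :
    decode π s T t v k Y = if HasRank (t + k) ((rcf π s T Y).submatrix id
      (Subtype.val : {j : Fin m // (j : ℕ) < v + k} → Fin m)) then
      some (payload t v k (rcf π s T Y)) else none := by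
  rw [decode]
  simp only [hasMatrixShape_const_iff h.s_pos]

theorem decodeAlgorithm_val (h : IsFiniteChainRing π q s) (hT : IsResidueSystem π T) {N m : ℕ}
    (t v k : ℕ) (Y : Matrix (Fin N) (Fin m) R) :
    (decodeAlgorithm π s T t v k Y).val = decode π s T t v k Y := by
  classical
  rw [decode_eq h, ← rcfAlgorithm_val h hT, decodeAlgorithm, Counted.val_bind]
  generalize (rcfAlgorithm π s T Y).val = B
  obtain ⟨hst, hle⟩ := rcfAlgorithm_spec h hT
    (fun i j => if (j : ℕ) < v + k then B i j else 0 : Matrix (Fin N) (Fin m) R)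
  rw [← hasRank_submatrix_iff _ fun i j => rfl, hle.hasRank_iff, hst.hasRank_iff h]
  have key : ∀ d : Fin N → ℕ,
      (if (Finset.univ.filter fun i => decide (d i = 0) = true).card = t + k ∧
          (Finset.univ.filter fun i => decide (d i < s) = true).card = t + k then
        (Counted.pi fun a => Counted.pi fun b => Counted.op (payload t v k B a b)).bind fun M =>
        Counted.ret (some M)
      else Counted.ret none : Counted (Option (Matrix (Fin k) (Fin (m - v)) R))).val =
      if (Finset.univ.filter fun i => d i = 0).card = t + k ∧
        (Finset.univ.filter fun i => d i < s).card = t + k then some (payload t v k B)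
      else none := by
    intro d
    simp only [decide_eq_true_eq]
    split_ifs <;> rfl
  refine (key fun i => minDegree π s ((rcfAlgorithm π s T
    (fun i j => if (j : ℕ) < v + k then B i j else 0 : Matrix (Fin N) (Fin m) R)).val i)).trans ?_
  congr

theorem cost_rowDegree_le {m : ℕ} (x : Fin m → R) : (rowDegree π s x).cost ≤ 2 * m := by
  refine (Counted.cost_fold_le _ 2 (fun a b => ?_) _ _).trans ?_
  · simp
  · rw [List.length_finRange]

theorem cost_decodeAlgorithm_le {N m : ℕ} (hm : 0 < m) (t v k : ℕ)
    (Y : Matrix (Fin N) (Fin m) R) :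
    (decodeAlgorithm π s T t v k Y).cost ≤ 30 * (N * m * min N m) := by
  rw [decodeAlgorithm, Counted.cost_bind]
  have h1 := cost_rcfAlgorithm_le (π := π) (s := s) (T := T) Y
  generalize (rcfAlgorithm π s T Y).val = B
  simp only [Counted.cost_bind, Counted.cost_pi, Counted.cost_op, Counted.val_pi, Counted.val_op]
  have h2 := cost_rcfAlgorithm_le (π := π) (s := s) (T := T)
    (fun i j => if (j : ℕ) < v + k then B i j else 0 : Matrix (Fin N) (Fin m) R)
  generalize (rcfAlgorithm π s T (fun i j => if (j : ℕ) < v + k then B i j else 0)) = B' at h2 ⊢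
  have h3 : ∑ i, (rowDegree π s (B'.val i)).cost ≤ N * (2 * m) :=
    (Finset.sum_le_sum fun i _ => cost_rowDegree_le _).trans (by simp)
  have h4 : ∑ _ : Fin N, 1 = N := by simp
  rw [h4]
  have h5 : N * m ≤ N * m * min N m := by
    rcases Nat.eq_zero_or_pos N with rfl | hN
    · simp
    · exact Nat.le_mul_of_pos_right _ (by omega)
  have h6 : N ≤ N * m := Nat.le_mul_of_pos_right _ hm
  rw [mul_left_comm] at h3
  have key : ∀ d : Fin N → ℕ,
      (if (Finset.univ.filter fun i => decide (d i = 0) = true).card = t + k ∧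
          (Finset.univ.filter fun i => decide (d i < s) = true).card = t + k then
        (Counted.pi fun a => Counted.pi fun b => Counted.op (payload t v k B a b)).bind fun M =>
        Counted.ret (some M)
      else Counted.ret none : Counted (Option (Matrix (Fin k) (Fin (m - v)) R))).cost ≤ N * m := by
    intro d
    split_ifs with hc
    · have hk : k ≤ N := by
        have := (Finset.card_le_univ _).trans_eq (Fintype.card_fin N) |> (hc.1 ▸ ·)
        omega
      have h7 : k * (m - v) ≤ N * m := Nat.mul_le_mul hk (Nat.sub_le _ _)
      simpa using h7
    · simp
  refine (Nat.add_le_add h1 (Nat.add_le_add h2 (Nat.add_le_add h3 (Nat.add_le_add_left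
    (Nat.add_le_add_left (key fun i => (rowDegree π s (B'.val i)).val) _) _)))).trans ?_
  omega

end MatrixChannel

namespace MatrixChannel

variable {R : Type*} [CommRing R] {π : R} {q s : ℕ} {T : Set R}

/-! ### Shapes and exponents -/

theorem lt_shapeExp_iff {μ : Fin s → ℕ} (hμ : Monotone μ) (i : Fin s) (j : ℕ) :
    (i : ℕ) < shapeExp μ j ↔ μ i ≤ j := by
  constructor
  · intro hi
    by_contra hlt
    have hsub : (Finset.univ.filter fun i' => μ i' ≤ j) ⊆ Finset.Iio i := fun i' hi' => by
      simp only [Finset.mem_filter, Finset.mem_univ, true_and, Finset.mem_Iio] at hi' ⊢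
      by_contra hle
      have := hμ (not_lt.1 hle)
      omega
    have := Finset.card_le_card hsub
    rw [Fin.card_Iio] at this
    rw [shapeExp] at hi
    omega
  · intro hi
    have hsub : Finset.Iic i ⊆ Finset.univ.filter fun i' => μ i' ≤ j := fun i' hi' => by
      simp only [Finset.mem_filter, Finset.mem_univ, true_and, Finset.mem_Iic] at hi' ⊢
      exact (hμ hi').trans hi
    have := Finset.card_le_card hsub
    rw [Fin.card_Iic] at this
    rw [shapeExp]
    omega

theorem le_shapeLen (μ : Fin s → ℕ) (i : Fin s) : μ i ≤ shapeLen μ :=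
  Finset.le_sup (f := μ) (Finset.mem_univ i)

theorem card_fin_ge (s l : ℕ) : (Finset.univ.filter fun i : Fin s => l ≤ (i : ℕ)).card = s - l := by
  have h1 : (Finset.univ.filter fun i : Fin s => (i : ℕ) < l).card = min s l := by
    rw [← Finset.card_map Fin.valEmbedding]
    have : (Finset.univ.filter fun i : Fin s => (i : ℕ) < l).map Fin.valEmbedding =
        Finset.range (min s l) := by
      ext x
      simp only [Finset.mem_map, Finset.mem_filter, Finset.mem_univ, true_and, Finset.mem_range,
        Fin.valEmbedding_apply]
      constructor
      · rintro ⟨i, hi, rfl⟩; have := i.2; omega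
      · intro hx; exact ⟨⟨x, by omega⟩, by simp; omega, rfl⟩
    rw [this, Finset.card_range]
  have h2 := Finset.card_filter_add_card_filter_not (s := (Finset.univ : Finset (Fin s)))
    (fun i : Fin s => (i : ℕ) < l)
  simp only [not_lt] at h2
  rw [Finset.card_univ, Fintype.card_fin] at h2
  omega

theorem sub_max_shapeExp {μ : Fin s → ℕ} (hμ : Monotone μ) (l j : ℕ) :
    s - max l (shapeExp μ j) = (Finset.univ.filter fun i : Fin s => l ≤ (i : ℕ) ∧ j < μ i).card := by
  rw [← card_fin_ge]
  congr 1
  ext i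
  have := lt_shapeExp_iff hμ i j
  simp only [Finset.mem_filter, Finset.mem_univ, true_and]
  omega

theorem sum_sub_max_shapeExp {μ : Fin s → ℕ} (hμ : Monotone μ) {m : ℕ} (hm : ∀ i, μ i ≤ m)
    (l a : ℕ) :
    ∑ j : Fin m, (if (j : ℕ) < a then 0 else s - max l (shapeExp μ j)) =
      ∑ i : Fin s, if l ≤ (i : ℕ) then μ i - a else 0 := by
  simp_rw [sub_max_shapeExp hμ, Finset.card_filter]
  have h1 : ∀ j : Fin m, (if (j : ℕ) < a then 0 else ∑ i : Fin s, if l ≤ (i : ℕ) ∧ (j : ℕ) < μ i then 1 else 0) =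
      ∑ i : Fin s, if l ≤ (i : ℕ) then (if a ≤ (j : ℕ) ∧ (j : ℕ) < μ i then 1 else 0) else 0 := by
    intro j
    split_ifs with hj
    · symm; apply Finset.sum_eq_zero; intro i _
      rw [if_neg (by omega : ¬ (a ≤ (j : ℕ) ∧ (j : ℕ) < μ i))]; simp
    · refine Finset.sum_congr rfl fun i _ => ?_
      split_ifs <;> first | rfl | omega
  simp_rw [h1]
  rw [Finset.sum_comm]
  refine Finset.sum_congr rfl fun i _ => ?_
  split_ifs with hl
  · rw [← Finset.card_filter, ← Finset.card_map Fin.valEmbedding, ← Nat.card_Ico]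
    congr 1
    ext x
    simp only [Finset.mem_map, Finset.mem_filter, Finset.mem_univ, true_and, Finset.mem_Ico,
      Fin.valEmbedding_apply]
    constructor
    · rintro ⟨i, hi, rfl⟩; exact hi
    · intro hx; exact ⟨⟨x, hx.2.trans_le (hm i)⟩, hx, rfl⟩
  · simp

theorem mem_chainModule {μ : Fin s → ℕ} {m : ℕ} {x : Fin m → R} :
    x ∈ chainModule π μ m ↔ ∀ j : Fin m, π ^ shapeExp μ j ∣ x j := by
  constructor
  · intro hx j
    exact Ideal.mem_span_singleton.1 (hx j (Set.mem_univ j))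
  · intro hx j _
    exact Ideal.mem_span_singleton.2 (hx j)

theorem mem_rowMatrices {μ : Fin s → ℕ} {n m : ℕ} {A : Matrix (Fin n) (Fin m) R} :
    A ∈ rowMatrices π μ n m ↔ ∀ (i : Fin n) (j : Fin m), π ^ shapeExp μ j ∣ A i j :=
  forall_congr' fun _ => mem_chainModule

theorem mem_shapeMatrices (h : IsFiniteChainRing π q s) {μ : Fin s → ℕ} {n m c : ℕ}
    {A : Matrix (Fin n) (Fin m) R} :
    A ∈ shapeMatrices π (fun _ => c) μ n m ↔ A ∈ rowMatrices π μ n m ∧ HasRank c A := by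
  rw [← hasMatrixShape_const_iff h.s_pos]; rfl

/-! ### Principal row canonical forms -/

theorem isRowCanonical_iff_of_diag (h : IsFiniteChainRing π q s) {k m : ℕ} (hk : k ≤ m)
    (A : Matrix (Fin k) (Fin m) R) :
    (IsRowCanonical π s T A ∧ ∀ (i : Fin k) (j : Fin m), (i : ℕ) = j → A i j = 1) ↔
      ∀ (i : Fin k) (j : Fin m), (j : ℕ) < k → A i j = if (i : ℕ) = j then 1 else 0 := by
  have hdvd : ∀ l, π ^ l ∣ (1 : R) → l = 0 := fun l hl => by
    by_contra hne
    exact h.not_isUnit (isUnit_of_dvd_one ((dvd_pow_self π hne).trans hl))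
  constructor
  · rintro ⟨hc, hd⟩
    have hst := hc.staircase h
    have hd' : ∀ i : Fin k, A i ⟨i, i.2.trans_le hk⟩ = 1 := fun i => hd _ _ rfl
    have hp : ∀ i, ∃ j, PivotAt π s T A i j 0 := fun i => by
      rcases hst i with h0 | ⟨j, l, hp⟩
      · exfalso
        have := hd' i
        rw [h0 i le_rfl] at this
        exact h.nontrivial.exists_pair_ne.elim fun a ⟨b, hab⟩ => hab (eq_of_zero_eq_one this a b)
      · have := hdvd l (hd' i ▸ hp.dvd i le_rfl _)
        subst this; exact ⟨j, hp⟩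
    choose f hf using hp
    have hle : ∀ i, (f i : ℕ) ≤ i := fun i => by
      by_contra hlt
      have := (hf i).dvd_left i le_rfl ⟨i, i.2.trans_le hk⟩ (Fin.lt_def.2 (not_le.1 hlt))
      rw [hd'] at this
      exact absurd (hdvd _ this) (by omega)
    have hmono : StrictMono f := by
      intro i i' hi
      by_contra hlt
      rcases (not_lt.1 hlt).eq_or_lt with heq | hlt
      · have h1 := (hf i).below i' hi
        rw [← heq, (hf i').eq] at h1
        exact h.pow_ne_zero h.s_pos h1
      · have h1 := (hf i).dvd_left i' hi.le _ hlt
        rw [(hf i').eq, pow_zero] at h1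
        exact absurd (hdvd _ h1) (by omega)
    have hge : ∀ (a : ℕ) (ha : a < k), a ≤ f ⟨a, ha⟩ := by
      intro a
      induction a with
      | zero => intro _; exact Nat.zero_le _
      | succ a ih =>
        intro ha
        have h1 := ih (by omega)
        have h2 : f ⟨a, by omega⟩ < f ⟨a + 1, ha⟩ := hmono (Fin.mk_lt_mk.2 (Nat.lt_succ_self a))
        rw [Fin.lt_def] at h2
        omega
    intro i j hj
    have hfj : f ⟨j, hj⟩ = j := Fin.ext (le_antisymm (hle ⟨j, hj⟩) (hge j hj))
    have hpj := hf ⟨j, hj⟩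
    rw [hfj] at hpj
    rcases lt_trichotomy (i : ℕ) j with hlt | heq | hlt
    · have := hpj.above i hlt
      rw [IsFiniteChainRing.residues_zero] at this
      rw [if_neg hlt.ne]; exact this
    · rw [if_pos heq]; exact hd i j heq
    · rw [if_neg hlt.ne']; exact hpj.below i hlt
  · intro hA
    refine ⟨Staircase.isRowCanonical h fun i => Or.inr ⟨⟨i, i.2.trans_le hk⟩, 0, h.s_pos, ?_, ?_, ?_, ?_, ?_⟩, ?_⟩
    · rw [hA i _ i.2]; simp
    · intro i' _ j'; simp
    · intro i' hi' j' hj'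
      rw [Fin.lt_def] at hj'
      rw [hA i' j' (hj'.trans i.2), if_neg]
      · exact dvd_zero _
      · have := Fin.le_def.1 hi'; dsimp only at hj'; omega
    · intro i' hi'
      rw [hA i' _ i.2, if_neg]
      have := Fin.lt_def.1 hi'; dsimp only; omega
    · intro i' hi'
      rw [hA i' _ i.2, if_neg, IsFiniteChainRing.residues_zero]
      · rfl
      · have := Fin.lt_def.1 hi'; dsimp only; omega
    · intro i j hij
      rw [hA i j (hij ▸ i.2), if_pos hij]

theorem hasRank_of_identity_block {k m : ℕ} {A : Matrix (Fin k) (Fin m) R}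
    {f : Fin k → Fin m} (hA : ∀ i i', A i (f i') = if i = i' then 1 else 0) : HasRank k A := by
  let W : Matrix (Fin m) (Fin k) R := Matrix.of fun j i' => if j = f i' then 1 else 0
  have h1 : A * W = 1 := by
    ext i i'
    rw [Matrix.mul_apply]
    simp [W, hA, Matrix.one_apply]
  have := hasRank_of_factor (L := (1 : Matrix (Fin k) (Fin k) R)) (L' := 1) (Matrix.mul_one _) h1
  rwa [Matrix.one_mul, Fintype.card_fin] at this

theorem mem_principalForms_iff (h : IsFiniteChainRing π q s) {μ : Fin s → ℕ} {k m : ℕ} (hk : k ≤ m)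
    {A : Matrix (Fin k) (Fin m) R} :
    A ∈ principalForms π T (fun _ => k) μ k m ↔ A ∈ rowMatrices π μ k m ∧
      ∀ (i : Fin k) (j : Fin m), (j : ℕ) < k → A i j = if (i : ℕ) = j then 1 else 0 := by
  rw [← isRowCanonical_iff_of_diag (T := T) h hk, principalForms]
  have h1 : ∀ (i : Fin k) (j : Fin m), ((i : ℕ) = j → A i j = π ^ shapeExp (fun _ : Fin s => k) i) ↔
      ((i : ℕ) = j → A i j = 1) := fun i j => by
    rw [shapeExp_const_of_lt i.2, pow_zero]
  simp only [Set.mem_ofPred_eq, h1]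
  rw [mem_shapeMatrices h]
  constructor
  · rintro ⟨⟨h2, -⟩, h3⟩; exact ⟨h2, h3⟩
  · rintro ⟨h2, h3⟩
    refine ⟨⟨h2, ?_⟩, h3⟩
    have h4 := (isRowCanonical_iff_of_diag h hk A).1 h3
    exact hasRank_of_identity_block (f := fun i => ⟨i, i.2.trans_le hk⟩) fun i i' => by
      rw [h4 i _ i'.2]; simp [Fin.ext_iff]

theorem card_principalForms (h : IsFiniteChainRing π q s) {μ : Fin s → ℕ} (hμ : Monotone μ) {k m : ℕ}
    (hm : ∀ i, μ i ≤ m) (hk : ∀ i, k ≤ μ i) :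
    Nat.card (principalForms π T (fun _ => k) μ k m) = q ^ ∑ i, k * (μ i - k) := by
  have hkm : k ≤ m := (hk ⟨0, h.s_pos⟩).trans (hm _)
  let A₀ : Matrix (Fin k) (Fin m) R := fun i j => if (i : ℕ) = j then 1 else 0
  let e : Fin k → Fin m → ℕ := fun _ j => if (j : ℕ) < k then s else shapeExp μ j
  have key : ∀ A : Matrix (Fin k) (Fin m) R,
      A ∈ principalForms π T (fun _ => k) μ k m ↔ ∀ i j, π ^ e i j ∣ (A - A₀) i j := by
    intro A
    rw [mem_principalForms_iff h hkm, mem_rowMatrices]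
    have h0 : ∀ j : Fin m, (j : ℕ) < k → shapeExp μ j = 0 := fun j hj =>
      Finset.card_eq_zero.2 (Finset.filter_false_of_mem fun i _ => by have := hk i; omega)
    constructor
    · rintro ⟨h1, h2⟩ i j
      by_cases hj : (j : ℕ) < k
      · rw [Matrix.sub_apply, h2 i j hj, sub_self]; exact dvd_zero _
      · have hij : (i : ℕ) ≠ j := by have := i.2; omega
        rw [Matrix.sub_apply, show A₀ i j = 0 from if_neg hij, sub_zero,
          show e i j = shapeExp μ j from if_neg hj]
        exact h1 i j
    · intro hA
      refine ⟨fun i j => ?_, fun i j hj => ?_⟩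
      · by_cases hj : (j : ℕ) < k
        · rw [h0 j hj]; simp
        · have hij : (i : ℕ) ≠ j := by have := i.2; omega
          have h3 := hA i j
          rw [Matrix.sub_apply, show A₀ i j = 0 from if_neg hij, sub_zero,
            show e i j = shapeExp μ j from if_neg hj] at h3
          exact h3
      · have := hA i j
        simp only [e, hj, if_true] at this
        exact sub_eq_zero.1 (h.eq_zero_of_dvd le_rfl this)
  have h1 := h.card_matrix_dvd e
  have h2 : ∀ i : Fin k, ∑ j : Fin m, (s - e i j) = ∑ i, (μ i - k) := by
    intro i
    have := sum_sub_max_shapeExp hμ hm 0 k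
    simp only [Nat.zero_le, if_true, Nat.zero_max] at this
    rw [← this]
    refine Finset.sum_congr rfl fun j _ => ?_
    simp only [e]; split_ifs <;> omega
  rw [Finset.sum_congr rfl fun i _ => h2 i, Finset.sum_const, Finset.card_univ, Fintype.card_fin,
    smul_eq_mul, Finset.mul_sum] at h1
  rw [← h1]
  exact Nat.card_congr ((Equiv.subRight A₀).subtypeEquiv key)

/-! ### Encoding -/

theorem encode_injective {n m v k : ℕ} (hk : k ≤ n) (hv : v ≤ m) :
    Function.Injective (encode (R := R) n : Matrix (Fin k) (Fin (m - v)) R → Matrix (Fin n) (Fin m) R) := by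
  intro M M' hM
  ext a b
  have h1 := congrFun (congrFun hM ⟨n - k + a, by omega⟩) ⟨v + b, by omega⟩
  have hc : n ≤ n - k + (a : ℕ) + k ∧ v ≤ v + (b : ℕ) := by omega
  simp only [encode, hc, and_self, dif_pos] at h1
  convert h1 using 2 <;> (ext; simp; try omega)

/-- The message `M` preceded by `v` zero columns. -/
def padLeft {m v k : ℕ} (M : Matrix (Fin k) (Fin (m - v)) R) : Matrix (Fin k) (Fin m) R :=
  fun i j => if h : v ≤ j then M i ⟨j - v, by omega⟩ else 0

/-- The last `k` columns of a matrix. -/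
def lastCols {N n k : ℕ} (hk : k ≤ n) (A : Matrix (Fin N) (Fin n) R) : Matrix (Fin N) (Fin k) R :=
  A.submatrix id fun a => ⟨n - k + a, by omega⟩

theorem mul_encode {N n m v k : ℕ} (hk : k ≤ n) (A : Matrix (Fin N) (Fin n) R)
    (M : Matrix (Fin k) (Fin (m - v)) R) : A * encode n M = lastCols hk A * padLeft M := by
  ext i j
  rw [Matrix.mul_apply, Matrix.mul_apply]
  let f : Fin k → Fin n := fun a => ⟨n - k + a, by omega⟩
  have hf : Function.Injective f := fun a b hab => by
    have := Fin.val_eq_of_eq hab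
    simp only [f] at this
    ext; omega
  have h2 : ∑ a, lastCols hk A i a * padLeft M a j = ∑ x ∈ Finset.univ.map ⟨f, hf⟩, A i x * encode n M x j := by
    rw [Finset.sum_map]
    refine Finset.sum_congr rfl fun a _ => ?_
    refine congrArg₂ (· * ·) rfl ?_
    by_cases hv : v ≤ (j : ℕ)
    · have hc : n ≤ n - k + (a : ℕ) + k ∧ v ≤ (j : ℕ) := by omega
      simp only [padLeft, encode, hv, dif_pos, Function.Embedding.coeFn_mk, f, hc, and_self]
      congr 1
      ext; dsimp only; omega
    · simp [padLeft, encode, hv]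
  rw [h2]
  symm
  apply Finset.sum_subset (Finset.subset_univ _)
  intro x _ hx
  have : ¬ n ≤ (x : ℕ) + k := fun hle => hx (by
    rw [Finset.mem_map]
    exact ⟨⟨x + k - n, by omega⟩, Finset.mem_univ _, by ext; simp [f]; omega⟩)
  simp [encode, this]

theorem padLeft_mem_rowMatrices {μ : Fin s → ℕ} {m v k : ℕ} (hv : ∀ i, v ≤ μ i)
    {M : Matrix (Fin k) (Fin (m - v)) R} (hM : M ∈ rowMatrices π (fun i => μ i - v) k (m - v)) :
    padLeft M ∈ rowMatrices π μ k m := by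
  rw [mem_rowMatrices] at hM ⊢
  intro i j
  rw [padLeft]
  split_ifs with hj
  · convert hM i _ using 2
    rw [shapeExp, shapeExp]
    congr 1
    ext a
    have := hv a
    simp only [Finset.mem_filter, Finset.mem_univ, true_and]
    omega
  · exact dvd_zero _

theorem encode_mem_rowMatrices {μ : Fin s → ℕ} {n m v k : ℕ} (hv : ∀ i, v ≤ μ i)
    {M : Matrix (Fin k) (Fin (m - v)) R} (hM : M ∈ rowMatrices π (fun i => μ i - v) k (m - v)) :
    encode n M ∈ rowMatrices π μ n m := by
  have h1 := mem_rowMatrices.1 (padLeft_mem_rowMatrices hv hM)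
  rw [mem_rowMatrices]
  intro i j
  rw [encode]
  split_ifs with hj
  · have := h1 ⟨i + k - n, by omega⟩ j
    rwa [padLeft, dif_pos hj.2] at this
  · exact dvd_zero _

end MatrixChannel

namespace MatrixChannel

variable {R : Type*} [CommRing R] {π : R} {q s : ℕ} {T : Set R}

/-! ### A successful decoding is correct -/

theorem card_sup_le {M : Type*} [AddCommGroup M] [Module R M] [Finite M] (S S' : Submodule R M) :
    Nat.card (S ⊔ S' : Submodule R M) ≤ Nat.card S * Nat.card S' := by
  rw [← Nat.card_prod]
  apply Nat.card_le_card_of_surjective (f := fun x : S × S' =>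
    (⟨x.1.1 + x.2.1, Submodule.add_mem_sup x.1.2 x.2.2⟩ : (S ⊔ S' : Submodule R M)))
  rintro ⟨x, hx⟩
  obtain ⟨y, hy, z, hz, rfl⟩ := Submodule.mem_sup.1 hx
  exact ⟨(⟨y, hy⟩, ⟨z, hz⟩), rfl⟩

/-- Cancel the coordinates `v, ..., v + k - 1` with the help of the rows of `W`. -/
def cancelCols {m k : ℕ} (f : Fin k → Fin m) (W : Matrix (Fin k) (Fin m) R) :
    (Fin m → R) →ₗ[R] (Fin m → R) :=
  LinearMap.id - W.vecMulLinear.comp (LinearMap.funLeft R R f)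

theorem cancelCols_apply {m k : ℕ} (f : Fin k → Fin m) (W : Matrix (Fin k) (Fin m) R)
    (x : Fin m → R) : cancelCols f W x = x - Matrix.vecMul (fun a => x (f a)) W := rfl

section Success

variable {m k : ℕ} {f : Fin k → Fin m} {W : Matrix (Fin k) (Fin m) R}

theorem vecMul_identity_block (hW : ∀ i i', W i (f i') = if i = i' then 1 else 0) (c : Fin k → R)
    (a : Fin k) : Matrix.vecMul c W (f a) = c a := by
  rw [Matrix.vecMul, dotProduct]
  simp [hW]

theorem cancelCols_coord (hW : ∀ i i', W i (f i') = if i = i' then 1 else 0) (x : Fin m → R)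
    (a : Fin k) : cancelCols f W x (f a) = 0 := by
  rw [cancelCols_apply, Pi.sub_apply, vecMul_identity_block hW, sub_self]

theorem cancelCols_of_mem (hW : ∀ i i', W i (f i') = if i = i' then 1 else 0) {x : Fin m → R}
    (hx : x ∈ rowSpan W) : cancelCols f W x = 0 := by
  obtain ⟨c, rfl⟩ := mem_rowSpan.1 hx
  rw [cancelCols_apply]
  simp only [vecMul_identity_block hW, sub_self]

end Success

theorem rcf_rows_of_success (h : IsFiniteChainRing π q s) (hT : IsResidueSystem π T)
    {N m t v k : ℕ} (hvk : v + k ≤ m) {Y Z : Matrix (Fin N) (Fin m) R} {W : Matrix (Fin k) (Fin m) R}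
    (hZ : HasRank t Z) (hW0 : ∀ i (j : Fin m), (j : ℕ) < v → W i j = 0)
    (hW : ∀ i (i' : Fin k), W i ⟨v + i', by omega⟩ = if i = i' then 1 else 0)
    (hY : rowSpan Y ≤ rowSpan Z ⊔ rowSpan W)
    (hsucc : HasRank (t + k) (Y.submatrix id (Subtype.val : {j : Fin m // (j : ℕ) < v + k} → Fin m)))
    (a : Fin k) : ∃ ha : t + a < N, rcf π s T Y ⟨t + a, ha⟩ = W a := by
  have := h.finite
  have hq := h.two_le_q
  set f : Fin k → Fin m := fun i' => ⟨v + i', by omega⟩ with hf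
  let ρ : (Fin m → R) →ₗ[R] ({j : Fin m // (j : ℕ) < v + k} → R) := LinearMap.funLeft R R Subtype.val
  have htN : t + k ≤ N := by
    have h1 : Nat.card (rowSpan (Y.submatrix id (Subtype.val : {j : Fin m // (j : ℕ) < v + k} → Fin m))) ≤
        Nat.card (Fin N → R) := by
      apply Nat.card_le_card_of_surjective (f := fun c : Fin N → R => (⟨Matrix.vecMul c _,
        mem_rowSpan.2 ⟨c, rfl⟩⟩ : rowSpan (Y.submatrix id (Subtype.val : {j : Fin m // (j : ℕ) < v + k} → Fin m))))
      rintro ⟨y, hy⟩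
      obtain ⟨c, rfl⟩ := mem_rowSpan.1 hy
      exact ⟨c, rfl⟩
    rw [hsucc.card_rowSpan h, h.card_fun, Fintype.card_fin,
      Nat.pow_le_pow_iff_right h.two_le_q] at h1
    exact Nat.le_of_mul_le_mul_left h1 h.s_pos
  have hWr : HasRank k W := hasRank_of_identity_block hW
  -- sizes
  have hmap : (rowSpan Y).map ρ =
      rowSpan (Y.submatrix id (Subtype.val : {j : Fin m // (j : ℕ) < v + k} → Fin m)) := by
    rw [rowSpan, rowSpan, Submodule.map_span, ← Set.range_comp]; rfl
  have hc1 : Nat.card ((rowSpan Y).map ρ) = q ^ (s * (t + k)) := by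
    rw [hmap]; exact hsucc.card_rowSpan h
  have hc2 : Nat.card (rowSpan Z ⊔ rowSpan W : Submodule R (Fin m → R)) ≤ q ^ (s * (t + k)) := by
    refine (card_sup_le _ _).trans (le_of_eq ?_)
    rw [hZ.card_rowSpan h, hWr.card_rowSpan h, ← pow_add, mul_add]
  let ρ' : rowSpan Y → (rowSpan Y).map ρ := fun x => ⟨ρ x.1, Submodule.mem_map_of_mem x.2⟩
  have hρ's : Function.Surjective ρ' := by
    rintro ⟨_, x, hx, rfl⟩; exact ⟨⟨x, hx⟩, rfl⟩
  have hc3 := Nat.card_le_card_of_surjective ρ' hρ's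
  have hc4 : Nat.card (rowSpan Y) ≤ Nat.card (rowSpan Z ⊔ rowSpan W : Submodule R (Fin m → R)) :=
    Nat.card_mono (Set.toFinite _) hY
  have hcY : Nat.card (rowSpan Y) = q ^ (s * (t + k)) := by omega
  have hYeq : rowSpan Y = rowSpan Z ⊔ rowSpan W := by
    apply SetLike.coe_injective
    exact Set.eq_of_subset_of_ncard_le hY (by
      rw [← Nat.card_coe_set_eq, ← Nat.card_coe_set_eq]; exact hc2.trans hcY.ge) (Set.toFinite _)
  have hρinj : ∀ x ∈ rowSpan Y, ρ x = 0 → x = 0 := by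
    have hb := hρ's.bijective_of_nat_card_le (by rw [hcY, hc1])
    intro x hx h0
    have := @hb.1 ⟨x, hx⟩ ⟨0, zero_mem _⟩ (Subtype.ext (by simp [ρ', h0]))
    exact congrArg Subtype.val this
  -- the complement `S₀` of the span of `W`
  set φ := cancelCols f W with hφ
  set S₀ := (rowSpan Y).map φ with hS₀
  have hWY : rowSpan W ≤ rowSpan Y := hYeq ▸ le_sup_right
  have hS₀Y : S₀ ≤ rowSpan Y := by
    rintro _ ⟨x, hx, rfl⟩
    exact Submodule.sub_mem _ hx (hWY (mem_rowSpan.2 ⟨_, rfl⟩))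
  have hS₀0 : ∀ x ∈ S₀, ∀ a, x (f a) = 0 := by
    rintro _ ⟨x, -, rfl⟩ a
    exact cancelCols_coord hW x a
  have hsum : rowSpan Y ≤ S₀ ⊔ rowSpan W := by
    intro x hx
    have : x = φ x + Matrix.vecMul (fun a => x (f a)) W := by
      rw [hφ, cancelCols_apply, sub_add_cancel]
    rw [this]
    exact Submodule.add_mem_sup ⟨x, hx, rfl⟩ (mem_rowSpan.2 ⟨_, rfl⟩)
  have hS₀Z : S₀ = (rowSpan Z).map φ := by
    rw [hS₀, hYeq, Submodule.map_sup]
    apply sup_eq_left.2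
    rintro _ ⟨x, hx, rfl⟩
    rw [hφ, cancelCols_of_mem hW hx]; exact zero_mem _
  have hS₀free : Nonempty (S₀ ≃ₗ[R] (Fin t → R)) := by
    obtain ⟨e⟩ := hZ
    let g : rowSpan Z →ₗ[R] S₀ := (φ.comp (rowSpan Z).subtype).codRestrict _ fun x =>
      hS₀Z ▸ Submodule.mem_map_of_mem x.2
    have hg : Function.Surjective g := by
      rintro ⟨y, hy⟩
      rw [hS₀Z] at hy
      obtain ⟨x, hx, rfl⟩ := hy
      exact ⟨⟨x, hx⟩, rfl⟩
    have hcS : Nat.card (rowSpan Z) ≤ Nat.card S₀ := by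
      have h1 := Nat.card_mono (Set.toFinite ((S₀ ⊔ rowSpan W : Submodule R (Fin m → R)) : Set (Fin m → R))) hsum
      have h2 := (card_sup_le S₀ (rowSpan W))
      have h3 : q ^ (s * (t + k)) ≤ Nat.card S₀ * q ^ (s * k) := by
        rw [← hcY, ← hWr.card_rowSpan h]; exact h1.trans h2
      rw [mul_add, pow_add] at h3
      rw [HasRank.card_rowSpan h ⟨e⟩]
      exact Nat.le_of_mul_le_mul_right h3 (by positivity)
    exact ⟨(LinearEquiv.ofBijective g (hg.bijective_of_nat_card_le hcS)).symm.trans e⟩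
  let G : Matrix (Fin N) (Fin m) R := fun i => φ (Y i)
  have hG : rowSpan G = S₀ := by
    rw [hS₀, rowSpan, rowSpan, Submodule.map_span, ← Set.range_comp]; rfl
  obtain ⟨hH, hHG⟩ := rcfAlgorithm_spec h hT G
  generalize (rcfAlgorithm π s T G).val = H at hH hHG
  have hHS : rowSpan H = S₀ := hHG.rowSpan_eq.symm.trans hG
  have hHr : HasRank t H := by rw [HasRank, hHS]; exact hS₀free
  have hrow := hH.rows_of_hasRank h hHr
  have hHmem : ∀ i, H i ∈ S₀ := fun i => hHS ▸ row_mem_rowSpan H i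
  have hpiv : ∀ i : Fin N, (i : ℕ) < t → ∃ j, PivotAt π s T H i j 0 ∧ (j : ℕ) < v := by
    intro i hi
    obtain ⟨j, hj⟩ := (hrow i).1 hi
    refine ⟨j, hj, ?_⟩
    by_contra hjv
    have h0 : ρ (π ^ (s - 1) • H i) = 0 := by
      ext ⟨j', hj'⟩
      change π ^ (s - 1) * H i j' = 0
      by_cases hlt : (j' : ℕ) < v
      · have := hj.dvd_left i le_rfl j' (Fin.lt_def.2 (by omega))
        rw [h.socle_mul_eq_zero_iff]; simpa using this
      · have : j' = f ⟨j' - v, by omega⟩ := by ext; simp [hf]; omega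
        rw [this, hS₀0 _ (hHmem i), mul_zero]
    have h1 := hρinj _ (Submodule.smul_mem _ _ (hS₀Y (hHmem i))) h0
    have h2 := congrFun h1 j
    rw [Pi.smul_apply, smul_eq_mul, hj.eq] at h2
    exact h.pow_ne_zero (l := s - 1) (by have := h.s_pos; omega) (by simpa using h2)
  -- the row canonical form
  let C : Matrix (Fin N) (Fin m) R := fun i =>
    if (i : ℕ) < t then H i else if hk : (i : ℕ) - t < k then W ⟨i - t, hk⟩ else 0
  have hC1 : ∀ i : Fin N, (i : ℕ) < t → C i = H i := fun i hi => if_pos hi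
  have hC2 : ∀ (i : Fin N) (a : Fin k), (i : ℕ) = t + a → C i = W a := fun i a hi => by
    have h1 : ¬ (i : ℕ) < t := by omega
    have h2 : (i : ℕ) - t < k := by omega
    simp only [C, h1, if_false, h2, dif_pos]
    congr 1; ext; dsimp only; omega
  have hC3 : ∀ i : Fin N, t + k ≤ (i : ℕ) → C i = 0 := fun i hi => by
    have h1 : ¬ (i : ℕ) < t := by omega
    have h2 : ¬ (i : ℕ) - t < k := by omega
    simp only [C, h1, if_false, h2, dif_neg, not_false_eq_true]
  have hcases : ∀ i : Fin N, (i : ℕ) < t ∨ (∃ a : Fin k, (i : ℕ) = t + a) ∨ t + k ≤ (i : ℕ) := by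
    intro i
    by_cases h1 : (i : ℕ) < t
    · exact Or.inl h1
    · by_cases h2 : (i : ℕ) - t < k
      · exact Or.inr (Or.inl ⟨⟨i - t, h2⟩, by dsimp only; omega⟩)
      · exact Or.inr (Or.inr (by omega))
  have hCst : Staircase π s T C := by
    intro i
    rcases hcases i with hi | ⟨a, hi⟩ | hi
    · right
      obtain ⟨j, hj, hjv⟩ := hpiv i hi
      refine ⟨j, 0, h.s_pos, by rw [hC1 i hi, hj.eq], fun i' _ j' => by simp, ?_, ?_, ?_⟩
      · intro i' hi' j' hj'
        rcases hcases i' with hi2 | ⟨b, hi2⟩ | hi2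
        · rw [hC1 i' hi2]; exact hj.dvd_left i' hi' j' hj'
        · rw [hC2 i' b hi2, hW0 b j' (lt_trans (Fin.lt_def.1 hj') hjv)]; exact dvd_zero _
        · rw [hC3 i' hi2]; exact dvd_zero _
      · intro i' hi'
        rcases hcases i' with hi2 | ⟨b, hi2⟩ | hi2
        · rw [hC1 i' hi2]; exact hj.below i' hi'
        · rw [hC2 i' b hi2, hW0 b j hjv]
        · rw [hC3 i' hi2]; rfl
      · intro i' hi'
        rw [hC1 i' (lt_trans (Fin.lt_def.1 hi') hi)]; exact hj.above i' hi'
    · right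
      refine ⟨f a, 0, h.s_pos, by rw [hC2 i a hi, hW, if_pos rfl, pow_zero], fun i' _ j' => by simp,
        ?_, ?_, ?_⟩
      · intro i' hi' j' hj'
        have hle := Fin.le_def.1 hi'
        rcases hcases i' with hi2 | ⟨b, hi2⟩ | hi2
        · omega
        · rw [hC2 i' b hi2]
          by_cases hlt : (j' : ℕ) < v
          · rw [hW0 b j' hlt]; exact dvd_zero _
          · have hj2 : (j' : ℕ) < v + a := Fin.lt_def.1 hj'
            have : j' = f ⟨j' - v, by omega⟩ := by ext; simp [hf]; omega
            rw [this, hW, if_neg]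
            · exact dvd_zero _
            · intro he
              have := Fin.val_eq_of_eq he
              dsimp only at this
              omega
        · rw [hC3 i' hi2]; exact dvd_zero _
      · intro i' hi'
        have hlt := Fin.lt_def.1 hi'
        rcases hcases i' with hi2 | ⟨b, hi2⟩ | hi2
        · omega
        · rw [hC2 i' b hi2, hW, if_neg]
          rintro rfl; omega
        · rw [hC3 i' hi2]; rfl
      · intro i' hi'
        have hlt := Fin.lt_def.1 hi'
        rw [IsFiniteChainRing.residues_zero, Set.mem_singleton_iff]
        rcases hcases i' with hi2 | ⟨b, hi2⟩ | hi2
        · rw [hC1 i' hi2]; exact hS₀0 _ (hHmem i') a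
        · rw [hC2 i' b hi2, hW, if_neg]
          rintro rfl; omega
        · omega
    · left
      intro i' hi'
      exact hC3 i' (hi.trans (Fin.le_def.1 hi'))
  have hCspan : rowSpan Y = rowSpan C := by
    apply le_antisymm
    · refine hsum.trans (sup_le ?_ ?_)
      · rw [← hHS, rowSpan, Submodule.span_le]
        rintro _ ⟨i, rfl⟩
        by_cases hi : (i : ℕ) < t
        · have := row_mem_rowSpan C i
          rwa [hC1 i hi] at this
        · have : H.row i = 0 := (hrow i).2 (by omega)
          rw [this]; exact zero_mem _
      · rw [rowSpan, Submodule.span_le]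
        rintro _ ⟨b, rfl⟩
        have := row_mem_rowSpan C ⟨t + b, by omega⟩
        rwa [hC2 _ b rfl] at this
    · rw [rowSpan, Submodule.span_le]
      rintro _ ⟨i, rfl⟩
      change C i ∈ rowSpan Y
      rcases hcases i with hi | ⟨b, hi⟩ | hi
      · rw [hC1 i hi]; exact hS₀Y (hHmem i)
      · rw [hC2 i b hi]; exact hWY (row_mem_rowSpan W b)
      · rw [hC3 i hi]; exact zero_mem _
  refine ⟨by omega, ?_⟩
  rw [rcf_eq_of_staircase h hT hCst hCspan, hC2 _ a rfl]

/-- The row span of a sum of matrices. -/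
theorem rowSpan_add_le {α β γ : Type*} [Fintype α] [Fintype γ] (A : Matrix α γ R) (W : Matrix γ β R)
    (Z : Matrix α β R) : rowSpan (A * W + Z) ≤ rowSpan Z ⊔ rowSpan W := by
  rw [rowSpan, Submodule.span_le]
  rintro _ ⟨i, rfl⟩
  change (A * W) i + Z i ∈ _
  rw [add_comm]
  exact Submodule.add_mem_sup (row_mem_rowSpan Z i) (rowSpan_mul_le A W (row_mem_rowSpan _ i))

theorem hasRank_rcf_submatrix_iff (h : IsFiniteChainRing π q s) (hT : IsResidueSystem π T)
    {N m c : ℕ} (p : Fin m → Prop) (Y : Matrix (Fin N) (Fin m) R) :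
    HasRank c ((rcf π s T Y).submatrix id (Subtype.val : {j // p j} → Fin m)) ↔
      HasRank c (Y.submatrix id (Subtype.val : {j // p j} → Fin m)) := by
  obtain ⟨-, U, hU, hUY⟩ := rcf_spec h hT Y
  refine (LeftEquiv.hasRank_iff ⟨U, hU, ?_⟩).symm
  rw [← hUY]; rfl

theorem padLeft_eq_zero {m v k : ℕ} (M : Matrix (Fin k) (Fin (m - v)) R) (i : Fin k) (j : Fin m)
    (hj : (j : ℕ) < v) : padLeft M i j = 0 := dif_neg (not_le.2 hj)

theorem padLeft_add {m v k : ℕ} (M : Matrix (Fin k) (Fin (m - v)) R) (i : Fin k) (b : ℕ)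
    (hb : v + b < m) : padLeft M i ⟨v + b, hb⟩ = M i ⟨b, by omega⟩ := by
  rw [padLeft, dif_pos (by dsimp only; omega)]
  congr 1; ext; dsimp only; omega

theorem padLeft_identity_block {m v k : ℕ} {M : Matrix (Fin k) (Fin (m - v)) R} (hvk : v + k ≤ m)
    (hM : ∀ (i : Fin k) (j : Fin (m - v)), (j : ℕ) < k → M i j = if (i : ℕ) = j then 1 else 0)
    (i i' : Fin k) : padLeft M i ⟨v + i', by omega⟩ = if i = i' then 1 else 0 := by
  rw [padLeft_add, hM _ _ i'.2]; simp [Fin.ext_iff]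

theorem decode_eq_none_iff (h : IsFiniteChainRing π q s) (hT : IsResidueSystem π T) {N m : ℕ}
    (t v k : ℕ) (Y : Matrix (Fin N) (Fin m) R) : decode π s T t v k Y = none ↔
      ¬ HasRank (t + k) (Y.submatrix id (Subtype.val : {j : Fin m // (j : ℕ) < v + k} → Fin m)) := by
  classical
  rw [decode_eq h, hasRank_rcf_submatrix_iff h hT]
  split_ifs with h1 <;> simp [h1]

theorem decode_correct (h : IsFiniteChainRing π q s) (hT : IsResidueSystem π T) {n N m t v k : ℕ}
    (hkn : k ≤ n) (hvk : v + k ≤ m) {M M' : Matrix (Fin k) (Fin (m - v)) R}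
    (hM : ∀ (i : Fin k) (j : Fin (m - v)), (j : ℕ) < k → M i j = if (i : ℕ) = j then 1 else 0)
    (A : Matrix (Fin N) (Fin n) R) {Z : Matrix (Fin N) (Fin m) R} (hZ : HasRank t Z)
    (hdec : decode π s T t v k (A * encode n M + Z) = some M') : M' = M := by
  classical
  have hsucc : HasRank (t + k) ((A * encode n M + Z).submatrix id
      (Subtype.val : {j : Fin m // (j : ℕ) < v + k} → Fin m)) := by
    by_contra hne
    rw [(decode_eq_none_iff h hT t v k _).2 hne] at hdec
    exact absurd hdec (by simp)
  rw [decode_eq h, if_pos ((hasRank_rcf_submatrix_iff h hT _ _).2 hsucc), Option.some_inj] at hdec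
  rw [← hdec]
  have hrows := rcf_rows_of_success h hT hvk hZ (padLeft_eq_zero M) (padLeft_identity_block hvk hM)
    (by rw [mul_encode hkn]; exact rowSpan_add_le _ _ _) hsucc
  ext a b
  obtain ⟨ha, hrow⟩ := hrows a
  rw [payload, dif_pos ha, hrow, padLeft_add]

end MatrixChannel

namespace MatrixChannel

variable {R : Type*} [CommRing R] {π : R} {q s : ℕ} {T : Set R}

/-! ### Counting incidences with socles -/

theorem le_card_of_ne_bot (h : IsFiniteChainRing π q s) {V : Type*} [AddCommGroup V] [Module R V]
    [Finite V] {M : Submodule R V} (hM : M ≤ Submodule.torsionBy R V π) (hne : M ≠ ⊥) :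
    q ≤ Nat.card M := by
  obtain ⟨x, hx, hx0⟩ := (Submodule.ne_bot_iff M).1 hne
  let f : R →ₗ[R] M := LinearMap.toSpanSingleton R M ⟨x, hx⟩
  have hf : LinearMap.ker f = Ideal.span {π} := by
    ext r
    rw [Ideal.mem_span_singleton, LinearMap.mem_ker]
    have h1 : f r = 0 ↔ r • x = 0 := by
      rw [← ZeroMemClass.coe_eq_zero]; rfl
    rw [h1]
    constructor
    · intro hr
      by_contra hn
      obtain ⟨u, rfl⟩ := (h.isUnit_iff_not_dvd r).2 hn
      apply hx0
      have := congrArg (fun y => (↑u⁻¹ : R) • y) hr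
      simpa [smul_smul] using this
    · rintro ⟨c, rfl⟩
      rw [mul_comm, mul_smul, (Submodule.mem_torsionBy_iff _ _).1 (hM hx), smul_zero]
  rw [← h.card_residueField, ← hf, Nat.card_congr f.quotKerEquivRange.toEquiv]
  exact Nat.card_le_card_of_injective _ (LinearMap.range f).injective_subtype

open Classical in
theorem card_incidence_le {α β : Type*} (S : α → β → Prop) (t : Finset α) (E F : Finset β) (a b : ℕ)
    (hFE : F ⊆ E) (hS : ∀ z ∈ t, (E.filter (S z)).card = a)
    (htrans : ∀ x ∈ E, ∀ y ∈ E, (t.filter fun z => S z x).card ≤ (t.filter fun z => S z y).card)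
    (B : Finset α) (hB : B ⊆ t) (hb : ∀ z ∈ B, b ≤ (F.filter (S z)).card) :
    B.card * b * E.card ≤ F.card * a * t.card := by
  have hswap : ∀ G : Finset β, ∑ z ∈ t, (G.filter (S z)).card = ∑ x ∈ G, (t.filter fun z => S z x).card := by
    intro G
    simp_rw [Finset.card_filter]
    exact Finset.sum_comm
  rcases F.eq_empty_or_nonempty with rfl | ⟨x₀, hx₀⟩
  · rcases B.eq_empty_or_nonempty with rfl | ⟨z, hz⟩
    · simp
    · have := hb z hz
      simp at this
      simp [this]
  · set c := (t.filter fun z => S z x₀).card with hc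
    have hconst : ∀ x ∈ E, (t.filter fun z => S z x).card = c := fun x hx =>
      le_antisymm (htrans x hx x₀ (hFE hx₀)) (htrans x₀ (hFE hx₀) x hx)
    have h1 : B.card * b ≤ F.card * c := by
      calc B.card * b = ∑ z ∈ B, b := by rw [Finset.sum_const, smul_eq_mul]
        _ ≤ ∑ z ∈ B, (F.filter (S z)).card := Finset.sum_le_sum hb
        _ ≤ ∑ z ∈ t, (F.filter (S z)).card := Finset.sum_le_sum_of_subset hB
        _ = ∑ x ∈ F, c := by
          rw [hswap]; exact Finset.sum_congr rfl fun x hx => hconst x (hFE hx)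
        _ = F.card * c := by rw [Finset.sum_const, smul_eq_mul]
    have h2 : E.card * c = t.card * a := by
      calc E.card * c = ∑ x ∈ E, (t.filter fun z => S z x).card := by
            rw [Finset.sum_congr rfl hconst, Finset.sum_const, smul_eq_mul]
        _ = ∑ z ∈ t, (E.filter (S z)).card := (hswap E).symm
        _ = t.card * a := by rw [Finset.sum_congr rfl hS, Finset.sum_const, smul_eq_mul]
    calc B.card * b * E.card ≤ F.card * c * E.card := Nat.mul_le_mul_right _ h1
      _ = F.card * (E.card * c) := by ring
      _ = F.card * a * t.card := by rw [h2]; ring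

open Classical in
theorem card_meeting_le (h : IsFiniteChainRing π q s) {V : Type*} [AddCommGroup V] [Module R V]
    [Finite V] {α : Type*} (t : Finset α) (S : α → Submodule R V) (E F : Submodule R V)
    (hE : E ≤ Submodule.torsionBy R V π) (hFE : F ≤ E) {c : ℕ}
    (hSE : ∀ z ∈ t, S z ≤ E) (hS : ∀ z ∈ t, Nat.card (S z) = c)
    (htrans : ∀ x ∈ E, ∀ y ∈ E, x ≠ 0 → y ≠ 0 →
      (t.filter fun z => x ∈ S z).card ≤ (t.filter fun z => y ∈ S z).card) :
    (t.filter fun z => F ⊓ S z ≠ ⊥).card * (q - 1) * (Nat.card E - 1) ≤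
      (Nat.card F - 1) * (c - 1) * t.card := by
  have := Fintype.ofFinite V
  have hcard : ∀ M : Submodule R V, (Finset.univ.filter fun x => x ∈ M ∧ x ≠ 0).card = Nat.card M - 1 := by
    intro M
    have h1 : (Finset.univ.filter fun x => x ∈ M).card = Nat.card M := by
      rw [Nat.card_eq_fintype_card, Fintype.card_subtype]
    have h2 : (Finset.univ.filter fun x => x ∈ M ∧ x ≠ 0) =
        (Finset.univ.filter fun x => x ∈ M).erase 0 := by
      ext x; simp [and_comm]
    rw [h2, Finset.card_erase_of_mem (by simp), h1]
  have hfilt : ∀ M M' : Submodule R V, ((Finset.univ.filter fun x => x ∈ M ∧ x ≠ 0).filter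
      fun x => x ∈ M') = Finset.univ.filter fun x => x ∈ M ⊓ M' ∧ x ≠ 0 := by
    intro M M'
    ext x
    simp only [Finset.mem_filter, Finset.mem_univ, true_and, Submodule.mem_inf]
    tauto
  rw [← hcard E, ← hcard F]
  apply card_incidence_le (fun z x => x ∈ S z) t
  · intro x hx
    simp only [Finset.mem_filter, Finset.mem_univ, true_and] at hx ⊢
    exact ⟨hFE hx.1, hx.2⟩
  · intro z hz
    rw [hfilt, hcard, inf_eq_right.2 (hSE z hz), hS z hz]
  · intro x hx y hy
    simp only [Finset.mem_filter, Finset.mem_univ, true_and] at hx hy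
    exact htrans x hx.1 y hy.1 hx.2 hy.2
  · exact Finset.filter_subset _ _
  · intro z hz
    rw [hfilt, hcard]
    have := le_card_of_ne_bot h (inf_le_left.trans (hFE.trans hE)) (Finset.mem_filter.1 hz).2
    omega

/-! ### Transitivity on socle vectors -/

theorem exists_transvection {m : ℕ} {x y : Fin m → R} {i : Fin m} (hx : IsUnit (x i))
    (hy : IsUnit (y i)) : ∃ G : Matrix (Fin m) (Fin m) R, IsUnit G ∧ Matrix.vecMul x G = y ∧
      ∀ z j, x j = y j → Matrix.vecMul z G j = z j := by
  obtain ⟨u, hu⟩ := hx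
  have hvec : ∀ z, Matrix.vecMul z (1 + Matrix.vecMulVec (Pi.single i (↑u⁻¹ : R)) (y - x)) =
      z + (z i * (↑u⁻¹ : R)) • (y - x) := by
    intro z
    rw [Matrix.vecMul_add, Matrix.vecMul_one, Matrix.vecMul_vecMulVec]
    simp
  refine ⟨1 + Matrix.vecMulVec (Pi.single i (↑u⁻¹ : R)) (y - x), ?_, ?_, ?_⟩
  · rw [Matrix.isUnit_iff_isUnit_det, Matrix.vecMulVec_eq Unit,
      Matrix.det_one_add_replicateCol_mul_replicateRow]
    have : 1 + (y - x) ⬝ᵥ Pi.single i (↑u⁻¹ : R) = y i * (↑u⁻¹ : R) := by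
      rw [dotProduct_single, Pi.sub_apply, ← hu, sub_mul, Units.mul_inv]; ring
    rw [this]
    exact hy.mul (Units.isUnit _)
  · rw [hvec, ← hu, Units.mul_inv, one_smul, add_sub_cancel]
  · intro z j hj
    rw [hvec, Pi.add_apply, Pi.smul_apply, Pi.sub_apply, hj, sub_self, smul_zero, add_zero]

theorem exists_unit_vecMul_eq {m : ℕ} {x y : Fin m → R} {i i' : Fin m} (hx : IsUnit (x i))
    (hy : IsUnit (y i')) : ∃ G : Matrix (Fin m) (Fin m) R, IsUnit G ∧ Matrix.vecMul x G = y ∧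
      ∀ z j, x j = 0 → y j = 0 → Matrix.vecMul z G j = z j := by
  by_cases hii : i = i'
  · subst hii
    obtain ⟨G, h1, h2, h3⟩ := exists_transvection hx hy
    exact ⟨G, h1, h2, fun z j hxj hyj => h3 z j (hxj.trans hyj.symm)⟩
  · let w : Fin m → R := fun j => if j = i then x i else if j = i' then y i' else 0
    have hwi : w i = x i := if_pos rfl
    have hwi' : w i' = y i' := by simp [w, Ne.symm hii]
    obtain ⟨G, h1, h2, h3⟩ := exists_transvection (y := w) hx (hwi ▸ hx)
    obtain ⟨G', h1', h2', h3'⟩ := exists_transvection (x := w) (hwi' ▸ hy) hy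
    refine ⟨G * G', h1.mul h1', by rw [← Matrix.vecMul_vecMul, h2, h2'], fun z j hxj hyj => ?_⟩
    have hwj : w j = 0 := by
      simp only [w]
      split_ifs with ha hb
      · rw [← ha]; exact hxj
      · rw [← hb]; exact hyj
      · rfl
    rw [← Matrix.vecMul_vecMul, h3' _ _ (hwj.trans hyj.symm), h3 _ _ (hxj.trans hwj.symm)]

/-- The vectors killed by `π` and supported in the columns `a, ..., b - 1`. -/
def socleVectors (π : R) (s m a b : ℕ) : Submodule R (Fin m → R) :=
  Submodule.pi Set.univ fun j => Ideal.span {π ^ (if a ≤ (j : ℕ) ∧ (j : ℕ) < b then s - 1 else s)}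

theorem mem_socleVectors {m a b : ℕ} {x : Fin m → R} : x ∈ socleVectors π s m a b ↔
    ∀ j : Fin m, π ^ (if a ≤ (j : ℕ) ∧ (j : ℕ) < b then s - 1 else s) ∣ x j := by
  constructor
  · intro hx j
    exact Ideal.mem_span_singleton.1 (hx j (Set.mem_univ j))
  · intro hx j _
    exact Ideal.mem_span_singleton.2 (hx j)

theorem mem_socleVectors' (h : IsFiniteChainRing π q s) {m a b : ℕ} {x : Fin m → R} :
    x ∈ socleVectors π s m a b ↔
      ∀ j : Fin m, π ^ (s - 1) ∣ x j ∧ (¬ (a ≤ (j : ℕ) ∧ (j : ℕ) < b) → x j = 0) := by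
  rw [mem_socleVectors]
  refine forall_congr' fun j => ?_
  split_ifs with hj
  · simp [hj]
  · rw [h.pow_eq_zero, zero_dvd_iff]
    exact ⟨fun h0 => ⟨h0 ▸ dvd_zero _, fun _ => h0⟩, fun h0 => h0.2 hj⟩

theorem card_socleVectors (h : IsFiniteChainRing π q s) {m a b : ℕ} (hb : b ≤ m) :
    Nat.card (socleVectors π s m a b) = q ^ (b - a) := by
  have h1 := h.card_pi_dvd (fun j : Fin m => if a ≤ (j : ℕ) ∧ (j : ℕ) < b then s - 1 else s)
  have h2 : ∑ j : Fin m, (s - if a ≤ (j : ℕ) ∧ (j : ℕ) < b then s - 1 else s) = b - a := by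
    have : ∀ j : Fin m, (s - if a ≤ (j : ℕ) ∧ (j : ℕ) < b then s - 1 else s) =
        if a ≤ (j : ℕ) ∧ (j : ℕ) < b then 1 else 0 := fun j => by
      have := h.s_pos
      split_ifs <;> omega
    simp_rw [this]
    rw [← Finset.card_filter, ← Finset.card_map Fin.valEmbedding, ← Nat.card_Ico]
    congr 1
    ext x
    simp only [Finset.mem_map, Finset.mem_filter, Finset.mem_univ, true_and, Finset.mem_Ico,
      Fin.valEmbedding_apply]
    constructor
    · rintro ⟨i, hi, rfl⟩; exact hi
    · intro hx; exact ⟨⟨x, hx.2.trans_le hb⟩, hx, rfl⟩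
  rw [h2] at h1
  rw [← h1]
  exact Nat.card_congr (Equiv.subtypeEquivRight fun x => mem_socleVectors)

theorem socleVectors_le_torsionBy (h : IsFiniteChainRing π q s) {m a b : ℕ} :
    socleVectors π s m a b ≤ Submodule.torsionBy R (Fin m → R) π := by
  intro x hx
  rw [Submodule.mem_torsionBy_iff]
  ext j
  have := ((mem_socleVectors' h).1 hx j).1
  rwa [← h.pow_mul_eq_zero_iff (l := 1) h.s_pos, pow_one] at this

/-- The automorphisms that fix the columns from `b` on act transitively on the nonzero socle vectors
supported in the other columns. -/
theorem exists_unit_socleVectors (h : IsFiniteChainRing π q s) {m b : ℕ} {x y : Fin m → R}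
    (hx : x ∈ socleVectors π s m 0 b) (hy : y ∈ socleVectors π s m 0 b) (hx0 : x ≠ 0) (hy0 : y ≠ 0) :
    ∃ G : Matrix (Fin m) (Fin m) R, IsUnit G ∧ Matrix.vecMul x G = y ∧
      ∀ z (j : Fin m), b ≤ (j : ℕ) → Matrix.vecMul z G j = z j := by
  have key : ∀ x ∈ socleVectors π s m 0 b, x ≠ 0 → ∃ x' : Fin m → R, x = π ^ (s - 1) • x' ∧
      (∃ i, IsUnit (x' i)) ∧ ∀ j : Fin m, b ≤ (j : ℕ) → x' j = 0 := by
    intro x hx hx0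
    rw [mem_socleVectors' h] at hx
    choose c hc using fun j => (hx j).1
    let x' : Fin m → R := fun j => if (j : ℕ) < b then c j else 0
    have hxx' : x = π ^ (s - 1) • x' := by
      ext j
      change x j = π ^ (s - 1) * if (j : ℕ) < b then c j else 0
      split_ifs with hj
      · exact hc j
      · rw [(hx j).2 (by omega), mul_zero]
    refine ⟨x', hxx', ?_, fun j hj => if_neg (by omega)⟩
    by_contra hn
    push Not at hn
    apply hx0
    rw [hxx']
    ext j
    exact h.socle_mul_eq_zero_iff.2 ((h.isUnit_or_dvd _).resolve_left (hn j))
  obtain ⟨x', rfl, ⟨i, hi⟩, hx'⟩ := key x hx hx0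
  obtain ⟨y', rfl, ⟨i', hi'⟩, hy'⟩ := key y hy hy0
  obtain ⟨G, h1, h2, h3⟩ := exists_unit_vecMul_eq hi hi'
  exact ⟨G, h1, by rw [Matrix.smul_vecMul, h2], fun z j hj => h3 z j (hx' j hj) (hy' j hj)⟩

/-! ### The two ways to fail -/

theorem HasRank.mul_unit (h : IsFiniteChainRing π q s) {N m c : ℕ} {Z : Matrix (Fin N) (Fin m) R}
    (hZ : HasRank c Z) {G : Matrix (Fin m) (Fin m) R} (hG : IsUnit G) : HasRank c (Z * G) := by
  obtain ⟨L, L', W, W', h1, h2, rfl⟩ := hZ.exists_factor h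
  obtain ⟨G, rfl⟩ := hG
  have := hasRank_of_factor (W := W * (G : Matrix (Fin m) (Fin m) R)) (W' := (↑G⁻¹ : Matrix (Fin m) (Fin m) R) * W') h1 (by
    rw [Matrix.mul_assoc, ← Matrix.mul_assoc (G : Matrix (Fin m) (Fin m) R), Units.mul_inv,
      Matrix.one_mul, h2])
  rwa [Fintype.card_fin, ← Matrix.mul_assoc] at this

theorem HasRank.transpose (h : IsFiniteChainRing π q s) {N m c : ℕ} {Z : Matrix (Fin N) (Fin m) R}
    (hZ : HasRank c Z) : HasRank c Z.transpose := by
  obtain ⟨L, L', W, W', h1, h2, rfl⟩ := hZ.exists_factor h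
  have := hasRank_of_factor (L := W.transpose) (L' := W'.transpose) (W := L.transpose)
    (W' := L'.transpose) (by rw [← Matrix.transpose_mul, h2, Matrix.transpose_one])
    (by rw [← Matrix.transpose_mul, h1, Matrix.transpose_one])
  rwa [Fintype.card_fin, ← Matrix.transpose_mul] at this

/-- The socle of a free row span consists of multiples of `π ^ (s - 1)`. -/
theorem HasRank.exists_of_mem_socle (h : IsFiniteChainRing π q s) {α : Type*} {m c : ℕ}
    {A : Matrix α (Fin m) R} (hA : HasRank c A) {x : Fin m → R} (hx : x ∈ socle π (rowSpan A)) :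
    ∃ y ∈ rowSpan A, x = π ^ (s - 1) • y := by
  obtain ⟨e⟩ := hA
  have h1 : ∀ j, π ^ (s - 1) ∣ e ⟨x, hx.1⟩ j := fun j => by
    rw [← h.pow_mul_eq_zero_iff (l := 1) h.s_pos, pow_one]
    have : π • (⟨x, hx.1⟩ : rowSpan A) = 0 := Subtype.ext ((Submodule.mem_torsionBy_iff _ _).1 hx.2)
    have h2 := congrFun (congrArg e this) j
    rw [map_smul, map_zero] at h2
    exact h2
  choose d hd using h1
  refine ⟨(e.symm d).1, (e.symm d).2, ?_⟩
  have h2 : e ⟨x, hx.1⟩ = π ^ (s - 1) • d := by ext j; exact hd j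
  have h3 : (⟨x, hx.1⟩ : rowSpan A) = π ^ (s - 1) • e.symm d := by
    rw [← map_smul, ← h2, LinearEquiv.symm_apply_apply]
  exact congrArg Subtype.val h3

theorem mem_rowMatrices_iff_rowSpan_le {μ : Fin s → ℕ} {n m : ℕ} {A : Matrix (Fin n) (Fin m) R} :
    A ∈ rowMatrices π μ n m ↔ rowSpan A ≤ chainModule π μ m := by
  rw [rowSpan, Submodule.span_le, Set.range_subset_iff]; rfl

theorem HasRank.socle_le (h : IsFiniteChainRing π q s) {μ : Fin s → ℕ} (hμ : Monotone μ)
    {N m c : ℕ} {Z : Matrix (Fin N) (Fin m) R}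
    (hZ : HasRank c Z) (hZμ : Z ∈ rowMatrices π μ N m) :
    socle π (rowSpan Z) ≤ socleVectors π s m 0 (μ ⟨0, h.s_pos⟩) := by
  intro x hx
  obtain ⟨y, hy, rfl⟩ := hZ.exists_of_mem_socle h hx
  rw [mem_socleVectors' h]
  intro j
  refine ⟨Dvd.intro _ rfl, fun hj => ?_⟩
  have h1 := mem_chainModule.1 (mem_rowMatrices_iff_rowSpan_le.1 hZμ hy) j
  have h2 : 1 ≤ shapeExp μ j := (lt_shapeExp_iff hμ ⟨0, h.s_pos⟩ j).2 (by omega)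
  exact h.socle_mul_eq_zero_iff.2 ((dvd_pow_self π (by omega)).trans h1)

variable [Fintype R]

open Classical in
/-- The matrices of constant shape `t`, as a finite set. -/
noncomputable def rankFinset (π : R) {s : ℕ} (t : ℕ) (μ : Fin s → ℕ) (N m : ℕ) :
    Finset (Matrix (Fin N) (Fin m) R) :=
  Finset.univ.filter fun Z => Z ∈ rowMatrices π μ N m ∧ HasRank t Z

theorem mem_rankFinset {t : ℕ} {μ : Fin s → ℕ} {N m : ℕ} {Z : Matrix (Fin N) (Fin m) R} :
    Z ∈ rankFinset π t μ N m ↔ Z ∈ rowMatrices π μ N m ∧ HasRank t Z := by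
  classical
  rw [rankFinset, Finset.mem_filter, and_iff_right (Finset.mem_univ _)]

open Classical in
theorem card_row_failure_le (h : IsFiniteChainRing π q s) {μ : Fin s → ℕ} (hμ : Monotone μ)
    {N m t v : ℕ} (hm : ∀ i, μ i ≤ m) :
    ((rankFinset π t μ N m).filter fun Z =>
      socleVectors π s m v (μ ⟨0, h.s_pos⟩) ⊓ socle π (rowSpan Z) ≠ ⊥).card * (q - 1) *
        (q ^ μ ⟨0, h.s_pos⟩ - 1) ≤
      (q ^ (μ ⟨0, h.s_pos⟩ - v) - 1) * (q ^ t - 1) * (rankFinset π t μ N m).card := by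
  set a := μ ⟨0, h.s_pos⟩ with ha
  have := card_meeting_le h (rankFinset π t μ N m) (fun Z => socle π (rowSpan Z))
    (socleVectors π s m 0 a) (socleVectors π s m v a) (c := q ^ t)
    (socleVectors_le_torsionBy h) ?_ ?_ ?_ ?_
  · rwa [card_socleVectors h (hm _), card_socleVectors h (hm _), Nat.sub_zero] at this
  · intro x hx
    rw [mem_socleVectors' h] at hx ⊢
    exact fun j => ⟨(hx j).1, fun hj => (hx j).2 (by omega)⟩
  · intro Z hZ
    rw [mem_rankFinset] at hZ
    exact hZ.2.socle_le h hμ hZ.1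
  · intro Z hZ
    rw [mem_rankFinset] at hZ
    exact hZ.2.card_socle h
  · intro x hx y hy hx0 hy0
    obtain ⟨G, hG, hGx, hGfix⟩ := exists_unit_socleVectors h hx hy hx0 hy0
    apply Finset.card_le_card_of_injOn (fun Z => Z * G)
    · intro Z hZ
      rw [Finset.mem_coe, Finset.mem_filter, mem_rankFinset] at hZ
      rw [Finset.mem_coe, Finset.mem_filter, mem_rankFinset]
      obtain ⟨⟨h1, h2⟩, h3, -⟩ := hZ
      refine ⟨⟨?_, h2.mul_unit h hG⟩, ?_, socleVectors_le_torsionBy h hy⟩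
      · rw [mem_rowMatrices] at h1 ⊢
        intro i j
        by_cases hj : (j : ℕ) < a
        · have : shapeExp μ j = 0 := by
            have := (lt_shapeExp_iff hμ ⟨0, h.s_pos⟩ j).not.2 (by omega)
            dsimp only at this; omega
          rw [this]; simp
        · have : (Z * G) i j = Z i j := hGfix (Z i) j (by omega)
          exact (h1 i j).trans (dvd_of_eq this.symm)
      · obtain ⟨d, rfl⟩ := mem_rowSpan.1 h3
        exact mem_rowSpan.2 ⟨d, by rw [← hGx, Matrix.vecMul_vecMul]⟩
    · intro Z _ Z' _ hZZ'
      obtain ⟨G, rfl⟩ := hG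
      have := congrArg (fun Y => Y * (↑G⁻¹ : Matrix (Fin m) (Fin m) R)) hZZ'
      simpa [Matrix.mul_assoc] using this

open Classical in
theorem card_col_failure_le (h : IsFiniteChainRing π q s) {μ : Fin s → ℕ}
    {N m t k : ℕ} {A : Matrix (Fin N) (Fin k) R} (hA : HasRank k A) :
    ((rankFinset π t μ N m).filter fun Z =>
      socle π (rowSpan A.transpose) ⊓ socle π (rowSpan Z.transpose) ≠ ⊥).card * (q - 1) *
        (q ^ N - 1) ≤
      (q ^ k - 1) * (q ^ t - 1) * (rankFinset π t μ N m).card := by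
  have hle : ∀ {N m c : ℕ} {Z : Matrix (Fin N) (Fin m) R}, HasRank c Z →
      socle π (rowSpan Z.transpose) ≤ socleVectors π s N 0 N := by
    intro N m c Z hZ x hx
    obtain ⟨y, hy, rfl⟩ := (hZ.transpose h).exists_of_mem_socle h hx
    rw [mem_socleVectors' h]
    intro j
    exact ⟨Dvd.intro _ rfl, fun hj => absurd j.2 (by omega)⟩
  have := card_meeting_le h (rankFinset π t μ N m) (fun Z => socle π (rowSpan Z.transpose))
    (socleVectors π s N 0 N) (socle π (rowSpan A.transpose)) (c := q ^ t)
    (socleVectors_le_torsionBy h) (hle hA) ?_ ?_ ?_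
  · rwa [card_socleVectors h le_rfl, (hA.transpose h).card_socle h, Nat.sub_zero] at this
  · intro Z hZ
    rw [mem_rankFinset] at hZ
    exact hle hZ.2
  · intro Z hZ
    rw [mem_rankFinset] at hZ
    exact (hZ.2.transpose h).card_socle h
  · intro x hx y hy hx0 hy0
    obtain ⟨G, hG, hGx, -⟩ := exists_unit_socleVectors h hx hy hx0 hy0
    have hGt : IsUnit G.transpose := by
      rw [Matrix.isUnit_iff_isUnit_det, Matrix.det_transpose, ← Matrix.isUnit_iff_isUnit_det]
      exact hG
    apply Finset.card_le_card_of_injOn (fun Z => G.transpose * Z)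
    · intro Z hZ
      rw [Finset.mem_coe, Finset.mem_filter, mem_rankFinset] at hZ
      rw [Finset.mem_coe, Finset.mem_filter, mem_rankFinset]
      obtain ⟨⟨h1, h2⟩, h3, -⟩ := hZ
      have hequiv : LeftEquiv Z (G.transpose * Z) := ⟨_, hGt, rfl⟩
      refine ⟨⟨?_, hequiv.hasRank_iff.1 h2⟩, ?_, socleVectors_le_torsionBy h hy⟩
      · rw [mem_rowMatrices_iff_rowSpan_le, ← hequiv.rowSpan_eq]
        exact mem_rowMatrices_iff_rowSpan_le.1 h1
      · obtain ⟨d, rfl⟩ := mem_rowSpan.1 h3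
        exact mem_rowSpan.2 ⟨d, by
          rw [← hGx, Matrix.vecMul_vecMul, Matrix.transpose_mul, Matrix.transpose_transpose]⟩
    · intro Z _ Z' _ hZZ'
      obtain ⟨G', hG'⟩ := hGt
      rw [← hG'] at hZZ'
      have := congrArg (fun Y => (↑G'⁻¹ : Matrix (Fin N) (Fin N) R) * Y) hZZ'
      simpa [← Matrix.mul_assoc] using this

end MatrixChannel

namespace MatrixChannel

variable {R : Type*} [CommRing R] {π : R} {q s : ℕ} {T : Set R}

theorem HasRank.exists_left_inverse_of_cols (h : IsFiniteChainRing π q s) {N n : ℕ}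
    {A : Matrix (Fin N) (Fin n) R} (hA : HasRank n A) :
    ∃ A' : Matrix (Fin n) (Fin N) R, A' * A = 1 := by
  obtain ⟨L, L', W, W', h1, h2, rfl⟩ := hA.exists_factor h
  refine ⟨W' * L', ?_⟩
  calc W' * L' * (L * W) = W' * ((L' * L) * W) := by simp only [Matrix.mul_assoc]
    _ = 1 := by rw [h1, Matrix.one_mul]; exact mul_eq_one_comm.1 h2

theorem exists_left_inverse_lastCols (h : IsFiniteChainRing π q s) {N n k : ℕ} (hk : k ≤ n)
    {A : Matrix (Fin N) (Fin n) R} (hA : HasRank n A) :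
    ∃ A' : Matrix (Fin k) (Fin N) R, A' * lastCols hk A = 1 := by
  obtain ⟨A', hA'⟩ := hA.exists_left_inverse_of_cols h
  let f : Fin k → Fin n := fun a => ⟨n - k + a, by omega⟩
  have hf : Function.Injective f := fun a b hab => by
    have := Fin.val_eq_of_eq hab
    simp only [f] at this
    ext; omega
  refine ⟨A'.submatrix f id, ?_⟩
  have : A'.submatrix f id * lastCols hk A = (A' * A).submatrix f f := by
    rw [Matrix.submatrix_mul _ _ f id f Function.bijective_id]; rfl
  rw [this, hA', Matrix.submatrix_one f hf]

theorem hasRank_of_left_inverse {N k : ℕ} {A : Matrix (Fin N) (Fin k) R}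
    {A' : Matrix (Fin k) (Fin N) R} (hA : A' * A = 1) : HasRank k A := by
  have := hasRank_of_factor (W := (1 : Matrix (Fin k) (Fin k) R)) (W' := 1) hA (Matrix.mul_one _)
  rwa [Matrix.mul_one, Fintype.card_fin] at this

theorem smul_mem_torsionBy (h : IsFiniteChainRing π q s) {V : Type*} [AddCommGroup V] [Module R V]
    (x : V) : π ^ (s - 1) • x ∈ Submodule.torsionBy R V π := by
  have hs := h.s_pos
  rw [Submodule.mem_torsionBy_iff, smul_smul, ← pow_succ', Nat.sub_add_cancel hs, h.pow_eq_zero,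
    zero_smul]

theorem dvd_of_socle_smul (h : IsFiniteChainRing π q s) {ι : Type*} {x : ι → R}
    (hx : π ^ (s - 1) • x = 0) (i : ι) : π ∣ x i :=
  h.socle_mul_eq_zero_iff.1 (congrFun hx i)

/-- Decoding succeeds if the leftmost columns of the noise have full rank and the column spaces of
noise and transfer matrix are independent. -/
theorem success_of_disjoint (h : IsFiniteChainRing π q s) {μ : Fin s → ℕ} (hμ : Monotone μ)
    {N m t v k : ℕ} (hvk : v + k ≤ m) {Z : Matrix (Fin N) (Fin m) R} (hZ : HasRank t Z)
    (hZμ : Z ∈ rowMatrices π μ N m) {W : Matrix (Fin k) (Fin m) R}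
    (hW0 : ∀ i (j : Fin m), (j : ℕ) < v → W i j = 0)
    (hW : ∀ i (i' : Fin k), W i ⟨v + i', by omega⟩ = if i = i' then 1 else 0)
    {A : Matrix (Fin N) (Fin k) R} {A' : Matrix (Fin k) (Fin N) R} (hA : A' * A = 1)
    (hrow : socleVectors π s m v (μ ⟨0, h.s_pos⟩) ⊓ socle π (rowSpan Z) = ⊥)
    (hcol : socle π (rowSpan A.transpose) ⊓ socle π (rowSpan Z.transpose) = ⊥) :
    HasRank (t + k) ((A * W + Z).submatrix id
      (Subtype.val : {j : Fin m // (j : ℕ) < v + k} → Fin m)) := by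
  have hZsocle := hZ.socle_le h hμ hZμ
  obtain ⟨L, L', V, V', hL, hV, rfl⟩ := hZ.exists_factor h
  let ι : {j : Fin m // (j : ℕ) < v + k} → Fin m := Subtype.val
  obtain ⟨P', hP'⟩ := exists_left_inverse h (P := Matrix.fromCols L A) fun y hy => by
    rw [← Sum.elim_comp_inl_inr y, Matrix.fromCols_mulVec_sumElim, smul_add] at hy
    set y₁ := y ∘ Sum.inl
    set y₂ := y ∘ Sum.inr
    have h1 : π ^ (s - 1) • L.mulVec y₁ ∈
        socle π (rowSpan A.transpose) ⊓ socle π (rowSpan (L * V).transpose) := by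
      refine ⟨⟨?_, smul_mem_torsionBy h _⟩, ⟨?_, smul_mem_torsionBy h _⟩⟩
      · refine mem_rowSpan.2 ⟨-(π ^ (s - 1) • y₂), ?_⟩
        rw [Matrix.vecMul_transpose, Matrix.mulVec_neg, Matrix.mulVec_smul]
        exact (eq_neg_of_add_eq_zero_left hy).symm
      · refine mem_rowSpan.2 ⟨π ^ (s - 1) • V'.mulVec y₁, ?_⟩
        rw [Matrix.vecMul_transpose, Matrix.mulVec_smul, Matrix.mulVec_mulVec, Matrix.mul_assoc, hV,
          Matrix.mul_one]
    rw [hcol, Submodule.mem_bot] at h1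
    have h2 : π ^ (s - 1) • y₁ = 0 := by
      have := congrArg L'.mulVec h1
      rwa [Matrix.mulVec_smul, Matrix.mulVec_mulVec, hL, Matrix.one_mulVec, Matrix.mulVec_zero] at this
    rw [h1, zero_add] at hy
    have h3 : π ^ (s - 1) • y₂ = 0 := by
      have := congrArg A'.mulVec hy
      rwa [Matrix.mulVec_smul, Matrix.mulVec_mulVec, hA, Matrix.one_mulVec, Matrix.mulVec_zero] at this
    rintro (b | b)
    · exact dvd_of_socle_smul h h2 b
    · exact dvd_of_socle_smul h h3 b
  obtain ⟨Q', hQ'⟩ := exists_right_inverse h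
    (W := Matrix.fromRows (V.submatrix id ι) (W.submatrix id ι)) fun x hx => by
    rw [← Sum.elim_comp_inl_inr x, Matrix.sumElim_vecMul_fromRows] at hx
    set x₁ := x ∘ Sum.inl
    set x₂ := x ∘ Sum.inr
    have hx' : ∀ j : Fin m, (j : ℕ) < v + k →
        π ^ (s - 1) * (Matrix.vecMul x₁ V j + Matrix.vecMul x₂ W j) = 0 := fun j hj =>
      congrFun hx ⟨j, hj⟩
    have hW0' : ∀ j : Fin m, (j : ℕ) < v → Matrix.vecMul x₂ W j = 0 := fun j hj => by
      rw [Matrix.vecMul, dotProduct]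
      exact Finset.sum_eq_zero fun i _ => by rw [hW0 i j hj, mul_zero]
    have hmem : π ^ (s - 1) • Matrix.vecMul x₁ V ∈ socle π (rowSpan (L * V)) := by
      refine ⟨mem_rowSpan.2 ⟨π ^ (s - 1) • Matrix.vecMul x₁ L', ?_⟩, smul_mem_torsionBy h _⟩
      rw [Matrix.smul_vecMul, Matrix.vecMul_vecMul, ← Matrix.mul_assoc, hL, Matrix.one_mul]
    have h1 : π ^ (s - 1) • Matrix.vecMul x₁ V ∈
        socleVectors π s m v (μ ⟨0, h.s_pos⟩) ⊓ socle π (rowSpan (L * V)) := by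
      refine ⟨?_, hmem⟩
      have h2 := (mem_socleVectors' h).1 (hZsocle hmem)
      refine (mem_socleVectors' h).2 fun j => ⟨(h2 j).1, fun hj => ?_⟩
      by_cases hjv : (j : ℕ) < v
      · have := hx' j (by omega)
        rwa [hW0' j hjv, add_zero] at this
      · exact (h2 j).2 (by omega)
    rw [hrow, Submodule.mem_bot] at h1
    have h2 : π ^ (s - 1) • x₁ = 0 := by
      have := congrArg (fun w => Matrix.vecMul w V') h1
      simpa [Matrix.smul_vecMul, Matrix.vecMul_vecMul, hV] using this
    have h3 : ∀ b, π ∣ x₂ b := fun b => by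
      have h4 := hx' ⟨v + b, by omega⟩ (by dsimp only; omega)
      have h5 : π ^ (s - 1) * Matrix.vecMul x₁ V ⟨v + b, by omega⟩ = 0 := congrFun h1 _
      rw [mul_add, h5, zero_add, vecMul_identity_block (f := fun i' => ⟨v + i', by omega⟩) hW] at h4
      exact h.socle_mul_eq_zero_iff.1 h4
    rintro (b | b)
    · exact dvd_of_socle_smul h h2 b
    · exact h3 b
  have := hasRank_of_factor hP' hQ'
  rw [Matrix.fromCols_mul_fromRows, Fintype.card_sum, Fintype.card_fin, Fintype.card_fin] at this
  rw [add_comm (A * W)]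
  exact this

theorem socle_eq_bot_of_rank_zero (h : IsFiniteChainRing π q s) {N m : ℕ}
    {Z : Matrix (Fin N) (Fin m) R} (hZ : HasRank 0 Z) : socle π (rowSpan Z) = ⊥ := by
  have h1 := hZ.card_socle h
  rw [pow_zero] at h1
  exact (Submodule.eq_bot_iff _).2 fun x hx => by
    have := (Nat.card_eq_one_iff_unique.1 h1).1
    exact congrArg Subtype.val (Subsingleton.elim (⟨x, hx⟩ : socle π (rowSpan Z)) 0)

theorem message_identity_block (h : IsFiniteChainRing π q s)
    {μ : Fin s → ℕ} {n N v m : ℕ}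
    {M : Matrix (Fin (payloadRows n N v)) (Fin (m - v)) R} (hm : v + payloadRows n N v ≤ m) (hM : M ∈ messages π T μ m v (payloadRows n N v))
    (i : Fin (payloadRows n N v)) (j : Fin (m - v)) (hj : (j : ℕ) < payloadRows n N v) :
    M i j = if (i : ℕ) = j then 1 else 0 :=
  ((mem_principalForms_iff h (by omega)).1 hM).2 i j hj

/-! ### Probability of a failure -/

section Failure

variable [Fintype R]

theorem natCard_shapeMatrices (h : IsFiniteChainRing π q s) (t : ℕ) (μ : Fin s → ℕ) (N m : ℕ) :
    Nat.card (shapeMatrices π (fun _ : Fin s => t) μ N m) = (rankFinset π t μ N m).card := by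
  classical
  rw [rankFinset, ← Fintype.card_subtype, ← Nat.card_eq_fintype_card]
  exact Nat.card_congr (Equiv.subtypeEquivRight fun Z => mem_shapeMatrices h)

open Classical in
theorem mamcProb_eq (h : IsFiniteChainRing π q s) {μ : Fin s → ℕ} {n m N t : ℕ}
    (X : Matrix (Fin n) (Fin m) R) (P : Matrix (Fin N) (Fin m) R → Prop) :
    mamcProb π (fun _ => t) μ N X P =
      (∑ A ∈ rankFinset π n (fun _ : Fin s => n) N n,
        ((rankFinset π t μ N m).filter fun Z => P (A * X + Z)).card : ℕ) /
      ((rankFinset π n (fun _ : Fin s => n) N n).card * (rankFinset π t μ N m).card : ℝ) := by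
  rw [mamcProb, natCard_shapeMatrices h, natCard_shapeMatrices h]
  congr 2
  have h1 : ∑ A ∈ rankFinset π n (fun _ : Fin s => n) N n,
        ((rankFinset π t μ N m).filter fun Z => P (A * X + Z)).card =
      ((rankFinset π n (fun _ : Fin s => n) N n ×ˢ rankFinset π t μ N m).filter
        fun p => P (p.1 * X + p.2)).card := by
    rw [Finset.card_filter, Finset.sum_product]
    exact Finset.sum_congr rfl fun A _ => Finset.card_filter _ _
  rw [h1, ← Nat.card_eq_finsetCard]
  refine Nat.card_congr (Equiv.subtypeEquivRight fun p => ?_)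
  rw [Finset.mem_filter, Finset.mem_product, mem_rankFinset, mem_rankFinset, mem_shapeMatrices h,
    mem_shapeMatrices h]
  tauto

theorem mamcProb_eq_zero (h : IsFiniteChainRing π q s) {μ : Fin s → ℕ} {n m N t : ℕ}
    {X : Matrix (Fin n) (Fin m) R} {P : Matrix (Fin N) (Fin m) R → Prop}
    (hP : ∀ A Z, HasRank n A → HasRank t Z → Z ∈ rowMatrices π μ N m → ¬ P (A * X + Z)) :
    mamcProb π (fun _ => t) μ N X P = 0 := by
  classical
  rw [mamcProb_eq h, Finset.sum_eq_zero, Nat.cast_zero, zero_div]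
  intro A hA
  rw [Finset.card_eq_zero, Finset.filter_eq_empty_iff]
  exact fun Z hZ => hP A Z (mem_rankFinset.1 hA).2 (mem_rankFinset.1 hZ).2 (mem_rankFinset.1 hZ).1

/-- The numerical part of the union bound. -/
theorem union_bound {q a N k t v T b₁ b₂ : ℕ} (hq : 2 ≤ q) (hva : v ≤ a) (ht : 0 < t) (htv : t ≤ v)
    (htN : t ≤ N) (hk : 0 < k → k + v ≤ N) (hT : 0 < T)
    (h₁ : b₁ * (q - 1) * (q ^ a - 1) ≤ (q ^ (a - v) - 1) * (q ^ t - 1) * T)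
    (h₂ : b₂ * (q - 1) * (q ^ N - 1) ≤ (q ^ k - 1) * (q ^ t - 1) * T) :
    (b₁ + b₂) * ((q - 1) * q ^ v) < 2 * (q ^ t - 1) * T := by
  have hpow : ∀ {e : ℕ}, 0 < e → 2 ≤ q ^ e := fun {e} he => hq.trans (Nat.le_self_pow he.ne' q)
  have hone : ∀ e : ℕ, 1 ≤ q ^ e := fun e => Nat.one_le_pow _ _ (by omega)
  have key : ∀ {b c d : ℕ}, 0 < d → c * q ^ v < d → b * (q - 1) * d ≤ c * (q ^ t - 1) * T →
      b * ((q - 1) * q ^ v) < (q ^ t - 1) * T := by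
    intro b c d hd hcd hb
    have hpos : 0 < (q ^ t - 1) * T := Nat.mul_pos (by have := hpow ht; omega) hT
    refine lt_of_mul_lt_mul_right (a := d) ?_ (Nat.zero_le d)
    calc b * ((q - 1) * q ^ v) * d = b * (q - 1) * d * q ^ v := by ring
      _ ≤ c * (q ^ t - 1) * T * q ^ v := Nat.mul_le_mul_right _ hb
      _ = (q ^ t - 1) * T * (c * q ^ v) := by ring
      _ < (q ^ t - 1) * T * d := Nat.mul_lt_mul_of_pos_left hcd hpos
  have e₁ := key (by have := hpow (e := a) (by omega); omega) (by
    rw [Nat.sub_mul, one_mul, ← pow_add, Nat.sub_add_cancel hva]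
    have h1 := hpow (e := v) (by omega)
    have h2 := Nat.pow_le_pow_right (show 0 < q by omega) hva
    omega) h₁
  have e₂ := key (by have := hpow (e := N) (by omega); omega) (by
    rcases Nat.eq_zero_or_pos k with rfl | hk0
    · have := hpow (e := N) (by omega)
      simp only [pow_zero, Nat.sub_self, zero_mul]; omega
    · rw [Nat.sub_mul, one_mul, ← pow_add]
      have h1 := hpow (e := v) (by omega)
      have h2 := Nat.pow_le_pow_right (show 0 < q by omega) (hk hk0)
      have h3 := Nat.pow_le_pow_right (show 0 < q by omega) (show v ≤ k + v by omega)
      omega) h₂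
  calc _ = b₁ * ((q - 1) * q ^ v) + b₂ * ((q - 1) * q ^ v) := by ring
    _ < (q ^ t - 1) * T + (q ^ t - 1) * T := Nat.add_lt_add e₁ e₂
    _ = _ := by ring

section Scheme

variable {μ : Fin s → ℕ} {n N t v m : ℕ} {M : Matrix (Fin (payloadRows n N v)) (Fin (m - v)) R}

theorem payloadRows_le (n N v : ℕ) : payloadRows n N v ≤ n := min_le_left _ _

theorem payloadRows_add_le (hk : 0 < payloadRows n N v) : payloadRows n N v + v ≤ N := by
  unfold payloadRows at *; omega

theorem not_decode_ne (h : IsFiniteChainRing π q s) (hT : IsResidueSystem π T)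
    (hm : v + payloadRows n N v ≤ m) (hM : M ∈ messages π T μ m v (payloadRows n N v)) :
    mamcProb π (fun _ => t) μ N (encode n M)
      (fun Y => ∃ M', decode π s T t v (payloadRows n N v) Y = some M' ∧ M' ≠ M) = 0 := by
  apply mamcProb_eq_zero h
  rintro A Z - hZ - ⟨M', hdec, hne⟩
  exact hne (decode_correct h hT (min_le_left _ _) hm (message_identity_block h hm hM) A hZ hdec)

omit [Fintype R] in
theorem exists_bad_of_decode_eq_none (h : IsFiniteChainRing π q s) (hT : IsResidueSystem π T)
    (hμ : Monotone μ) (hm : v + payloadRows n N v ≤ m)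
    (hM : M ∈ messages π T μ m v (payloadRows n N v)) {A : Matrix (Fin N) (Fin n) R}
    (hA : HasRank n A) {Z : Matrix (Fin N) (Fin m) R} (hZ : HasRank t Z)
    (hZμ : Z ∈ rowMatrices π μ N m)
    (hdec : decode π s T t v (payloadRows n N v) (A * encode n M + Z) = none) :
    socleVectors π s m v (μ ⟨0, h.s_pos⟩) ⊓ socle π (rowSpan Z) ≠ ⊥ ∨
      socle π (rowSpan (lastCols (payloadRows_le n N v) A).transpose) ⊓
        socle π (rowSpan Z.transpose) ≠ ⊥ := by
  by_contra hn
  push Not at hn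
  obtain ⟨A', hA'⟩ := exists_left_inverse_lastCols h (payloadRows_le n N v) hA
  refine (decode_eq_none_iff h hT _ _ _ _).1 hdec ?_
  rw [mul_encode (payloadRows_le n N v)]
  exact success_of_disjoint h hμ hm hZ hZμ (padLeft_eq_zero M)
    (padLeft_identity_block hm (message_identity_block h hm hM)) hA' hn.1 hn.2

theorem mamcProb_failure_of_rank_zero (h : IsFiniteChainRing π q s) (hT : IsResidueSystem π T)
    (hμ : Monotone μ) (hm : v + payloadRows n N v ≤ m)
    (hM : M ∈ messages π T μ m v (payloadRows n N v)) :
    mamcProb π (fun _ => 0) μ N (encode n M)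
      (fun Y => decode π s T 0 v (payloadRows n N v) Y = none) = 0 := by
  apply mamcProb_eq_zero h
  intro A Z hA hZ hZμ hdec
  rcases exists_bad_of_decode_eq_none h hT hμ hm hM hA hZ hZμ hdec with hb | hb
  · exact hb (by rw [socle_eq_bot_of_rank_zero h hZ, inf_bot_eq])
  · exact hb (by rw [socle_eq_bot_of_rank_zero h (hZ.transpose h), inf_bot_eq])

theorem mamcProb_mul_lt (h : IsFiniteChainRing π q s) {X : Matrix (Fin n) (Fin m) R}
    {P : Matrix (Fin N) (Fin m) R → Prop} {a b : ℕ} (hb : 0 < b)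
    (hP : ∀ A, HasRank n A → 0 < (rankFinset π t μ N m).card → ∃ F : Finset (Matrix (Fin N) (Fin m) R),
      (∀ Z ∈ rankFinset π t μ N m, P (A * X + Z) → Z ∈ F) ∧
        F.card * a < b * (rankFinset π t μ N m).card) :
    mamcProb π (fun _ => t) μ N X P * a < b := by
  classical
  rw [mamcProb_eq h]
  set TA := rankFinset π n (fun _ : Fin s => n) N n
  set TZ := rankFinset π t μ N m
  rcases Nat.eq_zero_or_pos (TA.card * TZ.card) with h0 | hpos
  · have : (TA.card : ℝ) * TZ.card = 0 := by exact_mod_cast h0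
    rw [this, div_zero, zero_mul]
    exact_mod_cast hb
  have hTA : 0 < TA.card := Nat.pos_of_mul_pos_right hpos
  have hTZ : 0 < TZ.card := Nat.pos_of_mul_pos_left hpos
  have hsum : (∑ A ∈ TA, (TZ.filter fun Z => P (A * X + Z)).card) * a < b * (TA.card * TZ.card) := by
    rw [Finset.sum_mul]
    calc _ < ∑ A ∈ TA, b * TZ.card := by
          refine Finset.sum_lt_sum_of_nonempty (Finset.card_pos.1 hTA) fun A hA => ?_
          obtain ⟨F, hF, hlt⟩ := hP A (mem_rankFinset.1 hA).2 hTZ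
          refine lt_of_le_of_lt (Nat.mul_le_mul_right _ (Finset.card_le_card fun Z hZ => ?_)) hlt
          rw [Finset.mem_filter] at hZ
          exact hF Z hZ.1 hZ.2
      _ = _ := by rw [Finset.sum_const, smul_eq_mul]; ring
  rw [div_mul_eq_mul_div, div_lt_iff₀ (by exact_mod_cast hpos)]
  exact_mod_cast hsum

theorem mamcProb_failure_mul_lt (h : IsFiniteChainRing π q s) (hT : IsResidueSystem π T)
    (hμ : Monotone μ) (hμm : ∀ i, μ i ≤ m) (ht : 0 < t) (htv : t ≤ v) (htN : t ≤ N)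
    (hv : ∀ i, v ≤ μ i) (hm : v + payloadRows n N v ≤ m)
    (hM : M ∈ messages π T μ m v (payloadRows n N v)) :
    mamcProb π (fun _ => t) μ N (encode n M)
      (fun Y => decode π s T t v (payloadRows n N v) Y = none) * (((q : ℝ) - 1) * (q : ℝ) ^ v) <
    2 * ((q : ℝ) ^ t - 1) := by
  classical
  have hq := h.two_le_q
  have hqt : 0 < q ^ t - 1 := by
    have := hq.trans (Nat.le_self_pow ht.ne' q)
    omega
  have h1 : ((q - 1 : ℕ) : ℝ) = (q : ℝ) - 1 := by rw [Nat.cast_sub (by omega), Nat.cast_one]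
  have h2 : ((q ^ t - 1 : ℕ) : ℝ) = (q : ℝ) ^ t - 1 := by
    rw [Nat.cast_sub (Nat.one_le_pow _ _ (by omega)), Nat.cast_one, Nat.cast_pow]
  rw [← h1, ← h2]
  suffices hs : mamcProb π (fun _ => t) μ N (encode n M)
      (fun Y => decode π s T t v (payloadRows n N v) Y = none) * ((q - 1) * q ^ v : ℕ) <
        (2 * (q ^ t - 1) : ℕ) by
    push_cast at hs ⊢; exact hs
  apply mamcProb_mul_lt h (by omega)
  intro A hA hTZ
  obtain ⟨A', hA'⟩ := exists_left_inverse_lastCols h (payloadRows_le n N v) hA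
  refine ⟨_ ∪ _, ?_, lt_of_le_of_lt (Nat.mul_le_mul_right _ (Finset.card_union_le _ _))
    (union_bound hq (hv ⟨0, h.s_pos⟩) ht htv htN payloadRows_add_le hTZ
      (card_row_failure_le h hμ hμm)
      (card_col_failure_le h (hasRank_of_left_inverse hA')))⟩
  intro Z hZ hdec
  have hZ' := mem_rankFinset.1 hZ
  rw [Finset.mem_union, Finset.mem_filter, Finset.mem_filter]
  exact (exists_bad_of_decode_eq_none h hT hμ hm hM hA hZ'.2 hZ'.1 hdec).imp
    (fun h1 => ⟨hZ, h1⟩) (fun h1 => ⟨hZ, h1⟩)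

theorem pow_sub_one_le_mul {x : ℝ} (hx : 1 ≤ x) (t : ℕ) : x ^ t - 1 ≤ t * x ^ (t - 1) * (x - 1) := by
  rw [← geom_sum_mul]
  refine mul_le_mul_of_nonneg_right ?_ (by linarith)
  calc ∑ i ∈ Finset.range t, x ^ i ≤ ∑ i ∈ Finset.range t, x ^ (t - 1) :=
        Finset.sum_le_sum fun i hi => pow_le_pow_right₀ hx (by rw [Finset.mem_range] at hi; omega)
    _ = _ := by rw [Finset.sum_const, Finset.card_range, nsmul_eq_mul]

theorem mamcProb_failure_lt (h : IsFiniteChainRing π q s) (hT : IsResidueSystem π T)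
    (hμ : Monotone μ) (hμm : ∀ i, μ i ≤ m) (ht : 0 < t) (htv : t ≤ v) (htN : t ≤ N)
    (hv : ∀ i, v ≤ μ i) (hm : v + payloadRows n N v ≤ m)
    (hM : M ∈ messages π T μ m v (payloadRows n N v)) :
    mamcProb π (fun _ => t) μ N (encode n M)
      (fun Y => decode π s T t v (payloadRows n N v) Y = none) < 2 * (t : ℝ) / (q : ℝ) ^ (1 + v - t) := by
  have hq : (2 : ℝ) ≤ q := by exact_mod_cast h.two_le_q
  have h1 := mamcProb_failure_mul_lt h hT hμ hμm ht htv htN hv hm hM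
  have h2 := pow_sub_one_le_mul (show (1 : ℝ) ≤ q by linarith) t
  rw [lt_div_iff₀ (by positivity)]
  have h3 : (q : ℝ) ^ v = (q : ℝ) ^ (1 + v - t) * (q : ℝ) ^ (t - 1) := by
    rw [← pow_add]; congr 1; omega
  rw [h3] at h1
  have h4 : (0 : ℝ) < (q - 1) * (q : ℝ) ^ (t - 1) := mul_pos (by linarith) (by positivity)
  refine lt_of_mul_lt_mul_right (a := (q - 1) * (q : ℝ) ^ (t - 1)) ?_ h4.le
  linarith

theorem mamcProb_failure_le (h : IsFiniteChainRing π q s) (hT : IsResidueSystem π T)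
    (hμ : Monotone μ) (hμm : ∀ i, μ i ≤ m) (htv : t ≤ v) (htN : t ≤ N)
    (hv : ∀ i, v ≤ μ i) (hm : v + payloadRows n N v ≤ m)
    (hM : M ∈ messages π T μ m v (payloadRows n N v)) :
    mamcProb π (fun _ => t) μ N (encode n M)
      (fun Y => decode π s T t v (payloadRows n N v) Y = none) ≤ 2 / (q : ℝ) ^ (v - t) := by
  have hq : (2 : ℝ) ≤ q := by exact_mod_cast h.two_le_q
  rcases Nat.eq_zero_or_pos t with rfl | ht
  · rw [mamcProb_failure_of_rank_zero h hT hμ hm hM]; positivity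
  have h1 := mamcProb_failure_mul_lt h hT hμ hμm ht htv htN hv hm hM
  rw [le_div_iff₀ (by positivity)]
  have h3 : (q : ℝ) ^ v = (q : ℝ) ^ (v - t) * (q : ℝ) ^ t := by
    rw [← pow_add]; congr 1; omega
  set P := mamcProb π (fun _ => t) μ N (encode n M)
      (fun Y => decode π s T t v (payloadRows n N v) Y = none)
  have hP : 0 ≤ P := by unfold P mamcProb; positivity
  have h4 : P * (q : ℝ) ^ v ≤ P * (((q : ℝ) - 1) * (q : ℝ) ^ v) :=
    mul_le_mul_of_nonneg_left (le_mul_of_one_le_left (by positivity) (by linarith)) hP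
  rw [h3] at h4 h1
  refine le_of_mul_le_mul_right (a := (q : ℝ) ^ t) ?_ (by positivity)
  linarith

end Scheme

end Failure

end MatrixChannel

namespace MatrixChannel

variable {R : Type*} [CommRing R] {π : R} {q s : ℕ} {T : Set R}

/-! ### Invertible matrices with prescribed divisibility below the diagonal -/

section Parabolic

variable {N : ℕ}

/-- The unitriangular lower factor with entries from `a`. -/
def lowerFactor (a : Fin N → Fin N → R) : Matrix (Fin N) (Fin N) R :=
  Matrix.of fun i j => if j < i then a i j else if j = i then 1 else 0

/-- The unitriangular upper factor with entries from `a`. -/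
def upperFactor (a : Fin N → Fin N → R) : Matrix (Fin N) (Fin N) R :=
  Matrix.of fun i j => if i < j then a i j else if i = j then 1 else 0

theorem isUnit_lowerFactor (a : Fin N → Fin N → R) : IsUnit (lowerFactor a) := by
  rw [Matrix.isUnit_iff_isUnit_det, Matrix.det_of_isLowerTriangular]
  · simp [lowerFactor]
  · intro i j hij
    have hij : i < j := hij
    simp [lowerFactor, hij.not_gt, hij.ne']

theorem isUnit_upperFactor (a : Fin N → Fin N → R) : IsUnit (upperFactor a) := by
  rw [Matrix.isUnit_iff_isUnit_det, Matrix.det_of_isUpperTriangular]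
  · simp [upperFactor]
  · intro i j hij
    have hij : j < i := hij
    simp [upperFactor, hij.not_gt, hij.ne']

theorem lower_mul_upper_injective {a b : Fin N → Fin N → R}
    (h : lowerFactor a * upperFactor a = lowerFactor b * upperFactor b) {i j : Fin N} (hij : i ≠ j) :
    a i j = b i j := by
  have key : ∀ n, ∀ i j : Fin N, i ≠ j → (min i j : Fin N).val = n → a i j = b i j := by
    intro n
    induction n using Nat.strong_induction_on with
    | _ n ih =>
    intro i j hij hn
    have h1 := congrFun (congrFun h i) j
    rw [Matrix.mul_apply, Matrix.mul_apply, ← Finset.add_sum_erase _ _ (Finset.mem_univ (min i j)),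
      ← Finset.add_sum_erase _ _ (Finset.mem_univ (min i j))] at h1
    have h2 : ∀ k ∈ Finset.univ.erase (min i j), lowerFactor a i k * upperFactor a k j =
        lowerFactor b i k * upperFactor b k j := by
      intro k hk
      have hk := (Finset.mem_erase.1 hk).1
      by_cases hki : k < i
      · by_cases hkj : k < j
        · have e1 := ih k (by rw [← hn]; exact Fin.lt_def.1 (lt_min hki hkj)) i k hki.ne'
            (by rw [min_eq_right hki.le])
          have e2 := ih k (by rw [← hn]; exact Fin.lt_def.1 (lt_min hki hkj)) k j hkj.ne
            (by rw [min_eq_left hkj.le])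
          simp only [lowerFactor, upperFactor, Matrix.of_apply, if_pos hki, if_pos hkj, e1, e2]
        · have : k ≠ j := fun hkj' => hk (by rw [hkj', min_eq_right (hkj' ▸ hki.le)])
          simp [upperFactor, hkj, this]
      · by_cases hki' : k = i
        · have hjk : j < k := by
            by_contra hjk
            exact hk (by rw [hki', min_eq_left (hki' ▸ not_lt.1 hjk)])
          simp [upperFactor, hjk.not_gt, hjk.ne']
        · simp [lowerFactor, hki, hki']
    rw [Finset.sum_congr rfl h2, add_left_inj] at h1
    rcases lt_or_gt_of_ne hij with hlt | hlt
    · rw [min_eq_left hlt.le] at h1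
      simpa [lowerFactor, upperFactor, hlt] using h1
    · rw [min_eq_right hlt.le] at h1
      simpa [lowerFactor, upperFactor, hlt] using h1
  exact key _ i j hij rfl

/-- The invertible matrices whose entry at `(i, i')` is divisible by `π ^ (l i - l i')`. -/
def parabolic (π : R) (l : Fin N → ℕ) : Set (Matrix (Fin N) (Fin N) R) :=
  {V | IsUnit V ∧ ∀ i i', π ^ (l i - l i') ∣ V i i'}

theorem pow_le_card_parabolic [Finite R] (h : IsFiniteChainRing π q s) {l : Fin N → ℕ}
    (hls : ∀ i, l i ≤ s) :
    q ^ (s * (N * N)) ≤ q ^ (s * N + ∑ i, ∑ i', (l i - l i')) * Nat.card (parabolic π l) := by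
  let e : Fin N → Fin N → ℕ := fun i i' => if i = i' then s else l i - l i'
  have hcard := h.card_matrix_dvd e
  have hle : Nat.card {x : Matrix (Fin N) (Fin N) R // ∀ i j, π ^ e i j ∣ x i j} ≤
      Nat.card (parabolic π l) := by
    refine Nat.card_le_card_of_injective (fun a => ⟨lowerFactor a.1 * upperFactor a.1,
      (isUnit_lowerFactor _).mul (isUnit_upperFactor _), fun i j => ?_⟩) ?_
    · rw [Matrix.mul_apply]
      refine Finset.dvd_sum fun k _ => ?_
      have ha : ∀ i j, i ≠ j → π ^ (l i - l j) ∣ a.1 i j := fun i j hij => by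
        have := a.2 i j
        simpa only [e, if_neg hij] using this
      have h1 : π ^ (l i - l k) ∣ lowerFactor a.1 i k := by
        simp only [lowerFactor, Matrix.of_apply]
        split_ifs with h1 h2
        · exact ha _ _ h1.ne'
        · simp [h2]
        · exact dvd_zero _
      have h2 : π ^ (l k - l j) ∣ upperFactor a.1 k j := by
        simp only [upperFactor, Matrix.of_apply]
        split_ifs with h1 h2
        · exact ha _ _ h1.ne
        · simp [h2]
        · exact dvd_zero _
      refine (pow_dvd_pow π ?_).trans ((pow_add π (l i - l k) (l k - l j)) ▸ mul_dvd_mul h1 h2)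
      omega
    · rintro ⟨a, ha⟩ ⟨b, hb⟩ hab
      ext i j
      by_cases hij : i = j
      · have h1 := ha i j
        have h2 := hb i j
        simp only [e, if_pos hij, h.pow_eq_zero, zero_dvd_iff] at h1 h2
        exact h1.trans h2.symm
      · exact lower_mul_upper_injective (congrArg Subtype.val hab) hij
  rw [hcard] at hle
  calc q ^ (s * (N * N)) = q ^ ((s * N + ∑ i, ∑ i', (l i - l i')) + ∑ i, ∑ j, (s - e i j)) := by
        congr 1
        have h1 : ∀ i j, s = (if i = j then s else 0) + (l i - l j) + (s - e i j) := fun i j => by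
          have := hls i
          by_cases hij : i = j
          · subst hij; simp [e]
          · simp only [e, if_neg hij]; omega
        calc s * (N * N) = ∑ i : Fin N, ∑ j : Fin N, s := by simp; ring
          _ = ∑ i : Fin N, ∑ j : Fin N, ((if i = j then s else 0) + (l i - l j) + (s - e i j)) :=
            Finset.sum_congr rfl fun i _ => Finset.sum_congr rfl fun j _ => h1 i j
          _ = _ := by simp [Finset.sum_add_distrib]; ring
    _ = q ^ (s * N + ∑ i, ∑ i', (l i - l i')) * q ^ ∑ i, ∑ j, (s - e i j) := pow_add _ _ _
    _ ≤ _ := Nat.mul_le_mul_left _ hle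

theorem card_parabolic_le [Finite R] {m : ℕ} {l : Fin N → ℕ} {y : Matrix (Fin N) (Fin m) R}
    {U₀ : Matrix (Fin N) (Fin N) R} (hU₀ : IsUnit U₀) (hy : ∀ i j, π ^ l i ∣ (U₀ * y) i j) :
    Nat.card (parabolic π l) ≤
      Nat.card {U : Matrix (Fin N) (Fin N) R // IsUnit U ∧ ∀ i j, π ^ l i ∣ (U * y) i j} := by
  obtain ⟨U₀, rfl⟩ := hU₀
  refine Nat.card_le_card_of_injective (fun V => ⟨V.1 * U₀, V.2.1.mul U₀.isUnit, fun i j => ?_⟩) ?_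
  · rw [Matrix.mul_assoc, Matrix.mul_apply]
    refine Finset.dvd_sum fun k _ => (pow_dvd_pow π ?_).trans
      ((pow_add π (l i - l k) (l k)) ▸ mul_dvd_mul (V.2.2 i k) (hy k j))
    omega
  · intro V V' hVV'
    have h1 : V.1 * (U₀ : Matrix (Fin N) (Fin N) R) = V'.1 * U₀ := congrArg Subtype.val hVV'
    exact Subtype.ext ((Units.mul_left_inj U₀).1 h1)

end Parabolic

/-! ### Counting matrices of given type -/

theorem mul_left_cancel_of_isUnit {α β : Type*} [Fintype α] [DecidableEq α] {U : Matrix α α R}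
    (hU : IsUnit U) {A B : Matrix α β R} (h : U * A = U * B) : A = B := by
  obtain ⟨U, rfl⟩ := hU
  have := congrArg (fun Y => (↑U⁻¹ : Matrix α α R) * Y) h
  simpa [← Matrix.mul_assoc] using this

theorem card_mul_le_of_fiber {α β : Type*} [Finite α] [Finite β] {S : Set α} {Q : α → β → Prop}
    {c d : ℕ} (hc : ∀ a ∈ S, c ≤ Nat.card {b // Q a b})
    (hd : Nat.card {p : α × β // p.1 ∈ S ∧ Q p.1 p.2} ≤ d) : Nat.card S * c ≤ d := by
  classical
  have := Fintype.ofFinite α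
  have := Fintype.ofFinite β
  refine le_trans ?_ hd
  let e : {p : α × β // p.1 ∈ S ∧ Q p.1 p.2} ≃ Σ a : S, {b // Q a.1 b} :=
    { toFun := fun p => ⟨⟨p.1.1, p.2.1⟩, ⟨p.1.2, p.2.2⟩⟩
      invFun := fun x => ⟨(x.1.1, x.2.1), x.1.2, x.2.2⟩
      left_inv := fun _ => rfl
      right_inv := fun _ => rfl }
  rw [Nat.card_congr e, Nat.card_sigma]
  calc Nat.card S * c = ∑ a : S, c := by
        rw [Finset.sum_const, Finset.card_univ, smul_eq_mul, Nat.card_eq_fintype_card]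
    _ ≤ _ := Finset.sum_le_sum fun a _ => hc a.1 a.2

/-- Matrices that are left-equivalent to one whose `i`-th row is divisible by `π ^ l i`. -/
theorem card_type_mul_le [Finite R] (h : IsFiniteChainRing π q s) {μ : Fin s → ℕ} (hμ : Monotone μ)
    {N m : ℕ} (hm : ∀ i, μ i ≤ m) (l : Fin N → ℕ) :
    Nat.card {y : Matrix (Fin N) (Fin m) R | y ∈ rowMatrices π μ N m ∧
        ∃ U : Matrix (Fin N) (Fin N) R, IsUnit U ∧ ∀ i j, π ^ l i ∣ (U * y) i j} *
      Nat.card (parabolic π l) ≤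
      q ^ (s * (N * N) + ∑ i, ∑ u : Fin s, if l i ≤ (u : ℕ) then μ u else 0) := by
  apply card_mul_le_of_fiber (Q := fun (y : Matrix (Fin N) (Fin m) R) (U : Matrix (Fin N) (Fin N) R) =>
    IsUnit U ∧ ∀ i j, π ^ l i ∣ (U * y) i j)
  · rintro y ⟨-, U, hU, hy⟩
    exact card_parabolic_le hU hy
  · have h1 := h.card_matrix_dvd (fun (i : Fin N) (j : Fin m) => max (l i) (shapeExp μ j))
    have h2 : ∀ i : Fin N, ∑ j : Fin m, (s - max (l i) (shapeExp μ j)) =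
        ∑ u : Fin s, if l i ≤ (u : ℕ) then μ u else 0 := fun i => by
      simpa using sum_sub_max_shapeExp hμ hm (l i) 0
    simp_rw [h2] at h1
    have h3 := h.card_matrix (Fin N) (Fin N)
    rw [Fintype.card_fin] at h3
    rw [pow_add, ← h1, ← h3, ← Nat.card_prod]
    refine Nat.card_le_card_of_injective (fun p => (p.1.2, ⟨p.1.2 * p.1.1, fun i j => ?_⟩)) ?_
    · obtain ⟨⟨y, U⟩, ⟨hy, -⟩, -, hUy⟩ := p
      have h4 : π ^ shapeExp μ j ∣ (U * y) i j := by
        rw [Matrix.mul_apply]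
        exact Finset.dvd_sum fun k _ => (mem_rowMatrices.1 hy k j).mul_left _
      rcases max_choice (l i) (shapeExp μ j) with hmax | hmax
      · simpa only [hmax] using hUy i j
      · simpa only [hmax] using h4
    · rintro ⟨⟨y, U⟩, hy, hU, hUy⟩ ⟨⟨y', U'⟩, hy', hU', hUy'⟩ heq
      simp only [Prod.mk.injEq, Subtype.mk.injEq] at heq
      obtain ⟨rfl, heq⟩ := heq
      have := mul_left_cancel_of_isUnit hU heq
      rw [Subtype.mk.injEq, this]

/-- The matrices `A` for which `y - A x` has a given rank. -/
theorem card_rank_sub_mul_le [Finite R] (h : IsFiniteChainRing π q s) (hT : IsResidueSystem π T)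
    {N n m t : ℕ} (x : Matrix (Fin n) (Fin m) R) (y : Matrix (Fin N) (Fin m) R) :
    Nat.card {A : Matrix (Fin N) (Fin n) R | HasRank t (y - A * x)} *
      Nat.card (parabolic π fun i : Fin N => if (i : ℕ) < t then 0 else s) *
        Nat.card (rowSpan y) ^ (Finset.univ.filter fun i : Fin N => t ≤ (i : ℕ)).card ≤
      q ^ (s * ((N + n) * N)) := by
  let D : Fin N → (Fin N → R) × (Fin n → R) → Prop := fun i f =>
    t ≤ (i : ℕ) → Matrix.vecMul f.1 y = Matrix.vecMul f.2 x
  have hrow : ∀ i, Nat.card {f // D i f} * Nat.card (rowSpan y) ^ (if t ≤ (i : ℕ) then 1 else 0) ≤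
      q ^ (s * (N + n)) := by
    intro i
    have htot : Nat.card ((Fin N → R) × (Fin n → R)) = q ^ (s * (N + n)) := by
      rw [Nat.card_prod, h.card_fun, h.card_fun, Fintype.card_fin, Fintype.card_fin, ← pow_add, mul_add]
    split_ifs with hi
    · let φ : (Fin N → R) × (Fin n → R) →ₗ[R] (Fin m → R) :=
        y.vecMulLinear.coprod (-x.vecMulLinear)
      have hφ : ∀ f, φ f = Matrix.vecMul f.1 y - Matrix.vecMul f.2 x := fun f => by
        simp [φ, sub_eq_add_neg]
      have h1 : Nat.card {f // D i f} = Nat.card (LinearMap.ker φ) :=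
        Nat.card_congr (Equiv.subtypeEquivRight fun f => by
          rw [LinearMap.mem_ker, hφ, sub_eq_zero]
          exact ⟨fun hf => hf hi, fun hf _ => hf⟩)
      have h2 : Nat.card (rowSpan y) ≤ Nat.card (LinearMap.range φ) := by
        apply Nat.card_le_card_of_injective _ (Submodule.inclusion_injective (?_ : rowSpan y ≤ _))
        intro z hz
        obtain ⟨c, rfl⟩ := mem_rowSpan.1 hz
        exact ⟨(c, 0), by rw [hφ]; simp⟩
      rw [pow_one, h1, ← htot, Submodule.card_eq_card_quotient_mul_card (LinearMap.ker φ),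
        Nat.card_congr φ.quotKerEquivRange.toEquiv]
      exact Nat.mul_le_mul_left _ h2
    · rw [pow_zero, mul_one, ← htot]
      exact Nat.card_le_card_of_injective _ Subtype.val_injective
  have hprod : (∏ i, Nat.card {f // D i f}) *
      Nat.card (rowSpan y) ^ (Finset.univ.filter fun i : Fin N => t ≤ (i : ℕ)).card ≤
        q ^ (s * ((N + n) * N)) := by
    rw [Finset.card_filter, ← Finset.prod_pow_eq_pow_sum, ← Finset.prod_mul_distrib]
    refine (Finset.prod_le_prod' fun i _ => hrow i).trans_eq ?_
    rw [Finset.prod_const, Finset.card_univ, Fintype.card_fin, ← pow_mul, mul_assoc]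
  refine le_trans (Nat.mul_le_mul_right _ ?_) hprod
  apply card_mul_le_of_fiber (Q := fun (A : Matrix (Fin N) (Fin n) R) (U : Matrix (Fin N) (Fin N) R) =>
    IsUnit U ∧ ∀ (i : Fin N) (j : Fin m), π ^ (if (i : ℕ) < t then 0 else s) ∣ (U * (y - A * x)) i j)
  · intro A hA
    obtain ⟨hcan, U, hU, hUz⟩ := rcf_spec h hT (y - A * x)
    apply card_parabolic_le hU
    intro i j
    split_ifs with hi
    · exact pow_zero π ▸ one_dvd _
    · have hst := hcan.staircase h
      have := (hst.rows_of_hasRank h ((LeftEquiv.hasRank_iff ⟨U, hU, hUz⟩).1 hA) i).2 (by omega)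
      rw [hUz, congrFun this j]
      exact dvd_zero _
  · rw [← Nat.card_pi]
    refine Nat.card_le_card_of_injective (fun p i => ⟨(p.1.2 i, (p.1.2 * p.1.1) i), ?_⟩) ?_
    · intro hi
      obtain ⟨⟨A, U⟩, hA, hU, hUA⟩ := p
      ext j
      have h1 := hUA i j
      rw [if_neg (by omega), h.pow_eq_zero, zero_dvd_iff, Matrix.mul_sub, Matrix.sub_apply,
        ← Matrix.mul_assoc, sub_eq_zero] at h1
      exact h1
    · rintro ⟨⟨A, U⟩, hA, hU, hUA⟩ ⟨⟨A', U'⟩, hA', hU', hUA'⟩ heq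
      have h1 : U = U' := by
        funext i
        exact congrArg (fun f => f.1.1) (congrFun heq i)
      subst h1
      have h2 : U * A = U * A' := by
        funext i
        exact congrArg (fun f => f.1.2) (congrFun heq i)
      have := mul_left_cancel_of_isUnit hU h2
      rw [Subtype.mk.injEq, this]

end MatrixChannel

namespace MatrixChannel

variable {R : Type*} [CommRing R] {π : R} {q s : ℕ} {T : Set R}

/-! ### A lower bound for the number of matrices of given rank -/

section RankCount

variable {N m t : ℕ}

/-- The matrix `[1; D]`. -/
def oneStack (ht : t ≤ N) (D : Matrix (Fin (N - t)) (Fin t) R) : Matrix (Fin N) (Fin t) R :=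
  Matrix.of fun i a => if h : (i : ℕ) < t then (if i = Fin.castLE ht a then 1 else 0)
    else D ⟨i - t, by omega⟩ a

/-- The matrix `[G | B]`, of which `B` gives the last columns. -/
def blockRow (G : Matrix (Fin t) (Fin t) R) (B : Matrix (Fin t) (Fin m) R) :
    Matrix (Fin t) (Fin m) R :=
  Matrix.of fun i j => if h : (j : ℕ) < t then G i ⟨j, h⟩ else B i j

/-- The matrix `[1; 0]`. -/
def topOne (R : Type*) [CommRing R] {t N : ℕ} (ht : t ≤ N) : Matrix (Fin N) (Fin t) R :=
  Matrix.of fun i a => if i = Fin.castLE ht a then 1 else 0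

theorem mul_topOne {α : Type*} (ht : t ≤ N) (W : Matrix α (Fin N) R) (i : α) (a : Fin t) :
    (W * topOne R ht) i a = W i (Fin.castLE ht a) := by
  rw [Matrix.mul_apply]
  simp [topOne]

theorem topOne_transpose_mul {α : Type*} (ht : t ≤ N) (L : Matrix (Fin N) α R) (a : Fin t) (j : α) :
    ((topOne R ht).transpose * L) a j = L (Fin.castLE ht a) j := by
  rw [Matrix.mul_apply]
  simp [topOne]

theorem topOne_transpose_mul_oneStack (ht : t ≤ N) (D : Matrix (Fin (N - t)) (Fin t) R) :
    (topOne R ht).transpose * oneStack ht D = 1 := by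
  ext a b
  rw [topOne_transpose_mul]
  simp [oneStack, Matrix.one_apply]

theorem blockRow_mul_topOne (ht : t ≤ m) (G : Matrix (Fin t) (Fin t) R)
    (B : Matrix (Fin t) (Fin m) R) : blockRow G B * topOne R ht = G := by
  ext a b
  rw [mul_topOne]
  simp [blockRow]

theorem pow_le_card_rankFinset [Fintype R] (h : IsFiniteChainRing π q s) {μ : Fin s → ℕ}
    (hμ : Monotone μ) (hm : ∀ i, μ i ≤ m) (htN : t ≤ N) (htμ : ∀ i, t ≤ μ i) :
    q ^ (∑ i, t * (N + μ i - t)) ≤ q ^ (s * t) * (rankFinset π t μ N m).card := by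
  have htm : t ≤ m := (htμ ⟨0, h.s_pos⟩).trans (hm _)
  let e : Fin t → Fin m → ℕ := fun _ j => if (j : ℕ) < t then s else shapeExp μ j
  have hB := h.card_matrix_dvd e
  have hsum : ∀ i, ∑ j : Fin m, (s - e i j) = ∑ u, (μ u - t) := fun i => by
    have h1 := sum_sub_max_shapeExp hμ hm 0 t
    simp only [zero_le, if_true, Nat.zero_max] at h1
    rw [← h1]
    refine Finset.sum_congr rfl fun j _ => ?_
    by_cases hj : (j : ℕ) < t
    · simp only [e, if_pos hj, Nat.sub_self]
    · simp only [e, if_neg hj]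
  simp_rw [hsum] at hB
  rw [Finset.sum_const, Finset.card_univ, Fintype.card_fin, smul_eq_mul] at hB
  have hD := h.card_matrix (Fin (N - t)) (Fin t)
  rw [Fintype.card_fin, Fintype.card_fin] at hD
  have hG := pow_le_card_parabolic h (l := fun _ : Fin t => 0) fun _ => Nat.zero_le _
  simp only [Nat.sub_self, Finset.sum_const_zero, add_zero] at hG
  have hle : Nat.card (Matrix (Fin (N - t)) (Fin t) R × parabolic π (fun _ : Fin t => 0) ×
      {x : Matrix (Fin t) (Fin m) R // ∀ i j, π ^ e i j ∣ x i j}) ≤ (rankFinset π t μ N m).card := by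
    rw [← Nat.card_eq_finsetCard]
    refine Nat.card_le_card_of_injective
      (fun p => ⟨oneStack htN p.1 * blockRow p.2.1.1 p.2.2.1, ?_⟩) ?_
    · obtain ⟨D, ⟨G, hG, -⟩, B, hB⟩ := p
      dsimp only
      obtain ⟨G, rfl⟩ := hG
      rw [mem_rankFinset, mem_rowMatrices]
      constructor
      · intro i j
        rw [Matrix.mul_apply]
        refine Finset.dvd_sum fun a _ => Dvd.dvd.mul_left ?_ _
        by_cases hj : (j : ℕ) < t
        · have : shapeExp μ j = 0 := by
            by_contra h0
            have := (lt_shapeExp_iff hμ ⟨0, h.s_pos⟩ j).1 (Nat.pos_of_ne_zero h0)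
            have := htμ ⟨0, h.s_pos⟩
            omega
          rw [this, pow_zero]; exact one_dvd _
        · have := hB a j
          simp only [e, if_neg hj] at this
          simpa [blockRow, hj] using this
      · have := hasRank_of_factor (topOne_transpose_mul_oneStack htN D)
          (W := blockRow (G : Matrix (Fin t) (Fin t) R) B)
          (W' := topOne R htm * (↑G⁻¹ : Matrix (Fin t) (Fin t) R))
          (by rw [← Matrix.mul_assoc, blockRow_mul_topOne, Units.mul_inv])
        rwa [Fintype.card_fin] at this
    · rintro ⟨D, ⟨G, hG, hG'⟩, B, hB⟩ ⟨D₂, ⟨G₂, hG₂, hG₂'⟩, B₂, hB₂⟩ heq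
      have hLW : oneStack htN D * blockRow G B = oneStack htN D₂ * blockRow G₂ B₂ :=
        congrArg Subtype.val heq
      have hW : blockRow G B = blockRow G₂ B₂ := by
        have := congrArg ((topOne R htN).transpose * ·) hLW
        simpa only [← Matrix.mul_assoc, topOne_transpose_mul_oneStack, Matrix.one_mul] using this
      have hGG : G = G₂ := by
        rw [← blockRow_mul_topOne htm G B, hW, blockRow_mul_topOne]
      subst hGG
      have hBB : B = B₂ := by
        ext i j
        by_cases hj : (j : ℕ) < t
        · have h1 := hB i j
          have h2 := hB₂ i j
          simp only [e, if_pos hj, h.pow_eq_zero, zero_dvd_iff] at h1 h2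
          exact h1.trans h2.symm
        · have := congrFun (congrFun hW i) j
          simpa [blockRow, hj] using this
      subst hBB
      have hL : oneStack htN D = oneStack htN D₂ := by
        obtain ⟨G, rfl⟩ := hG
        have := congrArg (fun Y : Matrix (Fin N) (Fin m) R => Y * topOne R htm * (↑G⁻¹ : Matrix (Fin t) (Fin t) R)) hLW
        simpa only [Matrix.mul_assoc, blockRow_mul_topOne, Units.mul_inv, Matrix.mul_one] using this
      have hDD : D = D₂ := by
        ext i a
        have := congrFun (congrFun hL ⟨t + i, by omega⟩) a
        simpa [oneStack] using this
      subst hDD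
      rfl
  rw [Nat.card_prod, Nat.card_prod, hD, hB] at hle
  calc q ^ (∑ i, t * (N + μ i - t)) = q ^ (s * ((N - t) * t)) * q ^ (s * (t * t)) * q ^ (t * ∑ u, (μ u - t)) := by
        rw [← pow_add, ← pow_add]
        congr 1
        have : ∀ i, t * (N + μ i - t) = (N - t) * t + t * t + t * (μ i - t) := fun i => by
          obtain ⟨a, ha⟩ := Nat.exists_eq_add_of_le (htμ i)
          obtain ⟨b, hb⟩ := Nat.exists_eq_add_of_le htN
          rw [ha, hb, show t + b + (t + a) - t = t + b + a by omega, Nat.add_sub_cancel_left,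
            Nat.add_sub_cancel_left]
          ring
        simp_rw [this]
        rw [Finset.sum_add_distrib, Finset.sum_const, Finset.card_univ, Fintype.card_fin,
          ← Finset.mul_sum, smul_eq_mul]
        ring
    _ ≤ q ^ (s * ((N - t) * t)) * (q ^ (s * t) * Nat.card (parabolic π fun _ : Fin t => 0)) *
          q ^ (t * ∑ u, (μ u - t)) := by gcongr
    _ = q ^ (s * t) * (q ^ (s * ((N - t) * t)) * (Nat.card (parabolic π fun _ : Fin t => 0) *
          q ^ (t * ∑ u, (μ u - t)))) := by ring
    _ ≤ _ := Nat.mul_le_mul_left _ hle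

end RankCount

/-! ### The type of a matrix -/

section MatrixType

/-- The degrees of the rows of the row canonical form. -/
noncomputable def rowType (π : R) (s : ℕ) (T : Set R) {N m : ℕ} (y : Matrix (Fin N) (Fin m) R) (i : Fin N) : ℕ :=
  minDegree π s (rcf π s T y i)

variable {N m : ℕ}

theorem rowType_le (y : Matrix (Fin N) (Fin m) R) (i : Fin N) : rowType π s T y i ≤ s :=
  minDegree_le _

theorem card_rowSpan_eq (h : IsFiniteChainRing π q s) (hT : IsResidueSystem π T)
    (y : Matrix (Fin N) (Fin m) R) :
    Nat.card (rowSpan y) = q ^ ∑ i, (s - rowType π s T y i) := by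
  obtain ⟨h1, h2⟩ := rcf_spec h hT y
  rw [LeftEquiv.rowSpan_eq h2, (h1.staircase h).card_rowSpan h]
  rfl

theorem exists_unit_rowType_dvd (h : IsFiniteChainRing π q s) (hT : IsResidueSystem π T)
    (y : Matrix (Fin N) (Fin m) R) : ∃ U : Matrix (Fin N) (Fin N) R, IsUnit U ∧
      ∀ i j, π ^ rowType π s T y i ∣ (U * y) i j := by
  obtain ⟨-, U, hU, hUy⟩ := rcf_spec h hT y
  exact ⟨U, hU, fun i j => hUy ▸ pow_minDegree_dvd _ j⟩

/-- The socle of a module generated by `c` elements has at most `q ^ c` elements. -/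
theorem card_rowType_lt_le (h : IsFiniteChainRing π q s) (hT : IsResidueSystem π T) {c : ℕ}
    {y : Matrix (Fin N) (Fin m) R} {B : Matrix (Fin c) (Fin m) R} (hy : rowSpan y ≤ rowSpan B) :
    (Finset.univ.filter fun i => rowType π s T y i < s).card ≤ c := by
  classical
  have := h.finite
  have hq := h.two_le_q
  have h1 := (rcf_spec h hT y)
  have h2 := (rcf_spec h hT B)
  have h3 : Nat.card (socle π (rowSpan y)) ≤ Nat.card (socle π (rowSpan B)) :=
    Nat.card_le_card_of_injective _ (Submodule.inclusion_injective (inf_le_inf_right _ hy))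
  rw [LeftEquiv.rowSpan_eq h1.2, LeftEquiv.rowSpan_eq h2.2, (h1.1.staircase h).card_socle h,
    (h2.1.staircase h).card_socle h, Nat.pow_le_pow_iff_right (by omega)] at h3
  refine le_trans (Finset.card_le_card fun i hi => ?_) (h3.trans ((Finset.card_le_univ _).trans_eq
    (Fintype.card_fin c)))
  rw [Finset.mem_filter] at hi ⊢
  refine ⟨hi.1, fun h0 => ?_⟩
  have := (minDegree_eq_iff h).2 h0
  exact hi.2.ne this

theorem sum_tsub_eq (l : Fin N → ℕ) : ∑ i, (s - l i) =
    ∑ u : Fin s, (Finset.univ.filter fun i => l i ≤ (u : ℕ)).card := by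
  simp_rw [← card_fin_ge, Finset.card_filter]
  exact Finset.sum_comm

theorem sum_weighted_eq (l : Fin N → ℕ) (μ : Fin s → ℕ) :
    (∑ i, ∑ u : Fin s, if l i ≤ (u : ℕ) then μ u else 0) =
      ∑ u : Fin s, (Finset.univ.filter fun i => l i ≤ (u : ℕ)).card * μ u := by
  rw [Finset.sum_comm]
  refine Finset.sum_congr rfl fun u _ => ?_
  rw [← Finset.sum_filter, Finset.sum_const, smul_eq_mul]

theorem sum_sum_tsub_eq {l : Fin N → ℕ} (hl : ∀ i, l i ≤ s) : ∑ i, ∑ i', (l i - l i') =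
    ∑ u : Fin s, (Finset.univ.filter fun i => l i ≤ (u : ℕ)).card *
      (N - (Finset.univ.filter fun i => l i ≤ (u : ℕ)).card) := by
  have h1 : ∀ i i', l i - l i' = ∑ u : Fin s, if l i' ≤ (u : ℕ) ∧ ¬ l i ≤ (u : ℕ) then 1 else 0 := by
    intro i i'
    have e1 := card_fin_ge s (l i')
    have e2 := card_fin_ge s (l i)
    rw [← Finset.card_filter]
    by_cases hii : l i' ≤ l i
    · have hsub : (Finset.univ.filter fun u : Fin s => l i ≤ (u : ℕ)) ⊆
          Finset.univ.filter fun u : Fin s => l i' ≤ (u : ℕ) := fun u hu => by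
        rw [Finset.mem_filter] at hu ⊢
        exact ⟨hu.1, hii.trans hu.2⟩
      have e3 := Finset.card_sdiff_of_subset hsub
      rw [← Finset.filter_and_not] at e3
      have := hl i; have := hl i'
      omega
    · rw [Nat.sub_eq_zero_of_le (by omega), eq_comm, Finset.card_eq_zero, Finset.filter_eq_empty_iff]
      intro u _; omega
  simp_rw [h1]
  rw [Finset.sum_congr rfl fun i _ => Finset.sum_comm, Finset.sum_comm]
  refine Finset.sum_congr rfl fun u _ => ?_
  have h2 : (Finset.univ.filter fun i => ¬ l i ≤ (u : ℕ)).card =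
      N - (Finset.univ.filter fun i => l i ≤ (u : ℕ)).card := by
    have := Finset.card_filter_add_card_filter_not (s := (Finset.univ : Finset (Fin N))) fun i => l i ≤ (u : ℕ)
    rw [Finset.card_univ, Fintype.card_fin] at this
    omega
  rw [← h2, Finset.card_filter, Finset.card_filter, Finset.sum_mul_sum, Finset.sum_comm]
  refine Finset.sum_congr rfl fun i _ => Finset.sum_congr rfl fun i' _ => ?_
  split_ifs <;> simp_all

end MatrixType

end MatrixChannel

namespace MatrixChannel

/-! ### Bounds for the mutual information -/

section Information

variable {α β : Type*} [Fintype α] [Fintype β] {b : ℝ} {p : α → ℝ} {W : α → β → ℝ}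

theorem mutualInfo_le (hb : 1 < b) (hp : p ∈ stdSimplex ℝ α) (hW : ∀ x y, 0 ≤ W x y)
    (hW1 : ∀ x, ∑ y, W x y = 1) {g : β → ℝ} (hg : ∀ y, 0 ≤ g y) (hg1 : ∑ y, g y ≤ 1) {E : ℕ}
    (hWg : ∀ x y, W x y ≤ b ^ E * g y) : mutualInfo b p W ≤ E := by
  obtain ⟨hp0, hp1⟩ := hp
  have hlog : 0 < Real.log b := Real.log_pos hb
  set Q : β → ℝ := fun y => ∑ x, p x * W x y with hQ
  have hpW : ∀ x y, 0 ≤ p x * W x y := fun x y => mul_nonneg (hp0 x) (hW x y)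
  have hterm : ∀ x y, p x * W x y * Real.logb b (W x y / Q y) ≤
      p x * W x y * E + p x * W x y * (g y / Q y - 1) / Real.log b := by
    intro x y
    rcases (hpW x y).eq_or_lt with h0 | h0
    · rw [← h0]; simp
    have hWpos : 0 < W x y := (hW x y).lt_of_ne fun h => by rw [← h, mul_zero] at h0; exact h0.false
    have hQpos : 0 < Q y := h0.trans_le (Finset.single_le_sum (f := fun x => p x * W x y)
      (fun x _ => hpW x y) (Finset.mem_univ x))
    have hgpos : 0 < g y := (hg y).lt_of_ne fun h => by
      have := hWg x y
      rw [← h, mul_zero] at this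
      linarith
    rw [mul_div_assoc, ← mul_add]
    refine mul_le_mul_of_nonneg_left ?_ h0.le
    calc Real.logb b (W x y / Q y) ≤ Real.logb b (b ^ E * (g y / Q y)) := by
          apply Real.logb_le_logb_of_le hb (div_pos hWpos hQpos)
          rw [← mul_div_assoc]
          exact div_le_div_of_nonneg_right (hWg x y) hQpos.le
      _ = E + Real.log (g y / Q y) / Real.log b := by
          rw [Real.logb_mul (pow_ne_zero _ (by linarith)) (div_pos hgpos hQpos).ne', Real.logb_pow,
            Real.logb_self_eq_one hb, mul_one]
          rfl
      _ ≤ _ := by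
          gcongr
          exact Real.log_le_sub_one_of_pos (div_pos hgpos hQpos)
  have hsum1 : ∑ x, ∑ y, p x * W x y = 1 := by
    simp_rw [← Finset.mul_sum, hW1, mul_one, hp1]
  have hsum2 : ∑ x, ∑ y, p x * W x y * (g y / Q y - 1) ≤ 0 := by
    rw [Finset.sum_comm]
    have h1 : ∀ y, ∑ x, p x * W x y * (g y / Q y - 1) ≤ g y - ∑ x, p x * W x y := by
      intro y
      rw [← Finset.sum_mul]
      change Q y * _ ≤ g y - Q y
      rcases eq_or_ne (Q y) 0 with h0 | h0
      · rw [h0, zero_mul, sub_zero]; exact hg y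
      · rw [mul_sub, mul_div_cancel₀ _ h0, mul_one]
    refine (Finset.sum_le_sum fun y _ => h1 y).trans ?_
    rw [Finset.sum_sub_distrib, Finset.sum_comm, hsum1]
    linarith
  calc mutualInfo b p W ≤ ∑ x, ∑ y, (p x * W x y * E + p x * W x y * (g y / Q y - 1) / Real.log b) :=
        Finset.sum_le_sum fun x _ => Finset.sum_le_sum fun y _ => hterm x y
    _ = E + (∑ x, ∑ y, p x * W x y * (g y / Q y - 1)) / Real.log b := by
        simp_rw [Finset.sum_add_distrib, ← Finset.sum_mul, Finset.sum_div]
        rw [hsum1, one_mul]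
    _ ≤ E := by
        have := div_nonpos_of_nonpos_of_nonneg hsum2 hlog.le
        linarith

open Classical in
/-- The uniform distribution on a code that is decoded without errors, except for failures. -/
theorem le_mutualInfo_of_code (hb : 1 < b) (hW : ∀ x y, 0 ≤ W x y) {C : Finset α}
    (hC : C.Nonempty) (hW1 : ∀ x ∈ C, ∑ y, W x y = 1) {F : β → Prop} {ε : ℝ}
    (hdisj : ∀ y, ¬ F y → ∀ x ∈ C, ∀ x' ∈ C, x ≠ x' → W x y = 0 ∨ W x' y = 0)
    (hF : ∀ x ∈ C, ∑ y, (if F y then W x y else 0) ≤ ε) :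
    ∃ p ∈ stdSimplex ℝ α, (1 - ε) * Real.logb b C.card ≤ mutualInfo b p W := by
  have hCpos : (0 : ℝ) < C.card := by exact_mod_cast hC.card_pos
  have hlog : 0 < Real.log b := Real.log_pos hb
  have hL : 0 ≤ Real.logb b C.card := Real.logb_nonneg hb (by exact_mod_cast hC.card_pos)
  let p : α → ℝ := fun x => if x ∈ C then (C.card : ℝ)⁻¹ else 0
  have hp0 : ∀ x, 0 ≤ p x := fun x => by simp only [p]; split_ifs <;> positivity
  have hpC : ∀ x ∈ C, p x = (C.card : ℝ)⁻¹ := fun x hx => if_pos hx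
  have hpn : ∀ x, x ∉ C → p x = 0 := fun x hx => if_neg hx
  have hp1 : ∑ x, p x = 1 := by
    simp only [p]
    rw [Finset.sum_ite_mem, Finset.univ_inter, Finset.sum_const, nsmul_eq_mul,
      mul_inv_cancel₀ hCpos.ne']
  refine ⟨p, ⟨hp0, hp1⟩, ?_⟩
  set Q : β → ℝ := fun y => ∑ x, p x * W x y with hQ
  have hpW : ∀ x y, 0 ≤ p x * W x y := fun x y => mul_nonneg (hp0 x) (hW x y)
  have hterm : ∀ x y, p x * (W x y - if F y then W x y else 0) * Real.logb b C.card +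
      (if F y then p x * W x y - p x * Q y else 0) / Real.log b ≤
        p x * W x y * Real.logb b (W x y / Q y) := by
    intro x y
    by_cases hFy : F y
    · rw [if_pos hFy, if_pos hFy, sub_self, mul_zero, zero_mul, zero_add]
      rcases (hpW x y).eq_or_lt with h0 | h0
      · rw [← h0, zero_mul, zero_sub]
        refine div_nonpos_of_nonpos_of_nonneg (neg_nonpos.2 (mul_nonneg (hp0 x) ?_)) hlog.le
        exact Finset.sum_nonneg fun x _ => hpW x y
      have hWpos : 0 < W x y :=
        (hW x y).lt_of_ne fun h => by rw [← h, mul_zero] at h0; exact h0.false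
      have hQpos : 0 < Q y := h0.trans_le (Finset.single_le_sum (f := fun x => p x * W x y)
        (fun x _ => hpW x y) (Finset.mem_univ x))
      have h1 := Real.log_le_sub_one_of_pos (div_pos hQpos hWpos)
      have h2 : Real.log (W x y / Q y) = - Real.log (Q y / W x y) := by
        rw [← Real.log_inv, inv_div]
      rw [Real.logb, ← mul_div_assoc, h2]
      refine div_le_div_of_nonneg_right ?_ hlog.le
      calc p x * W x y - p x * Q y = p x * W x y * -(Q y / W x y - 1) := by
            field_simp; ring
        _ ≤ _ := mul_le_mul_of_nonneg_left (neg_le_neg h1) h0.le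
    · rw [if_neg hFy, if_neg hFy, sub_zero, zero_div, add_zero]
      by_cases hx : x ∈ C
      · rcases (hW x y).eq_or_lt with h0 | h0
        · rw [← h0]; simp
        · have hQy : Q y = p x * W x y := by
            refine Finset.sum_eq_single x (fun x' _ hne => ?_) fun hn => absurd (Finset.mem_univ x) hn
            by_cases hx' : x' ∈ C
            · rw [(hdisj y hFy x hx x' hx' hne.symm).resolve_left h0.ne', mul_zero]
            · rw [hpn x' hx', zero_mul]
          rw [hQy, hpC x hx, div_mul_cancel_right₀ h0.ne', inv_inv]
      · rw [hpn x hx]; simp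
  have hD : ∑ x, ∑ y, (if F y then p x * W x y - p x * Q y else 0) = 0 := by
    rw [Finset.sum_comm]
    refine Finset.sum_eq_zero fun y _ => ?_
    split_ifs
    · rw [Finset.sum_sub_distrib, ← Finset.sum_mul, hp1, one_mul]
      exact sub_self _
    · exact Finset.sum_const_zero
  calc (1 - ε) * Real.logb b C.card ≤
        (∑ x, p x * (∑ y, (W x y - if F y then W x y else 0))) * Real.logb b C.card := by
        refine mul_le_mul_of_nonneg_right ?_ hL
        calc 1 - ε = ∑ x, p x * (1 - ε) := by rw [← Finset.sum_mul, hp1, one_mul]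
          _ ≤ _ := by
            refine Finset.sum_le_sum fun x _ => ?_
            by_cases hx : x ∈ C
            · refine mul_le_mul_of_nonneg_left ?_ (hp0 x)
              rw [Finset.sum_sub_distrib, hW1 x hx]
              linarith [hF x hx]
            · rw [hpn x hx, zero_mul, zero_mul]
    _ = ∑ x, ∑ y, (p x * (W x y - if F y then W x y else 0) * Real.logb b C.card +
          (if F y then p x * W x y - p x * Q y else 0) / Real.log b) := by
        simp_rw [Finset.sum_add_distrib, ← Finset.sum_div]
        rw [hD, zero_div, add_zero]
        simp_rw [Finset.mul_sum, Finset.sum_mul]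
    _ ≤ mutualInfo b p W :=
        Finset.sum_le_sum fun x _ => Finset.sum_le_sum fun y _ => hterm x y

end Information

/-! ### Transition probabilities of the channel -/

variable {R : Type*} [CommRing R] [Fintype R] {π : R} {q s : ℕ} {T : Set R}
  {n N m t : ℕ} {μ : Fin s → ℕ}

open Classical in
theorem sum_mamcProb (h : IsFiniteChainRing π q s) [Fintype (rowMatrices π μ N m)]
    {X : Matrix (Fin n) (Fin m) R} (hX : X ∈ rowMatrices π μ n m)
    (P : Matrix (Fin N) (Fin m) R → Prop) :
    ∑ y : rowMatrices π μ N m, (if P y.1 then mamcProb π (fun _ => t) μ N X (fun Y => Y = y.1) else 0) =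
      mamcProb π (fun _ => t) μ N X P := by
  have hmem : ∀ A : Matrix (Fin N) (Fin n) R, ∀ Z ∈ rankFinset π t μ N m,
      A * X + Z ∈ rowMatrices π μ N m := fun A Z hZ => by
    rw [mem_rowMatrices] at hX ⊢
    intro i j
    rw [Matrix.add_apply, Matrix.mul_apply]
    exact dvd_add (Finset.dvd_sum fun k _ => (hX k j).mul_left _)
      (mem_rowMatrices.1 (mem_rankFinset.1 hZ).1 i j)
  have hA : ∀ A : Matrix (Fin N) (Fin n) R, ((rankFinset π t μ N m).filter fun Z => P (A * X + Z)).card =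
      ∑ y : rowMatrices π μ N m,
        if P y.1 then ((rankFinset π t μ N m).filter fun Z => A * X + Z = y.1).card else 0 := by
    intro A
    have h1 : ∀ y : rowMatrices π μ N m,
        (if P y.1 then ((rankFinset π t μ N m).filter fun Z => A * X + Z = y.1).card else 0) =
          ∑ Z ∈ rankFinset π t μ N m, if A * X + Z = y.1 ∧ P y.1 then 1 else 0 := by
      intro y
      by_cases hP : P y.1
      · rw [if_pos hP, Finset.card_filter]
        simp only [hP, and_true]
      · simp [hP]
    simp_rw [h1]
    rw [Finset.sum_comm, Finset.card_filter]
    refine Finset.sum_congr rfl fun Z hZ => ?_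
    rw [Finset.sum_eq_single ⟨A * X + Z, hmem A Z hZ⟩]
    · simp
    · intro y _ hy
      exact if_neg fun hn => hy (Subtype.ext hn.1.symm)
    · exact fun hn => absurd (Finset.mem_univ _) hn
  simp_rw [mamcProb_eq h, hA]
  rw [Finset.sum_comm]
  push_cast
  rw [Finset.sum_div]
  refine Finset.sum_congr rfl fun y _ => ?_
  split_ifs
  · congr!
  · simp

theorem card_rankFinset_pos (h : IsFiniteChainRing π q s) (hμ : Monotone μ) (hm : ∀ i, μ i ≤ m)
    (htN : t ≤ N) (htμ : ∀ i, t ≤ μ i) : 0 < (rankFinset π t μ N m).card := by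
  have hq := h.two_le_q
  exact Nat.pos_of_mul_pos_left ((Nat.pow_pos (by omega)).trans_le
    (pow_le_card_rankFinset h hμ hm htN htμ))

theorem sum_mamcProb_eq_one (h : IsFiniteChainRing π q s) [Fintype (rowMatrices π μ N m)]
    (hμ : Monotone μ) (hm : ∀ i, μ i ≤ m) (hnN : n ≤ N) (htN : t ≤ N) (htμ : ∀ i, t ≤ μ i)
    {X : Matrix (Fin n) (Fin m) R} (hX : X ∈ rowMatrices π μ n m) :
    ∑ y : rowMatrices π μ N m, mamcProb π (fun _ => t) μ N X (fun Y => Y = y.1) = 1 := by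
  classical
  have h1 := sum_mamcProb (t := t) (N := N) h hX fun _ => True
  simp only [if_true] at h1
  rw [h1, mamcProb_eq h]
  have h2 := card_rankFinset_pos h hμ hm htN htμ
  have h3 := card_rankFinset_pos (N := N) (t := n) (m := n) h (monotone_const (c := n))
    (fun _ => le_rfl) hnN fun _ => le_rfl
  simp only [Finset.filter_true, Finset.sum_const, smul_eq_mul]
  push_cast
  exact div_self (by positivity)

omit [Fintype R] in
theorem mamcProb_nonneg {τ : Fin s → ℕ} {X : Matrix (Fin n) (Fin m) R}
    {P : Matrix (Fin N) (Fin m) R → Prop} : 0 ≤ mamcProb π τ μ N X P := by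
  unfold mamcProb; positivity

end MatrixChannel

namespace MatrixChannel

/-! ### Bounds for the capacity -/

theorem exponent_le {N t r l u : ℕ} (hl : l ≤ r + t) (hr : r + t ≤ N) (hu : 2 * N ≤ u) :
    t * (N - t) + l * (N - l) + l * u ≤ r * (u - r - t) + l * (N - t) + t * (N + u - t) := by
  obtain ⟨a, ha⟩ := Nat.exists_eq_add_of_le hl
  obtain ⟨b, rfl⟩ := Nat.exists_eq_add_of_le hr
  obtain ⟨c, rfl⟩ := Nat.exists_eq_add_of_le hu
  have e1 : r + t + b - t = r + b := by omega
  have e2 : r + t + b - l = a + b := by omega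
  have e3 : 2 * (r + t + b) + c - r - t = r + t + 2 * b + c := by omega
  have e4 : r + t + b + (2 * (r + t + b) + c) - t = r + b + (2 * (r + t + b) + c) := by omega
  rw [e1, e2, e3, e4]
  have hnn : 0 ≤ (a : ℤ) * (t + a + 2 * b + c) := by positivity
  zify
  have ha : (l : ℤ) = r + t - a := by omega
  rw [ha]
  linarith

variable {R : Type*} [CommRing R] [Fintype R] {π : R} {q s : ℕ} {T : Set R}
  {n N m t : ℕ} {μ : Fin s → ℕ}

/-- The matrices that can be brought to row degrees at least `l`. -/
noncomputable def typeCard (π : R) {s : ℕ} (μ : Fin s → ℕ) {N : ℕ} (m : ℕ) (l : Fin N → ℕ) : ℕ :=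
  Nat.card {y : Matrix (Fin N) (Fin m) R | y ∈ rowMatrices π μ N m ∧
    ∃ U : Matrix (Fin N) (Fin N) R, IsUnit U ∧ ∀ i j, π ^ l i ∣ (U * y) i j}

theorem typeCard_le (h : IsFiniteChainRing π q s) (hμ : Monotone μ) (hm : ∀ i, μ i ≤ m)
    {l : Fin N → ℕ} (hl : ∀ i, l i ≤ s) :
    typeCard π μ m l ≤ q ^ (s * N + ∑ u : Fin s,
      ((Finset.univ.filter fun i => l i ≤ (u : ℕ)).card *
        (N - (Finset.univ.filter fun i => l i ≤ (u : ℕ)).card) +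
        (Finset.univ.filter fun i => l i ≤ (u : ℕ)).card * μ u)) := by
  have hq := h.two_le_q
  have h1 := card_type_mul_le h hμ hm l
  have h2 := pow_le_card_parabolic h hl
  rw [sum_weighted_eq] at h1
  rw [sum_sum_tsub_eq hl] at h2
  rw [Finset.sum_add_distrib]
  set A := ∑ u : Fin s, (Finset.univ.filter fun i => l i ≤ (u : ℕ)).card *
        (N - (Finset.univ.filter fun i => l i ≤ (u : ℕ)).card)
  set B := ∑ u : Fin s, (Finset.univ.filter fun i => l i ≤ (u : ℕ)).card * μ u
  refine le_of_mul_le_mul_right (a := q ^ (s * (N * N))) ?_ (Nat.pow_pos (by omega))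
  calc typeCard π μ m l * q ^ (s * (N * N)) ≤
        typeCard π μ m l * (q ^ (s * N + A) * Nat.card (parabolic π l)) := Nat.mul_le_mul_left _ h2
    _ = q ^ (s * N + A) * (typeCard π μ m l * Nat.card (parabolic π l)) := by ring
    _ ≤ q ^ (s * N + A) * q ^ (s * (N * N) + B) := Nat.mul_le_mul_left _ h1
    _ = q ^ (s * N + (A + B)) * q ^ (s * (N * N)) := by rw [← pow_add, ← pow_add]; congr 1; ring

theorem card_rank_sub_le (h : IsFiniteChainRing π q s) (hT : IsResidueSystem π T) (htN : t ≤ N)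
    (x : Matrix (Fin n) (Fin m) R) (y : Matrix (Fin N) (Fin m) R) :
    Nat.card {A : Matrix (Fin N) (Fin n) R | HasRank t (y - A * x)} *
      q ^ ((N - t) * ∑ u : Fin s, (Finset.univ.filter fun i => rowType π s T y i ≤ (u : ℕ)).card) ≤
      q ^ (s * (n * N) + s * N + s * (t * (N - t))) := by
  have hq := h.two_le_q
  have h1 := card_rank_sub_mul_le h hT (t := t) x y
  have h2 := pow_le_card_parabolic h (l := fun i : Fin N => if (i : ℕ) < t then 0 else s)
    (fun i => by split_ifs <;> omega)
  have hlt : (Finset.univ.filter fun i : Fin N => (i : ℕ) < t).card = t := by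
    have := card_fin_ge N t
    have h3 := Finset.card_filter_add_card_filter_not (s := (Finset.univ : Finset (Fin N))) fun i => t ≤ (i : ℕ)
    simp only [not_le] at h3
    rw [Finset.card_univ, Fintype.card_fin] at h3
    omega
  have hle : ∀ u : Fin s, (Finset.univ.filter fun i : Fin N =>
      (if (i : ℕ) < t then 0 else s) ≤ (u : ℕ)).card = t := fun u => by
    refine (congrArg Finset.card ?_).trans hlt
    ext i
    rw [Finset.mem_filter, Finset.mem_filter, and_congr_right_iff]
    intro _
    have := u.2
    split_ifs with hi
    · simp [hi]
    · omega
  rw [sum_sum_tsub_eq (s := s) (l := fun i : Fin N => if (i : ℕ) < t then 0 else s)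
    (fun i => by split_ifs <;> omega)] at h2
  simp_rw [hle] at h2
  rw [Finset.sum_const, Finset.card_univ, Fintype.card_fin, smul_eq_mul] at h2
  rw [card_fin_ge, card_rowSpan_eq h hT, sum_tsub_eq, ← pow_mul] at h1
  set L := ∑ u : Fin s, (Finset.univ.filter fun i => rowType π s T y i ≤ (u : ℕ)).card
  set a := Nat.card {A : Matrix (Fin N) (Fin n) R | HasRank t (y - A * x)}
  set P := Nat.card (parabolic π fun i : Fin N => if (i : ℕ) < t then 0 else s)
  refine le_of_mul_le_mul_right (a := q ^ (s * (N * N))) ?_ (Nat.pow_pos (by omega))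
  calc a * q ^ ((N - t) * L) * q ^ (s * (N * N)) ≤
        a * q ^ ((N - t) * L) * (q ^ (s * N + s * (t * (N - t))) * P) := Nat.mul_le_mul_left _ h2
    _ = q ^ (s * N + s * (t * (N - t))) * (a * P * q ^ (L * (N - t))) := by
        rw [mul_comm L]; ring
    _ ≤ q ^ (s * N + s * (t * (N - t))) * q ^ (s * ((N + n) * N)) := Nat.mul_le_mul_left _ h1
    _ = _ := by rw [← pow_add, ← pow_add]; congr 1; ring

omit [Fintype R] in
theorem rowType_card_le (h : IsFiniteChainRing π q s) (hT : IsResidueSystem π T)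
    {A : Matrix (Fin N) (Fin n) R} {x : Matrix (Fin n) (Fin m) R} {y : Matrix (Fin N) (Fin m) R}
    (hA : HasRank t (y - A * x)) (u : Fin s) :
    (Finset.univ.filter fun i => rowType π s T y i ≤ (u : ℕ)).card ≤ n + t := by
  obtain ⟨L, L', W, W', -, -, hz⟩ := hA.exists_factor h
  have hy : y = (Matrix.fromCols A L).submatrix id finSumFinEquiv.symm *
      (Matrix.fromRows x W).submatrix finSumFinEquiv.symm id := by
    rw [Matrix.submatrix_mul_equiv, Matrix.fromCols_mul_fromRows, ← hz]
    simp
  have h1 := card_rowType_lt_le h hT (B := (Matrix.fromRows x W).submatrix finSumFinEquiv.symm id)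
    (y := y) (by conv_lhs => rw [hy]
                 exact rowSpan_mul_le _ _)
  refine le_trans (Finset.card_le_card fun i hi => ?_) h1
  rw [Finset.mem_filter] at hi ⊢
  exact ⟨hi.1, hi.2.trans_lt u.2⟩

theorem card_transitions_mul_le (h : IsFiniteChainRing π q s) (hT : IsResidueSystem π T)
    (hμ : Monotone μ) (hm : ∀ i, μ i ≤ m) (hnN : n ≤ N) (htN : t ≤ N) (hN : ∀ i, 2 * N ≤ μ i)
    (x : Matrix (Fin n) (Fin m) R) (y : Matrix (Fin N) (Fin m) R) :
    Nat.card {A : Matrix (Fin N) (Fin n) R | HasRank t (y - A * x)} *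
      ((s + 1) ^ N * typeCard π μ m (rowType π s T y)) ≤
    q ^ (∑ i, min n (N - t) * (μ i - min n (N - t) - t) + 5 * s * N) *
      ((rankFinset π n (fun _ : Fin s => n) N n).card * (rankFinset π t μ N m).card) := by
  have hq := h.two_le_q
  set r := min n (N - t) with hr
  rcases Nat.eq_zero_or_pos (Nat.card {A : Matrix (Fin N) (Fin n) R | HasRank t (y - A * x)}) with h0 | hpos
  · rw [h0, zero_mul]; exact Nat.zero_le _
  obtain ⟨⟨A, hA⟩⟩ := (Nat.card_pos_iff.1 hpos).1
  have hlam : ∀ u : Fin s, (Finset.univ.filter fun i => rowType π s T y i ≤ (u : ℕ)).card ≤ r + t := by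
    intro u
    have h1 := rowType_card_le h hT hA u
    have h2 : (Finset.univ.filter fun i => rowType π s T y i ≤ (u : ℕ)).card ≤ N :=
      (Finset.card_le_univ _).trans_eq (Fintype.card_fin N)
    omega
  have e1 := typeCard_le h hμ hm (rowType_le (π := π) (T := T) y)
  have e2 := card_rank_sub_le h hT htN x y
  have e3 := pow_le_card_rankFinset (N := N) (t := n) (m := n) h (monotone_const (c := n))
    (fun _ => le_rfl) hnN fun _ => le_rfl
  have e4 := pow_le_card_rankFinset (N := N) (t := t) h hμ hm htN
    fun i => by have := hN i; omega
  have e5 : (s + 1) ^ N ≤ q ^ (s * N) := by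
    rw [pow_mul]
    exact Nat.pow_le_pow_left ((Nat.lt_two_pow_self).trans_le (Nat.pow_le_pow_left hq s)) N
  set lam : Fin s → ℕ := fun u => (Finset.univ.filter fun i => rowType π s T y i ≤ (u : ℕ)).card
  set a := Nat.card {A : Matrix (Fin N) (Fin n) R | HasRank t (y - A * x)}
  set c := typeCard π μ m (rowType π s T y)
  set TA := (rankFinset π n (fun _ : Fin s => n) N n).card
  set TZ := (rankFinset π t μ N m).card
  have hexp : (s * (n * N) + s * N + s * (t * (N - t))) + s * N +
      (s * N + ∑ u, (lam u * (N - lam u) + lam u * μ u)) + s * n + s * t ≤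
      (∑ i, r * (μ i - r - t) + 5 * s * N) + (N - t) * ∑ u, lam u + ∑ _i : Fin s, n * (N + n - n) +
        ∑ i, t * (N + μ i - t) := by
    have h1 : ∑ u, (t * (N - t) + lam u * (N - lam u) + lam u * μ u) ≤
        ∑ u, (r * (μ u - r - t) + lam u * (N - t) + t * (N + μ u - t)) :=
      Finset.sum_le_sum fun u _ => exponent_le (hlam u) (by omega) (hN u)
    simp only [Finset.sum_add_distrib, Finset.sum_const, Finset.card_univ, Fintype.card_fin,
      smul_eq_mul, ← Finset.sum_mul, Nat.add_sub_cancel] at h1 ⊢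
    have h2 := Nat.mul_le_mul_left s hnN
    have h3 := Nat.mul_le_mul_left s htN
    linarith
  refine le_of_mul_le_mul_right
    (a := q ^ ((N - t) * ∑ u, lam u) * q ^ (∑ _i : Fin s, n * (N + n - n)) * q ^ (∑ i, t * (N + μ i - t))) ?_
    (by have : 0 < q := by omega
        positivity)
  calc a * ((s + 1) ^ N * c) * (q ^ ((N - t) * ∑ u, lam u) * q ^ (∑ _i : Fin s, n * (N + n - n)) *
        q ^ (∑ i, t * (N + μ i - t))) =
      (a * q ^ ((N - t) * ∑ u, lam u)) * (s + 1) ^ N * c * q ^ (∑ _i : Fin s, n * (N + n - n)) *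
        q ^ (∑ i, t * (N + μ i - t)) := by ring
    _ ≤ q ^ (s * (n * N) + s * N + s * (t * (N - t))) * q ^ (s * N) *
          q ^ (s * N + ∑ u, (lam u * (N - lam u) + lam u * μ u)) * (q ^ (s * n) * TA) *
            (q ^ (s * t) * TZ) := by
        gcongr
    _ = q ^ ((s * (n * N) + s * N + s * (t * (N - t))) + s * N +
          (s * N + ∑ u, (lam u * (N - lam u) + lam u * μ u)) + s * n + s * t) * (TA * TZ) := by
        simp only [pow_add]; ring
    _ ≤ q ^ ((∑ i, r * (μ i - r - t) + 5 * s * N) + (N - t) * ∑ u, lam u +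
          ∑ _i : Fin s, n * (N + n - n) + ∑ i, t * (N + μ i - t)) * (TA * TZ) :=
        Nat.mul_le_mul_right _ (Nat.pow_le_pow_right (by omega) hexp)
    _ = _ := by simp only [pow_add]; ring

end MatrixChannel

namespace MatrixChannel

variable {R : Type*} [CommRing R] [Fintype R] {π : R} {q s : ℕ} {T : Set R}
  {n N m t : ℕ} {μ : Fin s → ℕ}

theorem mamcProb_eq_le (h : IsFiniteChainRing π q s) (X : Matrix (Fin n) (Fin m) R)
    (y : Matrix (Fin N) (Fin m) R) :
    mamcProb π (fun _ => t) μ N X (fun Y => Y = y) ≤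
      (Nat.card {A : Matrix (Fin N) (Fin n) R | HasRank t (y - A * X)} : ℝ) /
      ((rankFinset π n (fun _ : Fin s => n) N n).card * (rankFinset π t μ N m).card : ℝ) := by
  classical
  rw [mamcProb_eq h]
  refine div_le_div_of_nonneg_right ?_ (by positivity)
  have hcard : Nat.card {A : Matrix (Fin N) (Fin n) R | HasRank t (y - A * X)} =
      (Finset.univ.filter fun A : Matrix (Fin N) (Fin n) R => HasRank t (y - A * X)).card := by
    rw [← Fintype.card_subtype, ← Nat.card_eq_fintype_card]
    rfl
  rw [Nat.cast_le, hcard, Finset.card_filter]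
  refine (Finset.sum_le_sum fun A _ => ?_).trans (Finset.sum_le_sum_of_subset (Finset.subset_univ _))
  have hZy : ∀ Z, Z ∈ rankFinset π t μ N m ∧ A * X + Z = y → HasRank t Z ∧ Z = y - A * X :=
    fun Z hZ => ⟨(mem_rankFinset.1 hZ.1).2, by rw [← hZ.2, add_sub_cancel_left]⟩
  split_ifs with hr
  · refine Finset.card_le_one.2 fun Z hZ Z' hZ' => ?_
    simp only [Finset.mem_filter] at hZ hZ'
    exact (hZy Z hZ).2.trans (hZy Z' hZ').2.symm
  · rw [Nat.le_zero, Finset.card_eq_zero, Finset.eq_empty_iff_forall_notMem]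
    intro Z hZ
    simp only [Finset.mem_filter] at hZ
    obtain ⟨h1, rfl⟩ := hZy Z hZ
    exact hr h1

/-- The reference distribution: uniform over the types, then uniform over each type. -/
noncomputable def typeWeight (π : R) (T : Set R) {s : ℕ} (μ : Fin s → ℕ) {N m : ℕ}
    (y : Matrix (Fin N) (Fin m) R) : ℝ :=
  (((s + 1) ^ N * typeCard π μ m (rowType π s T y) : ℕ) : ℝ)⁻¹

theorem typeCard_pos (h : IsFiniteChainRing π q s) (hT : IsResidueSystem π T)
    {y : Matrix (Fin N) (Fin m) R} (hy : y ∈ rowMatrices π μ N m) :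
    0 < typeCard π μ m (rowType π s T y) :=
  Nat.card_pos_iff.2 ⟨⟨⟨y, hy, exists_unit_rowType_dvd h hT y⟩⟩, inferInstance⟩

theorem sum_typeWeight_le (h : IsFiniteChainRing π q s) (hT : IsResidueSystem π T)
    [Fintype (rowMatrices π μ N m)] :
    ∑ y : rowMatrices π μ N m, typeWeight π T μ y.1 ≤ 1 := by
  classical
  let f : rowMatrices π μ N m → Fin N → Fin (s + 1) := fun y i =>
    ⟨rowType π s T y.1 i, Nat.lt_succ_of_le (rowType_le _ _)⟩
  rw [← Finset.sum_fiberwise Finset.univ f]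
  have hK : (0 : ℝ) < (s + 1) ^ N := by positivity
  have hfib : ∀ l : Fin N → Fin (s + 1),
      ∑ y : rowMatrices π μ N m with f y = l, typeWeight π T μ y.1 ≤ ((s + 1 : ℝ) ^ N)⁻¹ := by
    intro l
    set c := typeCard π μ m fun i => (l i : ℕ)
    have h1 : ∀ y ∈ (Finset.univ.filter fun y : rowMatrices π μ N m => f y = l),
        typeWeight π T μ y.1 = ((s + 1 : ℝ) ^ N)⁻¹ * (c : ℝ)⁻¹ := by
      intro y hy
      have hl : rowType π s T y.1 = fun i => (l i : ℕ) := by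
        exact funext fun i => congrArg Fin.val (congrFun (Finset.mem_filter.1 hy).2 i)
      rw [typeWeight, hl]
      push_cast
      rw [mul_inv]
    have h2 : (Finset.univ.filter fun y : rowMatrices π μ N m => f y = l).card ≤ c := by
      rw [← Nat.card_eq_finsetCard]
      refine Nat.card_le_card_of_injective (fun y => ⟨y.1.1, y.1.2, ?_⟩) ?_
      · have hl : rowType π s T y.1.1 = fun i => (l i : ℕ) := by
          exact funext fun i => congrArg Fin.val (congrFun (Finset.mem_filter.1 y.2).2 i)
        have := exists_unit_rowType_dvd h hT y.1.1
        rwa [hl] at this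
      · intro y y' hyy
        have hval := congrArg (fun z => z.1) hyy
        exact Subtype.ext (Subtype.ext hval)
    rw [Finset.sum_congr rfl h1, Finset.sum_const, nsmul_eq_mul, mul_left_comm]
    refine mul_le_of_le_one_right (by positivity) ?_
    rw [← div_eq_mul_inv]
    exact div_le_one_of_le₀ (by exact_mod_cast h2) (by positivity)
  refine (Finset.sum_le_sum fun l _ => hfib l).trans_eq ?_
  rw [Finset.sum_const, Finset.card_univ, Fintype.card_fun, Fintype.card_fin, Fintype.card_fin,
    nsmul_eq_mul]
  push_cast
  exact mul_inv_cancel₀ hK.ne'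

theorem mamcProb_le_typeWeight (h : IsFiniteChainRing π q s) (hT : IsResidueSystem π T)
    (hμ : Monotone μ) (hm : ∀ i, μ i ≤ m) (hnN : n ≤ N) (htN : t ≤ N) (hN : ∀ i, 2 * N ≤ μ i)
    (X : Matrix (Fin n) (Fin m) R) {y : Matrix (Fin N) (Fin m) R} (hy : y ∈ rowMatrices π μ N m) :
    mamcProb π (fun _ => t) μ N X (fun Y => Y = y) ≤
      (q : ℝ) ^ (∑ i, min n (N - t) * (μ i - min n (N - t) - t) + 5 * s * N) * typeWeight π T μ y := by
  refine (mamcProb_eq_le h X y).trans ?_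
  have h1 := card_transitions_mul_le h hT hμ hm hnN htN hN X y
  have h2 := card_rankFinset_pos h hμ hm htN fun i => by have := hN i; omega
  have h3 := card_rankFinset_pos (N := N) (t := n) (m := n) h (monotone_const (c := n))
    (fun _ => le_rfl) hnN fun _ => le_rfl
  have h4 := typeCard_pos h hT hy
  rw [typeWeight, ← div_eq_mul_inv, div_le_div_iff₀ (by exact_mod_cast Nat.mul_pos h3 h2)
    (by exact_mod_cast Nat.mul_pos (Nat.pow_pos (Nat.succ_pos s)) h4)]
  exact_mod_cast h1

theorem mutualInfo_mamc_le (h : IsFiniteChainRing π q s) (hT : IsResidueSystem π T)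
    [Fintype (rowMatrices π μ n m)] [Fintype (rowMatrices π μ N m)]
    (hμ : Monotone μ) (hm : ∀ i, μ i ≤ m) (hnN : n ≤ N) (htN : t ≤ N) (hN : ∀ i, 2 * N ≤ μ i)
    {p : rowMatrices π μ n m → ℝ} (hp : p ∈ stdSimplex ℝ (rowMatrices π μ n m)) :
    mutualInfo (q : ℝ) p (fun (X : rowMatrices π μ n m) (Y : rowMatrices π μ N m) =>
      mamcProb π (fun _ => t) μ N X.1 fun Y' => Y' = Y.1) ≤
        (∑ i, min n (N - t) * (μ i - min n (N - t) - t) + 5 * s * N : ℕ) := by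
  refine mutualInfo_le (by exact_mod_cast h.two_le_q) hp (fun _ _ => mamcProb_nonneg)
    (fun X => sum_mamcProb_eq_one h hμ hm hnN htN (fun i => by have := hN i; omega) X.2)
    (g := fun y => typeWeight π T μ y.1) (fun y => ?_) (sum_typeWeight_le h hT)
    (fun X y => mamcProb_le_typeWeight h hT hμ hm hnN htN hN X.1 y.2)
  unfold typeWeight; positivity

theorem mamcCapacity_le (h : IsFiniteChainRing π q s) (hT : IsResidueSystem π T)
    (hμ : Monotone μ) (hm : ∀ i, μ i ≤ m) (hnN : n ≤ N) (htN : t ≤ N) (hN : ∀ i, 2 * N ≤ μ i) :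
    mamcCapacity π q (fun _ => t) μ n N m ≤
        (∑ i, min n (N - t) * (μ i - min n (N - t) - t) + 5 * s * N : ℕ) := by
  classical
  unfold mamcCapacity capacity
  apply Real.sSup_le _ (Nat.cast_nonneg _)
  rintro _ ⟨p, hp, rfl⟩
  exact mutualInfo_mamc_le h hT hμ hm hnN htN hN hp

section Code

variable {v : ℕ}

omit [Fintype R] in
theorem encode_messages_subset (h : IsFiniteChainRing π q s) (hv : ∀ i, v ≤ μ i)
    (hm : v + payloadRows n N v ≤ m) :
    encode n '' messages π T μ m v (payloadRows n N v) ⊆ rowMatrices π μ n m := by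
  rintro _ ⟨M, hM, rfl⟩
  exact encode_mem_rowMatrices hv ((mem_principalForms_iff h (by omega)).1 hM).1

theorem add_payloadRows_le {a : ℕ} (ha : v ≤ a) (hN : N ≤ a) : v + payloadRows n N v ≤ a := by
  unfold payloadRows; omega

omit [Fintype R] in
theorem card_code (h : IsFiniteChainRing π q s) (hμ : Monotone μ) (hm : ∀ i, μ i ≤ m)
    (hN : ∀ i, 2 * N ≤ μ i) (hv : ∀ i, v ≤ μ i) :
    Nat.card (encode (R := R) n '' messages π T μ m v (payloadRows n N v)) =
      q ^ (∑ i, payloadRows n N v * (μ i - v - payloadRows n N v)) := by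
  have hvm : v ≤ m := (hv ⟨0, h.s_pos⟩).trans (hm _)
  rw [Nat.card_image_of_injective (encode_injective (payloadRows_le n N v) hvm)]
  refine card_principalForms h (fun i j hij => Nat.sub_le_sub_right (hμ hij) v)
    (fun i => Nat.sub_le_sub_right (hm i) v) fun i => ?_
  have := add_payloadRows_le (n := n) (hv i) (show N ≤ μ i by have := hN i; omega)
  omega

theorem le_mamcCapacity (h : IsFiniteChainRing π q s) (hT : IsResidueSystem π T)
    (hμ : Monotone μ) (hm : ∀ i, μ i ≤ m) (hnN : n ≤ N) (htN : t ≤ N) (hN : ∀ i, 2 * N ≤ μ i)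
    (htv : t ≤ v) (hv : ∀ i, v ≤ μ i) :
    (1 - 2 / (q : ℝ) ^ (v - t)) *
        (∑ i, payloadRows n N v * (μ i - v - payloadRows n N v) : ℕ) ≤
      mamcCapacity π q (fun _ => t) μ n N m := by
  classical
  have hq : (1 : ℝ) < q := by exact_mod_cast h.two_le_q
  have hvk : v + payloadRows n N v ≤ m := (add_payloadRows_le (hv ⟨0, h.s_pos⟩)
    (by have := hN ⟨0, h.s_pos⟩; omega)).trans (hm _)
  have hsub := encode_messages_subset (T := T) h hv hvk
  let C : Finset (rowMatrices π μ n m) :=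
    Finset.univ.filter fun X => X.1 ∈ encode n '' messages π T μ m v (payloadRows n N v)
  have hC : C.card = q ^ (∑ i, payloadRows n N v * (μ i - v - payloadRows n N v)) := by
    rw [← card_code (T := T) (R := R) h hμ hm hN hv, ← Nat.card_eq_finsetCard]
    refine Nat.card_congr ⟨fun X => ⟨X.1.1, (Finset.mem_filter.1 X.2).2⟩,
      fun X => ⟨⟨X.1, hsub X.2⟩, Finset.mem_filter.2 ⟨Finset.mem_univ _, X.2⟩⟩,
      fun _ => rfl, fun _ => rfl⟩
  have hCne : C.Nonempty := by
    rw [← Finset.card_pos, hC]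
    exact Nat.pow_pos (by exact_mod_cast (zero_lt_one.trans hq))
  have key := le_mutualInfo_of_code hq
    (W := fun (X : rowMatrices π μ n m) (Y : rowMatrices π μ N m) =>
      mamcProb π (fun _ => t) μ N X.1 fun Y' => Y' = Y.1)
    (fun _ _ => mamcProb_nonneg) hCne
    (fun X _ => sum_mamcProb_eq_one h hμ hm hnN htN (fun i => by have := hN i; omega) X.2)
    (F := fun Y => decode π s T t v (payloadRows n N v) Y.1 = none) (ε := 2 / (q : ℝ) ^ (v - t))
    ?_ ?_
  · obtain ⟨p, hp, hle⟩ := key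
    rw [hC, Nat.cast_pow, Real.logb_pow, Real.logb_self_eq_one hq, mul_one] at hle
    refine hle.trans (le_csSup ⟨(∑ i, min n (N - t) * (μ i - min n (N - t) - t) + 5 * s * N : ℕ), ?_⟩ ⟨p, hp, rfl⟩)
    rintro _ ⟨p, hp, rfl⟩
    exact mutualInfo_mamc_le h hT hμ hm hnN htN hN hp
  · intro Y hY X hX X' hX' hne
    by_contra hn
    push Not at hn
    apply hne
    have hdec : ∀ X : rowMatrices π μ n m, X ∈ C →
        mamcProb π (fun _ => t) μ N X.1 (fun Y' => Y' = Y.1) ≠ 0 →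
        ∀ M', decode π s T t v (payloadRows n N v) Y.1 = some M' → X.1 = encode n M' := by
      intro X hX hp M' hM'
      obtain ⟨M, hM, hMX⟩ := (Finset.mem_filter.1 hX).2
      by_contra hXM
      refine hp (mamcProb_eq_zero h fun A Z _ hZ _ hY => hXM ?_)
      rw [← hMX] at hY ⊢
      rw [← hY] at hM'
      rw [decode_correct h hT (payloadRows_le n N v) hvk (message_identity_block h hvk hM) A hZ hM']
    obtain ⟨M', hM'⟩ := Option.ne_none_iff_exists'.1 hY
    exact Subtype.ext ((hdec X hX hn.1 M' hM').trans (hdec X' hX' hn.2 M' hM').symm)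
  · intro X hX
    obtain ⟨M, hM, hMX⟩ := (Finset.mem_filter.1 hX).2
    have h1 := sum_mamcProb (t := t) (N := N) h X.2
      fun Y => decode π s T t v (payloadRows n N v) Y = none
    refine (Eq.trans ?_ h1).le.trans ?_
    · refine Finset.sum_congr rfl fun y _ => ?_
      congr!
    · rw [← hMX]
      exact mamcProb_failure_le h hT hμ hm htv htN hv hvk hM

end Code

end MatrixChannel

namespace MatrixChannel

/-! ### Asymptotics -/

theorem natCast_tsub_eq_max (a b : ℕ) : ((a - b : ℕ) : ℝ) = max ((a : ℝ) - b) 0 := by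
  rcases le_total b a with hab | hab
  · rw [Nat.cast_sub hab, max_eq_left]
    exact sub_nonneg.2 (by exact_mod_cast hab)
  · rw [Nat.sub_eq_zero_of_le hab, Nat.cast_zero, max_eq_right]
    exact sub_nonpos.2 (by exact_mod_cast hab)

theorem mamcBound_eq {s : ℕ} (n N t : ℝ) (μ : Fin s → ℝ) : mamcBound n N t μ =
    (∑ i, min n (N - t) * (μ i - t - min n (N - t))) / (n * ∑ i, μ i) := by
  unfold mamcBound
  split_ifs with hnt
  · rw [min_eq_left (by linarith)]
    congr 1
    exact Finset.sum_congr rfl fun i _ => by ring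
  · rw [min_eq_right (by linarith)]
    congr 1
    exact Finset.sum_congr rfl fun i _ => by ring

section Limits

variable {s : ℕ} {n N t m v : ℕ → ℕ} {μ : ℕ → Fin s → ℕ} {nb Nb tb : ℝ} {μb : Fin s → ℝ}

theorem tendsto_div_of_sub (hm : Tendsto m atTop atTop) (ht : ∀ j, (t j : ℝ) = tb * m j)
    (hv : Tendsto (fun j => ((v j : ℝ) - t j) / m j) atTop (𝓝 0)) :
    Tendsto (fun j => (v j : ℝ) / m j) atTop (𝓝 tb) := by
  have h1 : (fun j => (v j : ℝ) / m j) =ᶠ[atTop] fun j => ((v j : ℝ) - t j) / m j + tb := by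
    filter_upwards [hm.eventually_gt_atTop 0] with j hj
    have : (m j : ℝ) ≠ 0 := by exact_mod_cast hj.ne'
    rw [ht]
    field_simp
    ring
  rw [tendsto_congr' h1]
  simpa using hv.add_const tb

theorem tendsto_rate (hm : Tendsto m atTop atTop)
    (hn : ∀ j, (n j : ℝ) = nb * m j) (hN : ∀ j, (N j : ℝ) = Nb * m j)
    (ht : ∀ j, (t j : ℝ) = tb * m j) (hμ : ∀ j i, (μ j i : ℝ) = μb i * m j)
    (htN : tb ≤ Nb) (hNμ : ∀ i, Nb ≤ μb i)
    (hv : Tendsto (fun j => ((v j : ℝ) - t j) / m j) atTop (𝓝 0)) :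
    Tendsto (fun j => ((∑ i, payloadRows (n j) (N j) (v j) *
        (μ j i - v j - payloadRows (n j) (N j) (v j)) : ℕ) : ℝ) / ((n j : ℝ) * ∑ i, (μ j i : ℝ)))
      atTop (𝓝 (mamcBound nb Nb tb μb)) := by
  have hvm := tendsto_div_of_sub hm ht hv
  have hk : Tendsto (fun j => (payloadRows (n j) (N j) (v j) : ℝ) / m j) atTop
      (𝓝 (min nb (Nb - tb))) := by
    have h1 : (fun j => (payloadRows (n j) (N j) (v j) : ℝ) / m j) =ᶠ[atTop]
        fun j => min nb (max (Nb - v j / m j) 0) := by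
      filter_upwards [hm.eventually_gt_atTop 0] with j hj
      have hpos : (0 : ℝ) < m j := by exact_mod_cast hj
      rw [payloadRows, Nat.cast_min, natCast_tsub_eq_max, hn, hN, div_eq_iff hpos.ne',
        min_mul_of_nonneg _ _ hpos.le, max_mul_of_nonneg _ _ hpos.le, zero_mul, sub_mul,
        div_mul_cancel₀ _ hpos.ne']
    rw [tendsto_congr' h1]
    have h2 := tendsto_const_nhds (x := nb).min ((tendsto_const_nhds (x := Nb).sub hvm).max
      (tendsto_const_nhds (x := (0 : ℝ))))
    rwa [max_eq_left (by linarith)] at h2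
  have hd : ∀ i, Tendsto (fun j => ((μ j i - v j - payloadRows (n j) (N j) (v j) : ℕ) : ℝ) / m j)
      atTop (𝓝 (μb i - tb - min nb (Nb - tb))) := by
    intro i
    have h1 : (fun j => ((μ j i - v j - payloadRows (n j) (N j) (v j) : ℕ) : ℝ) / m j) =ᶠ[atTop]
        fun j => max (μb i - v j / m j - payloadRows (n j) (N j) (v j) / m j) 0 := by
      filter_upwards [hm.eventually_gt_atTop 0] with j hj
      have hpos : (0 : ℝ) < m j := by exact_mod_cast hj
      rw [Nat.sub_sub, natCast_tsub_eq_max, hμ, div_eq_iff hpos.ne', max_mul_of_nonneg _ _ hpos.le,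
        zero_mul, sub_mul, sub_mul, div_mul_cancel₀ _ hpos.ne', div_mul_cancel₀ _ hpos.ne',
        Nat.cast_add, sub_sub]
    rw [tendsto_congr' h1]
    have h2 := (((tendsto_const_nhds (x := μb i)).sub hvm).sub hk).max
      (tendsto_const_nhds (x := (0 : ℝ)))
    rwa [max_eq_left] at h2
    have := hNμ i
    have := min_le_right nb (Nb - tb)
    linarith
  have h1 : (fun j => ((∑ i, payloadRows (n j) (N j) (v j) *
        (μ j i - v j - payloadRows (n j) (N j) (v j)) : ℕ) : ℝ) / ((n j : ℝ) * ∑ i, (μ j i : ℝ)))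
      =ᶠ[atTop] fun j => (∑ i, (payloadRows (n j) (N j) (v j) : ℝ) / m j *
        (((μ j i - v j - payloadRows (n j) (N j) (v j) : ℕ) : ℝ) / m j)) / (nb * ∑ i, μb i) := by
    filter_upwards [hm.eventually_gt_atTop 0] with j hj
    have hpos : (0 : ℝ) < m j := by exact_mod_cast hj
    simp_rw [hμ, ← Finset.sum_mul, hn]
    rw [Nat.cast_sum]
    simp_rw [div_mul_div_comm, ← Finset.sum_div, Nat.cast_mul]
    rw [div_div]
    congr 1
    ring
  rw [tendsto_congr' h1, mamcBound_eq]
  exact (tendsto_finsetSum _ fun i _ => hk.mul (hd i)).div_const _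

theorem tendsto_failure {q : ℕ} (hq : 2 ≤ q)
    (hv : Tendsto (fun j => (v j : ℝ) - t j) atTop atTop) :
    Tendsto (fun j => 2 / (q : ℝ) ^ (v j - t j)) atTop (𝓝 0) := by
  have h1 : Tendsto (fun j => v j - t j) atTop atTop := by
    rw [← tendsto_natCast_atTop_iff (R := ℝ)]
    refine tendsto_atTop_mono (fun j => ?_) hv
    rw [natCast_tsub_eq_max]
    exact le_max_left _ _
  exact ((tendsto_pow_atTop_atTop_of_one_lt (by exact_mod_cast hq : (1 : ℝ) < q)).comp
    h1).const_div_atTop 2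

theorem eventually_traps_le (hm : Tendsto m atTop atTop) (ht : ∀ j, (t j : ℝ) = tb * m j)
    (hμ : ∀ j i, (μ j i : ℝ) = μb i * m j) (htμ : ∀ i, tb < μb i)
    (hv : Tendsto (fun j => ((v j : ℝ) - t j) / m j) atTop (𝓝 0)) :
    ∀ᶠ j in atTop, ∀ i, v j ≤ μ j i := by
  rw [eventually_all]
  intro i
  filter_upwards [hm.eventually_gt_atTop 0,
    (tendsto_div_of_sub hm ht hv).eventually_lt_const (htμ i)] with j hj hlt
  have hpos : (0 : ℝ) < m j := by exact_mod_cast hj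
  rw [div_lt_iff₀ hpos, ← hμ] at hlt
  exact_mod_cast hlt.le

theorem eventually_le_traps (hv : Tendsto (fun j => (v j : ℝ) - t j) atTop atTop) :
    ∀ᶠ j in atTop, t j ≤ v j := by
  filter_upwards [hv.eventually_ge_atTop 0] with j hj
  exact_mod_cast sub_nonneg.1 hj

theorem tendsto_sqrt_div (hm : Tendsto m atTop atTop) :
    Tendsto (fun j => (Nat.sqrt (m j) : ℝ) / m j) atTop (𝓝 0) := by
  have h1 : Tendsto (fun j => (Real.sqrt (m j))⁻¹) atTop (𝓝 0) :=
    tendsto_inv_atTop_zero.comp (Real.tendsto_sqrt_atTop.comp (tendsto_natCast_atTop_atTop.comp hm))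
  refine squeeze_zero (fun j => by positivity) (fun j => ?_) h1
  calc (Nat.sqrt (m j) : ℝ) / m j ≤ Real.sqrt (m j) / m j :=
        div_le_div_of_nonneg_right Real.nat_sqrt_le_real_sqrt (by positivity)
    _ = _ := by rw [Real.sqrt_div_self', one_div]

theorem tendsto_natSqrt (hm : Tendsto m atTop atTop) :
    Tendsto (fun j => (Nat.sqrt (m j) : ℝ)) atTop atTop := by
  have h1 : Tendsto Nat.sqrt atTop atTop :=
    tendsto_atTop_atTop.2 fun b => ⟨b * b, fun a ha => Nat.le_sqrt.2 ha⟩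
  exact tendsto_natCast_atTop_atTop.comp (h1.comp hm)

end Limits

section Asymptotic

variable {R : Type*} [CommRing R] [Fintype R] {π : R} {q s : ℕ} {T : Set R}
  {n N t m : ℕ → ℕ} {μ : ℕ → Fin s → ℕ} {nb Nb tb : ℝ} {μb : Fin s → ℝ}

theorem tendsto_capacity (h : IsFiniteChainRing π q s) (hT : IsResidueSystem π T)
    (hm : Tendsto m atTop atTop) (hμ : ∀ j, Monotone (μ j)) (hμm : ∀ j i, μ j i ≤ m j)
    (hn : ∀ j, (n j : ℝ) = nb * m j) (hN : ∀ j, (N j : ℝ) = Nb * m j)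
    (ht : ∀ j, (t j : ℝ) = tb * m j) (hμb : ∀ j i, (μ j i : ℝ) = μb i * m j)
    (hnN : ∀ j, n j ≤ N j) (htN : ∀ j, t j ≤ N j)
    (hNμ : ∀ j i, 2 * N j ≤ μ j i) (htN' : tb ≤ Nb) (hNμ' : ∀ i, Nb ≤ μb i)
    (htμ : ∀ i, tb < μb i) :
    Tendsto (fun j => mamcCapacity π q (fun _ => t j) (μ j) (n j) (N j) (m j) /
      ((n j : ℝ) * ∑ i, (μ j i : ℝ))) atTop (𝓝 (mamcBound nb Nb tb μb)) := by
  have hden : ∀ j, 0 ≤ (n j : ℝ) * ∑ i, (μ j i : ℝ) := fun j => by positivity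
  have hsub : ∀ j, ((t j + Nat.sqrt (m j) : ℕ) : ℝ) - t j = Nat.sqrt (m j) := fun j => by
    push_cast; ring
  have hv₁ : Tendsto (fun j => ((t j + Nat.sqrt (m j) : ℕ) : ℝ) - t j) atTop atTop := by
    simp_rw [hsub]; exact tendsto_natSqrt hm
  have hv₂ : Tendsto (fun j => (((t j + Nat.sqrt (m j) : ℕ) : ℝ) - t j) / m j) atTop (𝓝 0) := by
    simp_rw [hsub]; exact tendsto_sqrt_div hm
  have hlow := ((tendsto_const_nhds (x := (1 : ℝ))).sub (tendsto_failure h.two_le_q hv₁)).mul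
    (tendsto_rate hm hn hN ht hμb htN' hNμ' hv₂)
  rw [sub_zero, one_mul] at hlow
  have hup₁ := tendsto_rate (v := t) hm hn hN ht hμb htN' hNμ' (by simp)
  have hup₂ : Tendsto (fun j => (5 * s * N j : ℝ) / ((n j : ℝ) * ∑ i, (μ j i : ℝ))) atTop (𝓝 0) := by
    have h1 : (fun j => (5 * s * N j : ℝ) / ((n j : ℝ) * ∑ i, (μ j i : ℝ))) =ᶠ[atTop]
        fun j => (5 * s * Nb / (nb * ∑ i, μb i)) * (m j : ℝ)⁻¹ := by
      filter_upwards [hm.eventually_gt_atTop 0] with j hj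
      have hpos : (m j : ℝ) ≠ 0 := by exact_mod_cast hj.ne'
      simp_rw [hμb, ← Finset.sum_mul, hn, hN]
      rw [show nb * (m j : ℝ) * ((∑ i, μb i) * m j) = nb * (∑ i, μb i) * m j * m j by ring,
        ← mul_assoc, mul_div_mul_right _ _ hpos, div_mul_eq_div_div, div_eq_mul_inv _ (m j : ℝ)]
    rw [tendsto_congr' h1]
    simpa using (tendsto_inv_atTop_zero.comp (tendsto_natCast_atTop_atTop.comp hm)).const_mul
      (5 * s * Nb / (nb * ∑ i, μb i))
  have hup := hup₁.add hup₂
  rw [add_zero] at hup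
  refine tendsto_of_tendsto_of_tendsto_of_le_of_le' hlow hup ?_ (Eventually.of_forall fun j => ?_)
  · filter_upwards [eventually_traps_le hm ht hμb htμ hv₂] with j hj
    rw [← mul_div_assoc]
    exact div_le_div_of_nonneg_right (le_mamcCapacity h hT (hμ j) (hμm j) (hnN j) (htN j) (hNμ j)
      (Nat.le_add_right _ _) hj) (hden j)
  · rw [← add_div]
    refine div_le_div_of_nonneg_right ((mamcCapacity_le h hT (hμ j) (hμm j) (hnN j) (htN j)
      (hNμ j)).trans_eq ?_) (hden j)
    have : ∀ i, μ j i - payloadRows (n j) (N j) (t j) - t j =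
        μ j i - t j - payloadRows (n j) (N j) (t j) := fun i => Nat.sub_right_comm _ _ _
    rw [show min (n j) (N j - t j) = payloadRows (n j) (N j) (t j) from rfl]
    simp_rw [this]
    push_cast
    rfl

end Asymptotic

end MatrixChannel

open MatrixChannel in
theorem mainTheorem12 :
    ∃ C : ℕ, ∀ {R : Type*} [CommRing R] [Fintype R] (π : R) (q s : ℕ),
      MatrixChannel.IsFiniteChainRing π q s →
    ∀ T : Set R, MatrixChannel.IsResidueSystem π T →
    -- the decoder is computed by the elimination algorithm, in cubic time
    (∀ (N m t v k : ℕ) (Y : Matrix (Fin N) (Fin m) R), 0 < m →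
      MatrixChannel.IsRowCanonicalFormOf π s T Y (MatrixChannel.rcf π s T Y) ∧
      (MatrixChannel.decodeAlgorithm π s T t v k Y).val = MatrixChannel.decode π s T t v k Y ∧
      (MatrixChannel.decodeAlgorithm π s T t v k Y).cost ≤ C * (N * m * min N m)) ∧
    -- the scheme at finite size: code size, zero error probability, failure probability
    (∀ (n N t v m : ℕ) (μ : Fin s → ℕ), Monotone μ → MatrixChannel.shapeLen μ = m →
      n ≤ N → t ≤ N → (∀ i, 2 * N ≤ μ i) → t ≤ v → (∀ i, v ≤ μ i) →
      let k := MatrixChannel.payloadRows n N v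
      let code : Set (Matrix (Fin n) (Fin m) R) :=
        MatrixChannel.encode n '' MatrixChannel.messages π T μ m v k
      code ⊆ MatrixChannel.rowMatrices π μ n m ∧
      Nat.card code = q ^ (∑ i, k * (μ i - v - k)) ∧
      ∀ M ∈ MatrixChannel.messages π T μ m v k,
        MatrixChannel.mamcProb π (fun _ => t) μ N (MatrixChannel.encode n M)
          (fun Y => ∃ M', MatrixChannel.decode π s T t v k Y = some M' ∧ M' ≠ M) = 0 ∧
        MatrixChannel.mamcProb π (fun _ => t) μ N (MatrixChannel.encode n M)
          (fun Y => MatrixChannel.decode π s T t v k Y = none) ≤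
            2 * (t : ℝ) / (q : ℝ) ^ (1 + v - t) ∧
        (0 < t → MatrixChannel.mamcProb π (fun _ => t) μ N (MatrixChannel.encode n M)
          (fun Y => MatrixChannel.decode π s T t v k Y = none) <
            2 * (t : ℝ) / (q : ℝ) ^ (1 + v - t))) ∧
    -- asymptotics, with fixed ratios
    (∀ (n N t m : ℕ → ℕ) (μ : ℕ → Fin s → ℕ) (nb Nb tb : ℝ) (μb : Fin s → ℝ),
      Tendsto m atTop atTop →
      (∀ j, Monotone (μ j)) → (∀ j, MatrixChannel.shapeLen (μ j) = m j) →
      (∀ j, (n j : ℝ) = nb * m j) → (∀ j, (N j : ℝ) = Nb * m j) → (∀ j, (t j : ℝ) = tb * m j) →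
      (∀ j i, (μ j i : ℝ) = μb i * m j) →
      0 < nb → (∀ j, n j ≤ N j) → (∀ j, t j ≤ N j) → (∀ j i, 2 * N j ≤ μ j i) →
      -- the upper bound on the asymptotic capacity, which is attained
      Tendsto (fun j =>
          MatrixChannel.mamcCapacity π q (fun _ => t j) (μ j) (n j) (N j) (m j) /
            ((n j : ℝ) * ∑ i, (μ j i : ℝ)))
        atTop (𝓝 (MatrixChannel.mamcBound nb Nb tb μb)) ∧
      -- the scheme attains it
      ∀ v : ℕ → ℕ, Tendsto (fun j => (v j : ℝ) - t j) atTop atTop →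
        Tendsto (fun j => ((v j : ℝ) - t j) / m j) atTop (𝓝 0) →
        Tendsto (fun j =>
            Real.logb q (Nat.card (MatrixChannel.encode (R := R) (m := m j) (v := v j) (n j) ''
                MatrixChannel.messages π T (μ j) (m j) (v j)
                  (MatrixChannel.payloadRows (n j) (N j) (v j)))) /
              ((n j : ℝ) * ∑ i, (μ j i : ℝ)))
          atTop (𝓝 (MatrixChannel.mamcBound nb Nb tb μb)) ∧
        ∀ ε > (0 : ℝ), ∀ᶠ j in atTop,
          ∀ M ∈ MatrixChannel.messages π T (μ j) (m j) (v j)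
              (MatrixChannel.payloadRows (n j) (N j) (v j)),
            MatrixChannel.mamcProb π (fun _ => t j) (μ j) (N j) (MatrixChannel.encode (n j) M)
              (fun Y => ∃ M', MatrixChannel.decode π s T (t j) (v j)
                (MatrixChannel.payloadRows (n j) (N j) (v j)) Y = some M' ∧ M' ≠ M) = 0 ∧
            MatrixChannel.mamcProb π (fun _ => t j) (μ j) (N j) (MatrixChannel.encode (n j) M)
              (fun Y => MatrixChannel.decode π s T (t j) (v j)
                (MatrixChannel.payloadRows (n j) (N j) (v j)) Y = none) < ε) := by
  refine ⟨30, fun {R} _ _ π q s h T hT => ⟨?_, ?_, ?_⟩⟩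
  · intro N m t v k Y hm
    exact ⟨rcf_spec h hT Y, decodeAlgorithm_val h hT t v k Y, cost_decodeAlgorithm_le hm t v k Y⟩
  · intro n N t v m μ hμ hlen hnN htN hN htv hv
    have hμm : ∀ i, μ i ≤ m := fun i => hlen ▸ le_shapeLen μ i
    have hvk : v + payloadRows n N v ≤ m := (add_payloadRows_le (hv ⟨0, h.s_pos⟩)
      (by have := hN ⟨0, h.s_pos⟩; omega)).trans (hμm _)
    refine ⟨encode_messages_subset h hv hvk, card_code h hμ hμm hN hv, fun M hM =>
      ⟨not_decode_ne h hT hvk hM, ?_, fun ht => mamcProb_failure_lt h hT hμ hμm ht htv htN hv hvk hM⟩⟩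
    rcases Nat.eq_zero_or_pos t with rfl | ht
    · rw [mamcProb_failure_of_rank_zero h hT hμ hvk hM]
      positivity
    · exact (mamcProb_failure_lt h hT hμ hμm ht htv htN hv hvk hM).le
  · intro n N t m μ nb Nb tb μb hm hμ hlen hn hN ht hμb hnb hnN htN hNμ
    have hμm : ∀ j i, μ j i ≤ m j := fun j i => hlen j ▸ le_shapeLen (μ j) i
    obtain ⟨j₀, hj₀⟩ := (hm.eventually_gt_atTop 0).exists
    have hpos : (0 : ℝ) < m j₀ := by exact_mod_cast hj₀
    have htN' : tb ≤ Nb := le_of_mul_le_mul_right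
      (by rw [← ht, ← hN]; exact_mod_cast htN j₀) hpos
    have hNb : 0 < Nb := hnb.trans_le (le_of_mul_le_mul_right
      (by rw [← hn, ← hN]; exact_mod_cast hnN j₀) hpos)
    have hNμ' : ∀ i, 2 * Nb ≤ μb i := fun i => le_of_mul_le_mul_right
      (by rw [mul_assoc, ← hN, ← hμb]; exact_mod_cast hNμ j₀ i) hpos
    have hNμb : ∀ i, Nb ≤ μb i := fun i => by have := hNμ' i; linarith
    have htμ : ∀ i, tb < μb i := fun i => by have := hNμ' i; linarith
    refine ⟨tendsto_capacity h hT hm hμ hμm hn hN ht hμb hnN htN hNμ htN' hNμb htμ,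
      fun v hv₁ hv₂ => ⟨?_, fun ε hε => ?_⟩⟩
    · refine (tendsto_rate hm hn hN ht hμb htN' hNμb hv₂).congr' ?_
      filter_upwards [eventually_traps_le hm ht hμb htμ hv₂] with j hj
      rw [card_code h (hμ j) (hμm j) (hNμ j) hj, Nat.cast_pow, Real.logb_pow,
        Real.logb_self_eq_one (by exact_mod_cast h.two_le_q), mul_one]
    · filter_upwards [eventually_traps_le hm ht hμb htμ hv₂, eventually_le_traps hv₁,
        (tendsto_failure h.two_le_q hv₁).eventually_lt_const hε] with j hj htv hlt M hM
      have hvk : v j + payloadRows (n j) (N j) (v j) ≤ m j :=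
        (add_payloadRows_le (hj ⟨0, h.s_pos⟩)
          (by have := hNμ j ⟨0, h.s_pos⟩; omega)).trans (hμm j _)
      exact ⟨not_decode_ne h hT hvk hM,
        (mamcProb_failure_le h hT (hμ j) (hμm j) htv (htN j) hj hvk hM).trans_lt hlt⟩
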